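/- Let $M$ be a smooth connected surface and $U$ a smooth compact connected one-dimensional manifold (a circle), and let $\dot q=f(q,u)$, $q\in M$, $u\in U$, be a smooth control system satisfying the regularity conditions $$f\wedge\frac{\partial f}{\partial u}\neq 0,\qquad \frac{\partial f}{\partial u}\wedge\frac{\partial^2 f}{\partial u^2}\neq 0\qquad\text{on } M\times U,$$ and such that for every $q$ the velocity curve $u\mapsto f(q,u)$ in $T_qM$ is convex, i.e. for every $u\in U$ there is a nonzero covector $p\in T_q^*M$ with $\langle p,f(q,w)\rangle\le\langle p,f(q,u)\rangle$ for all $w\in U$. Let $h(\lambda)=\max_{u\in U}\bigl(\langle\lambda,f(q,u)\rangle-1\bigr)$, $\lambda\in T_q^*M$, be the maximized Hamiltonian of the time-minimization problem, let $\vec h$ be its Hamiltonian vector field, defined by $\sigma(\cdot,\vec h)=dh$ with $\sigma$ the canonical symplectic form of $T^*M$, and let $\mathcal H=h^{-1}(e)$ be a level set with $e>-1$. Let $s$ be the restriction to $\mathcal H$ of the Liouville form $p\,dq$, and let $v$ be the vertical vector field on $\mathcal H$ (unique up to sign, locally on $M$) and $b$ the smooth function on $\mathcal H$ such that $$L_v^2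 s=-s+b\,L_v s.$$ Let the curvature $\kappa$ be the function on $\mathcal H$ defined by $[\vec h,[v,\vec h]]=\kappa v$. The system is called flat if every point of $M$ has an open neighbourhood $O$ over which it is feedback equivalent to a system of the form $\dot{\tilde q}=g(\tilde u)$ on an open set $\tilde O\subset\mathbb R^2$; that is, there are a smooth $g$ and a diffeomorphism $\Theta(q,u)=(\phi(q),\psi(q,u))$ of $O\times U$ onto $\tilde O\times U$, with $\phi:O\to\tilde O$ a diffeomorphism, such that $T_q\phi\,(f(q,u))=g(\psi(q,u))$ for all $(q,u)\in O\times U$. Then the system is flat if and only if the three functions $\kappa$, $L_{\vec h}b$ and $L_{[v,\vec h]}b$ vanish identically on $\mathcal H$. -/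

import Mathlib

open scoped Manifold ContDiff
open Set

noncomputable section

namespace FlatControl

/-- The coordinate plane. -/
abbrev Plane : Type := EuclideanSpace ℝ (Fin 2)

/-- The cotangent bundle of the coordinate plane: pairs `(q, p)` with `p` a covector at `q`. -/
abbrev Phase : Type := Plane × (Plane →L[ℝ] ℝ)

/-! ### Control systems on a surface -/

section Systems

variable {M U : Type*}
  [TopologicalSpace M] [ChartedSpace Plane M]
  [TopologicalSpace U] [ChartedSpace ℝ U]

/-- `q' = f (q, u)` is a smooth control system on the surface `M` with control set `U`. -/
def IsControlSystem [IsManifold (𝓡 2) ∞ M] (f : (q : M) → U → TangentSpace (𝓡 2) q) : Prop :=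
  ContMDiff ((𝓡 2).prod 𝓘(ℝ)) (𝓡 2).tangent ∞
    (fun x : M × U => (⟨x.1, f x.1 x.2⟩ : TangentBundle (𝓡 2) M))

/-- The curve `u ↦ f (q, u)` in the plane `T_q M`, read in a chart `c` of `U`. -/
def velocityCurve (f : (q : M) → U → TangentSpace (𝓡 2) q) (c : OpenPartialHomeomorph U ℝ)
    (q : M) : ℝ → Plane :=
  fun t => f q (c.symm t)

/-- The regularity conditions `f ∧ ∂f/∂u ≠ 0` and `∂f/∂u ∧ ∂²f/∂u² ≠ 0`. -/
def IsRegular (f : (q : M) → U → TangentSpace (𝓡 2) q) : Prop :=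
  ∀ c ∈ IsManifold.maximalAtlas 𝓘(ℝ) ∞ U, ∀ q : M, ∀ t ∈ c.target,
    LinearIndependent ℝ ![velocityCurve f c q t, deriv (velocityCurve f c q) t] ∧
    LinearIndependent ℝ
      ![deriv (velocityCurve f c q) t, deriv (deriv (velocityCurve f c q)) t]

/-- The curve of admissible velocities at each point is convex: each of its points lies on
a supporting line of the whole curve. -/
def HasConvexVelocities (f : (q : M) → U → TangentSpace (𝓡 2) q) : Prop :=
  ∀ (q : M) (u : U), ∃ p : TangentSpace (𝓡 2) q →L[ℝ] ℝ, p ≠ 0 ∧ ∀ w : U, p (f q w) ≤ p (f q u)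

/-- Feedback equivalence of the system `f` over the open set `O` with the system `g` over
the open set `O'`: a diffeomorphism `Θ (q, u) = (φ q, ψ (q, u))` of `O × U` onto `O' × U'`,
where `φ` is a diffeomorphism of `O` onto `O'`, that carries `f` to `g`. -/
def FeedbackEquivalentOn {M' U' : Type*}
    [TopologicalSpace M'] [ChartedSpace Plane M'] [TopologicalSpace U'] [ChartedSpace ℝ U']
    (f : (q : M) → U → TangentSpace (𝓡 2) q) (O : Set M)
    (g : (q : M') → U' → TangentSpace (𝓡 2) q) (O' : Set M') : Prop :=
  ∃ (Θ : PartialDiffeomorph ((𝓡 2).prod 𝓘(ℝ)) ((𝓡 2).prod 𝓘(ℝ)) (M × U) (M' × U') ∞)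
    (φ : PartialDiffeomorph (𝓡 2) (𝓡 2) M M' ∞) (ψ : M → U → U'),
    Θ.source = O ×ˢ (univ : Set U) ∧ Θ.target = O' ×ˢ (univ : Set U') ∧
    φ.source = O ∧ φ.target = O' ∧
    (∀ q ∈ O, ∀ u : U, Θ (q, u) = (φ q, ψ q u)) ∧
    (∀ q ∈ O, ∀ u : U, mfderiv (𝓡 2) (𝓡 2) φ q (f q u) = g (φ q) (ψ q u))

/-- A system is flat if, near each point of the state space, it is feedback equivalent to a system
`q' = g (u)` over an open set of the plane. (The control set of the model can be taken to be
`U` itself, since `ψ (q, ·)` identifies the two control sets.) -/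
def IsFlat (f : (q : M) → U → TangentSpace (𝓡 2) q) : Prop :=
  ∀ q₀ : M, ∃ (O : Set M) (O' : Set Plane) (g : U → Plane),
    q₀ ∈ O ∧ IsOpen O ∧ IsOpen O' ∧ ContMDiff 𝓘(ℝ) (𝓡 2) ∞ g ∧
    FeedbackEquivalentOn f O (fun (_ : Plane) (u : U) => g u) O'

/-- The system `f` written in a chart `χ` of the state space. -/
def inChart (f : (q : M) → U → TangentSpace (𝓡 2) q) (χ : OpenPartialHomeomorph M Plane) :
    Plane → U → Plane :=
  fun x u => mfderiv (𝓡 2) (𝓡 2) χ (χ.symm x) (f (χ.symm x) u)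

end Systems

/-! ### Symplectic geometry of the cotangent bundle in a chart -/

/-- The Liouville form `p dq`. -/
def liouville (z : Phase) : Phase →L[ℝ] ℝ :=
  z.2.comp (ContinuousLinearMap.fst ℝ Plane (Plane →L[ℝ] ℝ))

/-- The symplectic form `σ = dp ∧ dq`. -/
def symplectic (X Y : Phase) : ℝ := X.2 Y.1 - Y.2 X.1

/-- The Hamiltonian vector field `(∂h/∂p, -∂h/∂q)` of the function `h`. -/
def hamVec (h : Phase → ℝ) (z : Phase) : Phase :=
  (∑ i : Fin 2,
      fderiv ℝ h z (0, EuclideanSpace.proj i) • EuclideanSpace.single i (1 : ℝ),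
    -((fderiv ℝ h z).comp (ContinuousLinearMap.inl ℝ Plane (Plane →L[ℝ] ℝ))))

/-- The defining relation `σ (·, hamVec h) = dh`. -/
theorem symplectic_hamVec (h : Phase → ℝ) (z X : Phase) :
    symplectic X (hamVec h z) = fderiv ℝ h z X := by
  have key : X.2 = ∑ i : Fin 2,
      X.2 (EuclideanSpace.single i (1 : ℝ)) •
        (EuclideanSpace.proj i : Plane →L[ℝ] ℝ) := by
    ext x
    have hx : x = ∑ i : Fin 2, x i • EuclideanSpace.single i (1 : ℝ) := by
      ext j; fin_cases j <;> simp
    conv_lhs => rw [hx]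
    simp [mul_comm]
  have hX : X = ((X.1, 0) : Phase) + (0, X.2) := by simp
  conv_rhs => rw [hX, map_add, key]
  have h0 : ((0 : Plane), ∑ i : Fin 2, X.2 (EuclideanSpace.single i (1 : ℝ)) •
        (EuclideanSpace.proj i : Plane →L[ℝ] ℝ))
      = ∑ i : Fin 2, X.2 (EuclideanSpace.single i (1 : ℝ)) •
        ((0 : Plane), (EuclideanSpace.proj i : Plane →L[ℝ] ℝ)) := by
    simp [Fin.sum_univ_two]
  rw [h0, map_sum]
  simp only [map_smul, symplectic, hamVec, Fin.sum_univ_two, map_add, smul_eq_mul,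
    neg_apply, ContinuousLinearMap.comp_apply, ContinuousLinearMap.inl_apply]
  ring

/-- The Lie derivative `L_X η` of a one-form `η` along a vector field `X`. -/
def lieDerivForm (X : Phase → Phase) (η : Phase → (Phase →L[ℝ] ℝ)) (z : Phase) :
    Phase →L[ℝ] ℝ :=
  fderiv ℝ η z (X z) + (η z).comp (fderiv ℝ X z)

/-- The Lie derivative `L_X b` of a function `b` along a vector field `X`. -/
def lieDeriv (X : Phase → Phase) (b : Phase → ℝ) (z : Phase) : ℝ := fderiv ℝ b z (X z)

/-- The maximized Hamiltonian `h (q, p) = max_u (⟨p, F (q, u)⟩ - 1)` of the time-minimization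
problem. -/
def maxHam {U : Type*} (F : Plane → U → Plane) (z : Phase) : ℝ :=
  ⨆ u : U, (z.2 (F z.1 u) - 1)

/-- The level set `h = e` over the coordinate domain `D`. -/
def levelSet (D : Set Plane) (h : Phase → ℝ) (e : ℝ) : Set Phase :=
  {z | z.1 ∈ D ∧ h z = e}

/-- `v` is the canonical vertical field of the level set `H = {h = e}` over `D`, and `b` is the
associated invariant: `v` is smooth, vertical, tangent to `H`, and `L_v² s = -s + b L_v s` holds
for the restriction `s` of the Liouville form to `H`.

The fields and functions are given on the complement of the zero section; only their restrictions
to `H` matter, since all derivatives below are taken along `H`. This determines `v` on `H` up to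
sign, and `(-v, -b)` is the other possible pair. -/
structure IsCanonicalField (D : Set Plane) (h : Phase → ℝ) (e : ℝ)
    (v : Phase → Phase) (b : Phase → ℝ) : Prop where
  smooth_field : ContDiffOn ℝ ∞ v {z : Phase | z.1 ∈ D ∧ z.2 ≠ 0}
  smooth_invariant : ContDiffOn ℝ ∞ b {z : Phase | z.1 ∈ D ∧ z.2 ≠ 0}
  vertical : ∀ z ∈ levelSet D h e, (v z).1 = 0
  tangent : ∀ z ∈ levelSet D h e, fderiv ℝ h z (v z) = 0
  structure_eq : ∀ z ∈ levelSet D h e, ∀ X : Phase, fderiv ℝ h z X = 0 →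
    lieDerivForm v (lieDerivForm v liouville) z X
      = -liouville z X + b z * lieDerivForm v liouville z X

/-- `κ` is the curvature on the level set `H`: `[h⃗, [v, h⃗]] = κ v`. -/
def IsCurvature (D : Set Plane) (h : Phase → ℝ) (e : ℝ) (v : Phase → Phase) (κ : Phase → ℝ) :
    Prop :=
  ∀ z ∈ levelSet D h e,
    VectorField.lieBracket ℝ (hamVec h) (VectorField.lieBracket ℝ v (hamVec h)) z = κ z • v z

/-- The invariants `κ`, `L_h⃗ b` and `L_[v, h⃗] b` of the level set `{h = e}` over `D`
vanish identically. (None of the three conditions depends on the choice of sign of `v`.) -/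
def InvariantsVanishOn (D : Set Plane) (h : Phase → ℝ) (e : ℝ) : Prop :=
  ∃ (v : Phase → Phase) (b κ : Phase → ℝ),
    IsCanonicalField D h e v b ∧ IsCurvature D h e v κ ∧
    ∀ z ∈ levelSet D h e,
      κ z = 0 ∧ lieDeriv (hamVec h) b z = 0 ∧
      lieDeriv (VectorField.lieBracket ℝ v (hamVec h)) b z = 0

/-- The feedback invariants `κ`, `L_h⃗ b` and `L_[v, h⃗] b` of the control system `f` vanish
identically on the level set `{h = e}` in the cotangent bundle, expressed in every chart. -/
def InvariantsVanish {M U : Type*} [TopologicalSpace M] [ChartedSpace Plane M]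
    (f : (q : M) → U → TangentSpace (𝓡 2) q) (e : ℝ) : Prop :=
  ∀ χ ∈ IsManifold.maximalAtlas (𝓡 2) ∞ M,
    InvariantsVanishOn χ.target (maxHam (inChart f χ)) e

end FlatControl

end

/-! The argument is local. In a chart, regularity and convexity make the maximizing control a smooth
function of a nonzero covector, so `h + 1` is smooth off the zero section, positive, homogeneous of
degree one and strongly convex across the rays (`IsRegularSystem.isSmoothHam`). Both implications
pass through straightening: a local diffeomorphism `φ` for which `h (q, π ∘ Dφ_q)` does not depend
on `q`.

If the system is flat, the flat coordinates straighten `h`, since the support function of the model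
curve is the same at every point (`exists_straightening_of_isFlat`). In the cotangent lift of a
straightening, `h`, `v` and `b` depend on the covector alone, while `h⃗` and `[v, h⃗]` are
horizontal with constant components. Hence these two fields commute and annihilate `b`, and the
three invariants vanish.

Conversely, suppose the invariants vanish. Parametrize the level set by a point and an angle, write
`P` for the covector and `Q = L_v P`, and let `X` be the field `h⃗`. Then `(P, Q)` is, up to the
factor `c = e + 1`, the coframe dual to the projections of `X` and `[v, X]`. The curvature condition
says `[X, [v, X]] = 0`, and the Jacobi identity with `X b = 0` forces `[v, [v, X]] = -X - b [v, X]`.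
So `X`, `[v, X]` and `v + ∂_t` span an involutive distribution, and Frobenius' theorem produces an
angle `ϑ (q, t)` that follows `v` in `t` and is tangent to `X` and `[v, X]` in `q`. Along it `b`
depends on `t` only, so `P` and `Q` solve the linear equation `P' = Q`, `Q' = -P + b Q` with
coefficients independent of `q`. On the slice `t = 0` both forms are closed, hence they are pulled
back from their values at the base point by the differential of a map `φ`. Uniqueness for the linear
equation extends this to all `t`, that is, to the whole fibre (`IsFlatFrame.exists_flattening`), and
homogeneity extends it off the level set (`IsSmoothHam.exists_straightening`).

A straightening equalizes the support functions of all velocity curves. By convexity the curves then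
coincide up to reparametrization, which is found smoothly by matching directions
(`IsRegularSystem.exists_control_change`). This is the required change of controls. -/

noncomputable section

namespace FlatControl

open Filter Topology VectorField
open scoped NNReal

/-! ### Linear algebra of the plane -/

/-- The dual plane. -/
abbrev Covec : Type := Plane →L[ℝ] ℝ

/-- The first basis vector of the plane. -/
abbrev e₁ : Plane := EuclideanSpace.single 0 (1 : ℝ)

/-- The second basis vector of the plane. -/
abbrev e₂ : Plane := EuclideanSpace.single 1 (1 : ℝ)

/-- The area form of the plane, as a map from vectors to covectors. -/
def area : Plane →L[ℝ] Covec :=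
  (EuclideanSpace.proj 0 : Covec).smulRight (EuclideanSpace.proj 1 : Covec) -
    (EuclideanSpace.proj 1 : Covec).smulRight (EuclideanSpace.proj 0 : Covec)

theorem area_apply (x y : Plane) : area x y = x 0 * y 1 - x 1 * y 0 := by
  simp [area]

theorem area_self (x : Plane) : area x x = 0 := by
  rw [area_apply]; ring

theorem area_swap (x y : Plane) : area x y = -area y x := by
  simp only [area_apply]; ring

theorem plane_eq (x : Plane) : x = x 0 • e₁ + x 1 • e₂ := by
  ext j; fin_cases j <;> simp

theorem covec_apply (ξ : Covec) (x : Plane) : ξ x = x 0 * ξ e₁ + x 1 * ξ e₂ := by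
  conv_lhs => rw [plane_eq x]
  simp

theorem covec_ext {ξ ζ : Covec} (h₁ : ξ e₁ = ζ e₁) (h₂ : ξ e₂ = ζ e₂) : ξ = ζ := by
  ext x; rw [covec_apply ξ, covec_apply ζ, h₁, h₂]

/-- Cramer's rule: it expands a vector in the basis `x, y`, and so shows that a covector vanishing
on two independent vectors is zero. -/
theorem area_smul_eq (x y z : Plane) : area x y • z = area z y • x + area x z • y := by
  ext j; fin_cases j <;> simp [area_apply] <;> ring

theorem covec_eq_zero {ξ : Covec} {x y : Plane} (hxy : area x y ≠ 0) (hx : ξ x = 0)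
    (hy : ξ y = 0) : ξ = 0 := by
  ext z
  have := congrArg ξ (area_smul_eq x y z)
  simp only [map_smul, map_add, hx, hy, smul_eq_mul, mul_zero, add_zero] at this
  simpa [hxy] using this

theorem area_ne_zero_iff {x y : Plane} : LinearIndependent ℝ ![x, y] ↔ area x y ≠ 0 := by
  rw [LinearIndependent.pair_iff]
  constructor
  · intro h h0
    have h1 := h (y 0) (-x 0) (by
      ext j; rw [area_apply] at h0; fin_cases j <;> simp <;> linarith)
    have h2 := h (y 1) (-x 1) (by
      ext j; rw [area_apply] at h0; fin_cases j <;> simp <;> linarith)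
    have h3 := h 1 0 (by
      ext j; fin_cases j
      · simpa using h1.2
      · simpa using h2.2)
    simp at h3
  · intro h s t hst
    have h1 := congrArg (fun z => area z y) hst
    have h2 := congrArg (fun z => area x z) hst
    simp [area_self, h] at h1 h2
    exact ⟨h1, h2⟩

theorem area_ne_zero_vec {x : Plane} (hx : x ≠ 0) : area x ≠ 0 := by
  intro h
  apply hx
  have h1 := congrArg (fun ξ : Covec => ξ e₁) h
  have h2 := congrArg (fun ξ : Covec => ξ e₂) h
  simp [area_apply] at h1 h2
  ext j; fin_cases j <;> simp [h1, h2]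

/-- The vector dual to a covector for the Euclidean structure. -/
def sharp : Covec →L[ℝ] Plane :=
  (ContinuousLinearMap.apply ℝ ℝ e₁).smulRight e₁ +
    (ContinuousLinearMap.apply ℝ ℝ e₂).smulRight e₂

theorem apply_sharp (ξ ζ : Covec) : ξ (sharp ζ) = ζ e₁ * ξ e₁ + ζ e₂ * ξ e₂ := by
  simp [sharp]

theorem apply_sharp_self_pos {ξ : Covec} (hξ : ξ ≠ 0) : 0 < ξ (sharp ξ) := by
  rw [apply_sharp]
  by_contra h
  apply hξ
  have h1 := mul_self_nonneg (ξ e₁)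
  have h2 := mul_self_nonneg (ξ e₂)
  apply covec_ext
  · simpa using mul_self_eq_zero.1 (le_antisymm (by linarith) h1)
  · simpa using mul_self_eq_zero.1 (le_antisymm (by linarith) h2)

/-- Two covectors with a common kernel vector are proportional. -/
theorem covec_eq_smul {ξ ζ : Covec} {x : Plane} (hx : x ≠ 0) (hζ : ζ ≠ 0) (h₁ : ξ x = 0)
    (h₂ : ζ x = 0) : ξ = (ξ (sharp ζ) / ζ (sharp ζ)) • ζ := by
  have hpos := (apply_sharp_self_pos hζ).ne'
  rw [← sub_eq_zero]
  refine covec_eq_zero (x := x) (y := sharp ζ) ?_ (by simp [h₁, h₂]) ?_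
  · intro h0
    obtain ⟨z, hz⟩ : ∃ z, area x z ≠ 0 := by
      by_contra! hall
      exact area_ne_zero_vec hx (by ext z; simpa using hall z)
    have := congrArg ζ (area_smul_eq x z (sharp ζ))
    simp only [map_smul, map_add, h₂, h0, smul_eq_mul, mul_zero, zero_mul, add_zero] at this
    exact (mul_ne_zero hz hpos) this
  · simp [div_mul_cancel₀ _ hpos]

/-- The determinant of a linear map of the plane. -/
def planeDet (A : Plane →L[ℝ] Plane) : ℝ := area (A e₁) (A e₂)

theorem area_map (A : Plane →L[ℝ] Plane) (x y : Plane) :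
    area (A x) (A y) = planeDet A * area x y := by
  conv_lhs => rw [plane_eq x, plane_eq y]
  simp only [map_add, map_smul, planeDet, area_self, add_apply, smul_apply, smul_eq_mul,
    area_swap (A e₂) (A e₁), area_apply x y]
  ring

theorem planeDet_ne_zero {A : Plane →L[ℝ] Plane} (hA : Function.Injective A) :
    planeDet A ≠ 0 := by
  rw [planeDet, ← area_ne_zero_iff, LinearIndependent.pair_iff]
  intro s t hst
  rw [← map_smul, ← map_smul, ← map_add] at hst
  have h0 := hA (hst.trans (map_zero A).symm)
  have h1 := congrArg (fun z : Plane => z 0) h0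
  have h2 := congrArg (fun z : Plane => z 1) h0
  simp at h1 h2
  exact ⟨h1, h2⟩

theorem two_le_infty : (2 : WithTop ℕ∞) ≤ ∞ :=
  WithTop.coe_le_coe.2 (le_top : (2 : ℕ∞) ≤ ⊤)

/-! ### Related vector fields -/

section Related

variable {E G : Type*} [NormedAddCommGroup E] [NormedSpace ℝ E]
  [NormedAddCommGroup G] [NormedSpace ℝ G]

/-- The bracket of fields that are related by a map are related by this map. -/
theorem lieBracket_related {Z : E → G} {X Y : E → E} {V W : G → G} {x : E}
    (hZ : ContDiffAt ℝ ∞ Z x) (hX : DifferentiableAt ℝ X x) (hY : DifferentiableAt ℝ Y x)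
    (hV : DifferentiableAt ℝ V (Z x)) (hW : DifferentiableAt ℝ W (Z x))
    (hXV : ∀ᶠ y in 𝓝 x, V (Z y) = fderiv ℝ Z y (X y))
    (hYW : ∀ᶠ y in 𝓝 x, W (Z y) = fderiv ℝ Z y (Y y)) :
    lieBracket ℝ V W (Z x) = fderiv ℝ Z x (lieBracket ℝ X Y x) := by
  have hdZ : DifferentiableAt ℝ Z x := hZ.differentiableAt (by simp)
  have hd2Z : DifferentiableAt ℝ (fderiv ℝ Z) x :=
    (hZ.fderiv_right (m := ∞) (by simp)).differentiableAt (by simp)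
  have hsymm : ∀ u w, fderiv ℝ (fderiv ℝ Z) x u w = fderiv ℝ (fderiv ℝ Z) x w u := by
    have : IsSymmSndFDerivAt ℝ Z x := hZ.isSymmSndFDerivAt (by
      rw [minSmoothness_of_isRCLikeNormedField]; exact two_le_infty)
    exact fun u w => this u w
  -- Differentiating the relation between two fields leaves a second derivative of `Z`; in the
  -- bracket these terms cancel by symmetry.
  have key : ∀ {T : E → E} {K : G → G}, DifferentiableAt ℝ T x → DifferentiableAt ℝ K (Z x) →
      (∀ᶠ y in 𝓝 x, K (Z y) = fderiv ℝ Z y (T y)) → ∀ u,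
      fderiv ℝ K (Z x) (fderiv ℝ Z x u) =
        fderiv ℝ (fderiv ℝ Z) x u (T x) + fderiv ℝ Z x (fderiv ℝ T x u) := by
    intro T K hT hK hTK u
    have h1 : fderiv ℝ (fun y => K (Z y)) x u = fderiv ℝ K (Z x) (fderiv ℝ Z x u) := by
      rw [show (fun y => K (Z y)) = K ∘ Z from rfl, fderiv_comp x hK hdZ]; rfl
    rw [← h1, Filter.EventuallyEq.fderiv_eq hTK, fderiv_clm_apply hd2Z hT]
    simp [add_comm]
  have hVx := hXV.self_of_nhds
  have hWx := hYW.self_of_nhds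
  rw [lieBracket, lieBracket, hVx, hWx, key hY hW hYW, key hX hV hXV, map_sub,
    hsymm (X x) (Y x)]
  abel

end Related

/-! ### Completely integrable systems of total differential equations -/

section Frobenius

variable {V : Type*} [NormedAddCommGroup V] [NormedSpace ℝ V]

/-- Linearity in the defect `ε`: a defect of order `‖δ‖²` gives an error of the same order with a
constant independent of `δ`. -/
theorem gronwallBound_zero_eq_mul (K ε x : ℝ) :
    gronwallBound 0 K ε x = ε * gronwallBound 0 K 1 x := by
  rcases eq_or_ne K 0 with rfl | hK
  · simp [gronwallBound_K0]
  · simp only [gronwallBound_of_K_ne_0 hK]; ring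

/-- Existence for a scalar ODE whose right-hand side is globally bounded and Lipschitz. -/
theorem exists_ode_solution {g : ℝ → ℝ → ℝ} {C : ℝ≥0}
    (hlip : ∀ s ∈ Icc (0 : ℝ) 1, LipschitzWith C (g s))
    (hcont : ∀ y, ContinuousOn (g · y) (Icc (0 : ℝ) 1))
    (hb : ∀ s ∈ Icc (0 : ℝ) 1, ∀ y, ‖g s y‖ ≤ C) (θ₀ : ℝ) :
    ∃ α : ℝ → ℝ, α 0 = θ₀ ∧
      ∀ s ∈ Icc (0 : ℝ) 1, HasDerivWithinAt α (g s (α s)) (Icc (0 : ℝ) 1) s := by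
  -- The radius of the ball is the bound `C` times the length one of the interval, so the solution
  -- cannot leave the ball before time one.
  have hp : IsPicardLindelof g (tmin := 0) (tmax := 1) ⟨0, by simp⟩ θ₀ C 0 C C :=
    { lipschitzOnWith := fun t ht => (hlip t ht).lipschitzOnWith
      continuousOn := fun y _ => hcont y
      norm_le := fun t ht y _ => hb t ht y
      mul_max_le := by simp }
  exact hp.exists_eq_forall_mem_Icc_hasDerivWithinAt₀

/-- A system `Dϑ = A (x, ϑ)` satisfying the Frobenius integrability condition, with bounds that
are uniform in the unknown, has a solution on the whole of a convex open set. -/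
theorem exists_hasFDerivAt_of_integrable {S : Set V} (hS : Convex ℝ S) (hSo : IsOpen S)
    {A : V × ℝ → V →L[ℝ] ℝ} {C : ℝ≥0}
    (hA : ∀ z ∈ S ×ˢ (univ : Set ℝ), DifferentiableAt ℝ A z)
    (hb : ∀ z ∈ S ×ˢ (univ : Set ℝ), ‖A z‖ ≤ C)
    (hb' : ∀ z ∈ S ×ˢ (univ : Set ℝ), ‖fderiv ℝ A z‖ ≤ C)
    (hlip : ∀ z ∈ S ×ˢ (univ : Set ℝ), ∀ z' ∈ S ×ˢ (univ : Set ℝ),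
      ‖fderiv ℝ A z' - fderiv ℝ A z‖ ≤ C * ‖z' - z‖)
    (hint : ∀ z ∈ S ×ˢ (univ : Set ℝ), ∀ u w,
      fderiv ℝ A z (u, A z u) w = fderiv ℝ A z (w, A z w) u)
    {x₀ : V} (hx₀ : x₀ ∈ S) (θ₀ : ℝ) :
    ∃ ϑ : V → ℝ, ϑ x₀ = θ₀ ∧ ∀ x ∈ S, HasFDerivAt ϑ (A (x, ϑ x)) x := by
  have hC : (0 : ℝ) ≤ C := C.2
  have hconv : Convex ℝ (S ×ˢ (univ : Set ℝ)) := hS.prod convex_univ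
  have hseg : ∀ x ∈ S, ∀ s ∈ Icc (0 : ℝ) 1, x₀ + s • (x - x₀) ∈ S := fun x hx s hs =>
    hS.add_smul_sub_mem hx₀ hx hs
  have hAlip : ∀ z ∈ S ×ˢ (univ : Set ℝ), ∀ z' ∈ S ×ˢ (univ : Set ℝ),
      ‖A z' - A z‖ ≤ C * ‖z' - z‖ := fun z hz z' hz' =>
    hconv.norm_image_sub_le_of_norm_fderiv_le hA hb' hz hz'
  have htaylor : ∀ z ∈ S ×ˢ (univ : Set ℝ), ∀ z' ∈ S ×ˢ (univ : Set ℝ),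
      ‖A z' - A z - fderiv ℝ A z (z' - z)‖ ≤ C * ‖z' - z‖ * ‖z' - z‖ := by
    intro z hz z' hz'
    refine (convex_segment z z').norm_image_sub_le_of_norm_fderiv_le' (𝕜 := ℝ)
      (fun y hy => hA y (hconv.segment_subset hz hz' hy)) (fun y hy => ?_)
      (left_mem_segment ℝ z z') (right_mem_segment ℝ z z')
    refine (hlip z hz y (hconv.segment_subset hz hz' hy)).trans ?_
    gcongr
    rw [segment_eq_image'] at hy
    obtain ⟨t, ht, rfl⟩ := hy
    rw [add_sub_cancel_left, norm_smul, Real.norm_of_nonneg ht.1]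
    exact mul_le_of_le_one_left (norm_nonneg _) ht.2
  have hlipray : ∀ x ∈ S, ∀ s ∈ Icc (0 : ℝ) 1, ∀ K : ℝ≥0, (C : ℝ) * ‖x - x₀‖ ≤ K →
      LipschitzWith K (fun y : ℝ => A (x₀ + s • (x - x₀), y) (x - x₀)) := by
    intro x hx s hs K hK
    refine LipschitzWith.of_dist_le_mul fun y y' => ?_
    rw [dist_eq_norm, dist_eq_norm, ← sub_apply]
    refine (ContinuousLinearMap.le_opNorm _ _).trans ?_
    have h1 := hAlip (x₀ + s • (x - x₀), y') ⟨hseg x hx s hs, mem_univ _⟩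
      (x₀ + s • (x - x₀), y) ⟨hseg x hx s hs, mem_univ _⟩
    rw [show ((x₀ + s • (x - x₀), y) : V × ℝ) - (x₀ + s • (x - x₀), y') = (0, y - y') by simp,
      show ‖((0, y - y') : V × ℝ)‖ = ‖y - y'‖ by simp [Prod.norm_def]] at h1
    calc _ ≤ C * ‖y - y'‖ * ‖x - x₀‖ := by gcongr
      _ = C * ‖x - x₀‖ * ‖y - y'‖ := by ring
      _ ≤ _ := by gcongr
  have hrayc : ∀ x ∈ S, ∀ y, ContinuousOn
      (fun s : ℝ => A (x₀ + s • (x - x₀), y) (x - x₀)) (Icc (0 : ℝ) 1) := by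
    intro x hx y s hs
    have h1 : ContinuousAt A (x₀ + s • (x - x₀), y) :=
      (hA _ ⟨hseg x hx s hs, mem_univ _⟩).continuousAt
    have h2 : ContinuousAt (fun s : ℝ => A (x₀ + s • (x - x₀), y)) s :=
      ContinuousAt.comp (f := fun s : ℝ => (x₀ + s • (x - x₀), y)) h1 (by fun_prop)
    exact (h2.clm_apply continuousAt_const).continuousWithinAt
  have hsol : ∀ x ∈ S, ∃ α : ℝ → ℝ, α 0 = θ₀ ∧ ∀ s ∈ Icc (0 : ℝ) 1,
      HasDerivWithinAt α (A (x₀ + s • (x - x₀), α s) (x - x₀)) (Icc (0 : ℝ) 1) s := by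
    intro x hx
    set K : ℝ≥0 := C * ‖x - x₀‖₊ with hK
    have hKc : (C : ℝ) * ‖x - x₀‖ = K := by simp [hK]
    refine exists_ode_solution (C := K) (g := fun s y => A (x₀ + s • (x - x₀), y) (x - x₀))
      (fun s hs => hlipray x hx s hs K hKc.le) (hrayc x hx) (fun s hs y => ?_) θ₀
    rw [← hKc]
    exact (ContinuousLinearMap.le_opNorm _ _).trans (by
      gcongr; exact hb _ ⟨hseg x hx s hs, mem_univ _⟩)
  choose! α hα0 hα using hsol
  have hIci : ∀ {β : ℝ → ℝ} {β' s : ℝ}, s ∈ Ico (0 : ℝ) 1 →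
      HasDerivWithinAt β β' (Icc (0 : ℝ) 1) s → HasDerivWithinAt β β' (Ici s) s := by
    intro β β' s hs h
    refine (h.mono (Icc_subset_Icc_left hs.1)).mono_of_mem_nhdsWithin ?_
    exact Icc_mem_nhdsGE hs.2
  -- The solution at `x` is the value at time one of the ordinary equation along the ray from `x₀`.
  -- At `x₀` itself the ray is constant and so is the solution.
  refine ⟨fun x => α x 1, ?_, fun x hx => ?_⟩
  · have h := dist_le_of_approx_trajectories_ODE (K := 0) (a := 0) (b := 1) (δ := 0) (εf := 0)
      (εg := 0) (v := fun _ _ => (0 : ℝ)) (f := α x₀) (g := fun _ => θ₀) (f' := fun _ => 0)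
      (g' := fun _ => 0) (fun _ => LipschitzWith.const _)
      (fun s hs => (hα x₀ hx₀ s hs).continuousWithinAt)
      (fun s hs => by
        simpa using hIci hs (hα x₀ hx₀ s (Ico_subset_Icc_self hs))) (by simp)
      continuousOn_const (fun s _ => hasDerivWithinAt_const _ _ _) (by simp)
      (by simp [hα0 x₀ hx₀]) 1 (by simp)
    simpa [gronwallBound_K0] using h
  · set w := x - x₀ with hw
    -- The first summand bounds the quadratic term left over after integrability is used, the second
    -- the Taylor remainder of `A` paired with the direction `w + δ`.
    set M : ℝ := C * (1 + C) + C * (1 + C) ^ 2 * (‖w‖ + 1) with hM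
    set K : ℝ≥0 := C * (‖w‖₊ + 1) with hK
    set B : ℝ := gronwallBound 0 K 1 1 with hB
    have hxw : x₀ + (1 : ℝ) • (x - x₀) = x := by simp
    rw [hasFDerivAt_iff_isLittleO_nhds_zero]
    have hsmall : ∀ᶠ δ : V in 𝓝 0, x + δ ∈ S ∧ ‖δ‖ < 1 := by
      refine Filter.Eventually.and ?_ ?_
      · have : ContinuousAt (fun δ : V => x + δ) 0 := by fun_prop
        exact this.eventually (hSo.mem_nhds (by simpa using hx))
      · exact Filter.eventually_of_mem (Metric.ball_mem_nhds (0 : V) one_pos) fun δ hδ =>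
        mem_ball_zero_iff.1 hδ
    refine Asymptotics.IsBigO.trans_isLittleO (g := fun δ : V => ‖δ‖ ^ 2) ?_
      (Asymptotics.isLittleO_norm_pow_id one_lt_two)
    refine Asymptotics.IsBigO.of_bound (M * B) ?_
    filter_upwards [hsmall] with δ ⟨hδS, hδ1⟩
    set y := x + δ with hy
    have hyw : y - x₀ = w + δ := by rw [hy, hw]; abel
    have hys : ∀ s : ℝ, x₀ + s • (y - x₀) = x₀ + s • (x - x₀) + s • δ := by
      intro s; rw [hyw, smul_add, add_assoc]
    have hwδ : ‖w + δ‖ ≤ ‖w‖ + 1 := (norm_add_le _ _).trans (by gcongr)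
    set z : ℝ → V × ℝ := fun s => (x₀ + s • (x - x₀), α x s) with hz
    have hzS : ∀ s ∈ Icc (0 : ℝ) 1, z s ∈ S ×ˢ (univ : Set ℝ) := fun s hs =>
      ⟨hseg x hx s hs, mem_univ _⟩
    have hzd : ∀ s ∈ Icc (0 : ℝ) 1, HasDerivWithinAt z (w, A (z s) w) (Icc (0 : ℝ) 1) s := by
      intro s hs
      refine HasDerivWithinAt.prodMk ?_ (hα x hx s hs)
      have : HasDerivAt (fun s : ℝ => x₀ + s • (x - x₀)) ((1 : ℝ) • (x - x₀)) s :=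
        ((hasDerivAt_id s).smul_const _).const_add _
      simpa using this.hasDerivWithinAt
    -- The first-order guess for the solution along the ray to `x + δ`. Integrability exchanges `w`
    -- and `δ` in its derivative, so it satisfies that ray equation up to `O(‖δ‖²)`; Gronwall's
    -- inequality then gives differentiability with derivative `A`.
    set χ : ℝ → ℝ := fun s => α x s + s * A (z s) δ with hχ
    set χ' : ℝ → ℝ := fun s => A (z s) w + (1 * A (z s) δ +
      s * fderiv ℝ A (z s) (w, A (z s) w) δ) with hχ'
    have hχd : ∀ s ∈ Icc (0 : ℝ) 1, HasDerivWithinAt χ (χ' s) (Icc (0 : ℝ) 1) s := by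
      intro s hs
      refine (hα x hx s hs).add ((hasDerivWithinAt_id _ _).mul ?_)
      have h1 := (hA _ (hzS s hs)).hasFDerivAt.comp_hasDerivWithinAt s (hzd s hs)
      have h2 := h1.clm_apply (hasDerivWithinAt_const s (Icc (0 : ℝ) 1) δ)
      simpa using h2
    have hbound : ∀ s ∈ Icc (0 : ℝ) 1,
        dist (χ' s) (A (x₀ + s • (y - x₀), χ s) (y - x₀)) ≤ M * ‖δ‖ ^ 2 := by
      intro s hs
      set d : V × ℝ := (s • δ, s * A (z s) δ) with hd
      have hzd' : (x₀ + s • (y - x₀), χ s) = z s + d := by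
        rw [hys]; rfl
      have hds : d = s • (δ, A (z s) δ) := by simp [hd]
      have hdn' : ‖((δ, A (z s) δ) : V × ℝ)‖ ≤ (1 + C) * ‖δ‖ := by
        rw [Prod.norm_def]
        refine max_le ?_ ?_
        · nlinarith [norm_nonneg δ]
        · have h3 := (A (z s)).le_opNorm δ
          have h4 := hb _ (hzS s hs)
          have h5 : ‖A (z s)‖ * ‖δ‖ ≤ C * ‖δ‖ := by gcongr
          simp only
          nlinarith [norm_nonneg δ]
      have hdn : ‖d‖ ≤ (1 + C) * ‖δ‖ := by
        rw [hds, norm_smul, Real.norm_of_nonneg hs.1]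
        exact (mul_le_of_le_one_left (norm_nonneg _) hs.2).trans hdn'
      have hR := htaylor (z s) (hzS s hs) (z s + d) (by
        rw [← hzd']; exact ⟨hseg y hδS s hs, mem_univ _⟩)
      rw [add_sub_cancel_left] at hR
      set R := A (z s + d) - A (z s) - fderiv ℝ A (z s) d with hRdef
      have hR' : ‖R‖ ≤ C * (1 + C) ^ 2 * ‖δ‖ ^ 2 := by
        refine hR.trans ?_
        calc C * ‖d‖ * ‖d‖ ≤ C * ((1 + C) * ‖δ‖) * ((1 + C) * ‖δ‖) := by gcongr
          _ = _ := by ring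
      have hexp : A (z s + d) = A (z s) + fderiv ℝ A (z s) d + R := by rw [hRdef]; abel
      have hfd : fderiv ℝ A (z s) d = s • fderiv ℝ A (z s) (δ, A (z s) δ) := by
        rw [hds, map_smul]
      have hdiff : χ' s - A (x₀ + s • (y - x₀), χ s) (y - x₀) =
          -(s * fderiv ℝ A (z s) (δ, A (z s) δ) δ) - R (w + δ) := by
        rw [hzd', hyw, hexp, hfd]
        simp only [hχ', add_apply, smul_apply, smul_eq_mul, map_add,
          hint (z s) (hzS s hs) w δ]
        ring
      rw [Real.dist_eq, hdiff]
      have hn1 : ‖fderiv ℝ A (z s) (δ, A (z s) δ) δ‖ ≤ C * (1 + C) * ‖δ‖ ^ 2 := by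
        refine ((fderiv ℝ A (z s) (δ, A (z s) δ)).le_opNorm δ).trans ?_
        have h6 := (fderiv ℝ A (z s)).le_opNorm (δ, A (z s) δ)
        have h7 : ‖fderiv ℝ A (z s)‖ * ‖((δ, A (z s) δ) : V × ℝ)‖ ≤ C * ((1 + C) * ‖δ‖) := by
          gcongr; exact hb' _ (hzS s hs)
        calc _ ≤ C * ((1 + C) * ‖δ‖) * ‖δ‖ := by gcongr; exact h6.trans h7
          _ = _ := by ring
      have hn2 : ‖R (w + δ)‖ ≤ C * (1 + C) ^ 2 * ‖δ‖ ^ 2 * (‖w‖ + 1) :=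
        (R.le_opNorm _).trans (by gcongr)
      rw [← Real.norm_eq_abs]
      refine (norm_sub_le _ _).trans ?_
      rw [norm_neg, norm_mul, Real.norm_of_nonneg hs.1]
      have hn3 : s * ‖fderiv ℝ A (z s) (δ, A (z s) δ) δ‖ ≤ C * (1 + C) * ‖δ‖ ^ 2 :=
        (mul_le_of_le_one_left (norm_nonneg _) hs.2).trans hn1
      rw [hM]
      linarith
    have hfin := dist_le_of_approx_trajectories_ODE_of_mem (K := K) (a := 0) (b := 1) (δ := 0)
      (εf := 0) (εg := M * ‖δ‖ ^ 2) (s := fun _ => univ)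
      (v := fun s u => A (x₀ + s • (y - x₀), u) (y - x₀)) (f := α y) (g := χ)
      (f' := fun s => A (x₀ + s • (y - x₀), α y s) (y - x₀)) (g' := χ')
      (fun s hs => (hlipray y hδS s (Ico_subset_Icc_self hs) K (by
        rw [hyw, hK]; push_cast; gcongr)).lipschitzOnWith)
      (fun s hs => (hα y hδS s hs).continuousWithinAt)
      (fun s hs => hIci hs (hα y hδS s (Ico_subset_Icc_self hs))) (by simp) (by simp)
      (fun s hs => (hχd s hs).continuousWithinAt)
      (fun s hs => hIci hs (hχd s (Ico_subset_Icc_self hs)))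
      (fun s hs => hbound s (Ico_subset_Icc_self hs)) (by simp)
      (by simp [hχ, hα0 y hδS, hα0 x hx]) 1 (by simp)
    rw [gronwallBound_zero_eq_mul] at hfin
    have hz1 : z 1 = (x, α x 1) := by simp [hz]
    rw [Real.dist_eq] at hfin
    simp only [hχ, hz1, one_mul] at hfin
    rw [Real.norm_eq_abs, norm_pow, norm_norm]
    calc |α y 1 - α x 1 - A (x, α x 1) δ| = |α y 1 - (α x 1 + A (x, α x 1) δ)| := by ring_nf
      _ ≤ _ := hfin
      _ = M * B * ‖δ‖ ^ 2 := by rw [hB]; simp; ring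

/-- Bootstrapping: if `ϑ` has `n` continuous derivatives, so does its differential `A (x, ϑ x)`, and
`ϑ` gains one more. -/
theorem contDiffOn_of_hasFDerivAt {S : Set V} (hSo : IsOpen S)
    {A : V × ℝ → V →L[ℝ] ℝ} (hA : ContDiffOn ℝ ∞ A (S ×ˢ (univ : Set ℝ))) {ϑ : V → ℝ}
    (hϑ : ∀ x ∈ S, HasFDerivAt ϑ (A (x, ϑ x)) x) : ContDiffOn ℝ ∞ ϑ S := by
  rw [contDiffOn_infty]
  intro n
  induction n with
  | zero =>
    simp only [Nat.cast_zero, contDiffOn_zero]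
    exact fun x hx => (hϑ x hx).continuousAt.continuousWithinAt
  | succ n ih =>
    push_cast
    rw [contDiffOn_succ_iff_fderiv_of_isOpen hSo]
    refine ⟨fun x hx => (hϑ x hx).differentiableAt.differentiableWithinAt, by simp, ?_⟩
    have h1 : ContDiffOn ℝ n (fun x => A (x, ϑ x)) S :=
      (hA.of_le (by exact_mod_cast le_top)).comp (contDiffOn_id.prodMk ih)
        (fun x hx => ⟨hx, mem_univ _⟩)
    exact h1.congr fun x hx => (hϑ x hx).fderiv

end Frobenius

/-! ### The maximized Hamiltonian of a regular convex system in coordinates -/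

/-- The covectors at the points of `D`, without the zero section. -/
def slit (D : Set Plane) : Set Phase := {z : Phase | z.1 ∈ D ∧ z.2 ≠ 0}

theorem isOpen_slit {D : Set Plane} (hD : IsOpen D) : IsOpen (slit D) :=
  (hD.preimage continuous_fst).inter (isOpen_ne.preimage continuous_snd)

theorem apply_hamVec (h : Phase → ℝ) (z : Phase) (ξ : Covec) :
    ξ (hamVec h z).1 = fderiv ℝ h z (0, ξ) := by
  have := symplectic_hamVec h z (0, ξ)
  simpa [symplectic] using this

theorem hamVec_snd (h : Phase → ℝ) (z : Phase) (y : Plane) :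
    (hamVec h z).2 y = -fderiv ℝ h z (y, 0) := by
  have := symplectic_hamVec h z (y, 0)
  simp [symplectic] at this
  linarith

theorem contDiffOn_hamVec {D : Set Plane} (hD : IsOpen D) {h : Phase → ℝ}
    (hh : ContDiffOn ℝ ∞ h (slit D)) : ContDiffOn ℝ ∞ (hamVec h) (slit D) := by
  have hd := hh.fderiv_of_isOpen (m := ∞) (isOpen_slit hD) (by simp)
  refine ContDiffOn.prodMk ?_ ?_
  · exact ContDiffOn.sum fun i _ => (hd.clm_apply contDiffOn_const).smul contDiffOn_const
  · exact (hd.clm_comp contDiffOn_const).neg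

/-- The properties of the maximized Hamiltonian that are used below: smoothness away from the zero
section, homogeneity, positivity and strong convexity on the fibres. -/
structure IsSmoothHam (D : Set Plane) (h : Phase → ℝ) : Prop where
  isOpen : IsOpen D
  smooth : ContDiffOn ℝ ∞ h (slit D)
  homogeneous : ∀ q ∈ D, ∀ p : Covec, ∀ t : ℝ, 0 < t → h (q, t • p) + 1 = t * (h (q, p) + 1)
  pos : ∀ z ∈ slit D, 0 < h z + 1
  convex : ∀ z ∈ slit D,
    0 < area (hamVec h z).1 (fderiv ℝ (hamVec h) z (0, area (hamVec h z).1)).1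

/-- A control system on a coordinate domain that is smooth, regular and convex. -/
structure IsRegularSystem {U : Type*} [TopologicalSpace U] [ChartedSpace ℝ U]
    (D : Set Plane) (F : Plane → U → Plane) : Prop where
  isOpen : IsOpen D
  smooth : ContMDiffOn ((𝓡 2).prod 𝓘(ℝ)) (𝓡 2) ∞ (fun x : Plane × U => F x.1 x.2)
    (D ×ˢ (univ : Set U))
  regular : ∀ c ∈ IsManifold.maximalAtlas 𝓘(ℝ) ∞ U, ∀ q ∈ D, ∀ t ∈ c.target,
    area (F q (c.symm t)) (deriv (fun s => F q (c.symm s)) t) ≠ 0 ∧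
    area (deriv (fun s => F q (c.symm s)) t) (deriv (deriv (fun s => F q (c.symm s))) t) ≠ 0
  convex : ∀ q ∈ D, ∀ u, ∃ p : Covec, p ≠ 0 ∧ ∀ w, p (F q w) ≤ p (F q u)

theorem maxHam_eq {U : Type*} [Nonempty U] {F : Plane → U → Plane} {z : Phase} {u : U}
    (hmax : ∀ w, z.2 (F z.1 w) ≤ z.2 (F z.1 u)) : maxHam F z = z.2 (F z.1 u) - 1 := by
  refine le_antisymm (ciSup_le fun w => by linarith [hmax w]) ?_
  exact le_ciSup (f := fun w => z.2 (F z.1 w) - 1)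
    ⟨z.2 (F z.1 u) - 1, by rintro _ ⟨w, rfl⟩; simpa using hmax w⟩ u

/-- First-order condition at a maximum of a function of the control. -/
theorem deriv_eq_zero_of_max {U : Type*} [TopologicalSpace U]
    {γ : U → ℝ} {c : OpenPartialHomeomorph U ℝ} {u : U}
    (hu : u ∈ c.source) (hmax : ∀ w, γ w ≤ γ u) : deriv (fun s => γ (c.symm s)) (c u) = 0 := by
  apply IsLocalMax.deriv_eq_zero
  exact Filter.Eventually.of_forall fun s => by simpa [hu] using hmax (c.symm s)

section

variable {U : Type*} [TopologicalSpace U] [ChartedSpace ℝ U]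
  {D : Set Plane} {F : Plane → U → Plane}

namespace IsRegularSystem

theorem contDiffOn_chart (hF : IsRegularSystem D F) {c : OpenPartialHomeomorph U ℝ}
    (hc : c ∈ IsManifold.maximalAtlas 𝓘(ℝ) ∞ U) :
    ContDiffOn ℝ ∞ (fun x : Plane × ℝ => F x.1 (c.symm x.2)) (D ×ˢ c.target) := by
  rw [← contMDiffOn_iff_contDiffOn]
  have h1 : ContMDiffOn 𝓘(ℝ) 𝓘(ℝ) ∞ c.symm c.target :=
    contMDiffOn_symm_of_mem_maximalAtlas hc
  have h2 : ContMDiffOn 𝓘(ℝ, Plane × ℝ) ((𝓡 2).prod 𝓘(ℝ)) ∞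
      (fun x : Plane × ℝ => (x.1, c.symm x.2)) (D ×ˢ c.target) := by
    rw [← chartedSpaceSelf_prod, modelWithCornersSelf_prod]
    exact contMDiffOn_fst.prodMk (h1.comp contMDiffOn_snd fun x hx => hx.2)
  exact hF.smooth.comp h2 fun x hx => ⟨hx.1, mem_univ _⟩

theorem continuous_velocity (hF : IsRegularSystem D F) {q : Plane} (hq : q ∈ D) :
    Continuous (F q) := by
  have h := hF.smooth.continuousOn
  have h2 : Continuous (fun u : U => (q, u)) := by fun_prop
  exact h.comp_continuous h2 fun u => ⟨hq, mem_univ _⟩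

/-- The velocity curve in a chart, as a smooth function of the control. -/
theorem contDiffOn_curve (hF : IsRegularSystem D F) {c : OpenPartialHomeomorph U ℝ}
    (hc : c ∈ IsManifold.maximalAtlas 𝓘(ℝ) ∞ U) {q : Plane} (hq : q ∈ D) :
    ContDiffOn ℝ ∞ (fun s => F q (c.symm s)) c.target :=
  (hF.contDiffOn_chart hc).comp (f := fun s : ℝ => (q, s)) (by fun_prop) fun s hs => ⟨hq, hs⟩

theorem hasDerivAt_curve (hF : IsRegularSystem D F) {c : OpenPartialHomeomorph U ℝ}
    (hc : c ∈ IsManifold.maximalAtlas 𝓘(ℝ) ∞ U) {q : Plane} (hq : q ∈ D) {t : ℝ}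
    (ht : t ∈ c.target) :
    HasDerivAt (fun s => F q (c.symm s)) (deriv (fun s => F q (c.symm s)) t) t :=
  (((hF.contDiffOn_curve hc hq).contDiffAt (c.open_target.mem_nhds ht)).differentiableAt
    (by simp)).hasDerivAt

theorem hasDerivAt_deriv_curve (hF : IsRegularSystem D F) {c : OpenPartialHomeomorph U ℝ}
    (hc : c ∈ IsManifold.maximalAtlas 𝓘(ℝ) ∞ U) {q : Plane} (hq : q ∈ D) {t : ℝ}
    (ht : t ∈ c.target) :
    HasDerivAt (deriv (fun s => F q (c.symm s))) (deriv (deriv (fun s => F q (c.symm s))) t) t := by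
  have h := (hF.contDiffOn_curve hc hq).deriv_of_isOpen (m := ∞) c.open_target (by simp)
  exact ((h.contDiffAt (c.open_target.mem_nhds ht)).differentiableAt (by simp)).hasDerivAt

theorem covec_deriv_eq_zero_of_max (hF : IsRegularSystem D F) {c : OpenPartialHomeomorph U ℝ}
    (hc : c ∈ IsManifold.maximalAtlas 𝓘(ℝ) ∞ U) {q : Plane} (hq : q ∈ D) {p : Covec} {u : U}
    (hu : u ∈ c.source) (hmax : ∀ w, p (F q w) ≤ p (F q u)) :
    p (deriv (fun s => F q (c.symm s)) (c u)) = 0 := by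
  rw [← deriv_eq_zero_of_max (γ := fun w => p (F q w)) hu hmax]
  exact ((p.hasFDerivAt.comp_hasDerivAt _
    (hF.hasDerivAt_curve hc hq (c.map_source hu))).deriv).symm

variable [CompactSpace U] [Nonempty U]

theorem exists_max (hF : IsRegularSystem D F) {q : Plane} (hq : q ∈ D) (p : Covec) :
    ∃ u : U, ∀ w, p (F q w) ≤ p (F q u) := by
  obtain ⟨u, -, hu⟩ := isCompact_univ.exists_isMaxOn univ_nonempty
    (p.continuous.comp (hF.continuous_velocity hq)).continuousOn
  exact ⟨u, fun w => hu (mem_univ w)⟩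

variable [IsManifold 𝓘(ℝ) ∞ U]

/-- The origin lies in the interior of the convex hull of the admissible velocities. -/
theorem apply_pos_of_max (hF : IsRegularSystem D F) {q : Plane} (hq : q ∈ D) {p : Covec}
    (hp : p ≠ 0) {u : U} (hmax : ∀ w, p (F q w) ≤ p (F q u)) : 0 < p (F q u) := by
  by_contra hle
  -- A zero of `p` on the curve would make the maximum equal to zero; at `u` the covector `p` would
  -- then kill both the velocity and its derivative, against regularity.
  have hneg : ∀ w, p (F q w) ≠ 0 := by
    intro w hw
    have hw0 : p (F q u) = 0 := le_antisymm (not_lt.1 hle) (hw ▸ hmax w)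
    have hc := IsManifold.chart_mem_maximalAtlas (I := 𝓘(ℝ)) (n := ∞) u
    have hs : u ∈ (chartAt ℝ u).source := mem_chart_source ℝ u
    have h1 := hF.covec_deriv_eq_zero_of_max hc hq hs hmax
    have h2 := (hF.regular _ hc q hq _ ((chartAt ℝ u).map_source hs)).1
    rw [(chartAt ℝ u).left_inv hs] at h2
    exact hp (covec_eq_zero h2 hw0 h1)
  -- Since `p` does not vanish on the curve, the slope `r / p` is a continuous function of the
  -- control on a compact set and attains a maximum.
  set r : Covec := area (sharp p) with hr
  have hcont : Continuous (fun w => r (F q w) / p (F q w)) :=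
    (r.continuous.comp (hF.continuous_velocity hq)).div
      (p.continuous.comp (hF.continuous_velocity hq)) hneg
  obtain ⟨u₁, -, hu₁⟩ := isCompact_univ.exists_isMaxOn univ_nonempty hcont.continuousOn
  have hmax₁ : ∀ w, r (F q w) / p (F q w) ≤ r (F q u₁) / p (F q u₁) := fun w =>
    hu₁ (mem_univ w)
  set c := chartAt ℝ u₁ with hcdef
  have hc : c ∈ IsManifold.maximalAtlas 𝓘(ℝ) ∞ U :=
    IsManifold.chart_mem_maximalAtlas (I := 𝓘(ℝ)) (n := ∞) u₁
  have hs : u₁ ∈ c.source := mem_chart_source ℝ u₁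
  have hd := deriv_eq_zero_of_max hs hmax₁
  have hd1 := hF.hasDerivAt_curve hc hq (c.map_source hs)
  have h2 := (hF.regular _ hc q hq _ (c.map_source hs)).1
  set G := deriv (fun s => F q (c.symm s)) (c u₁) with hG
  have hq1 : HasDerivAt (fun s => r (F q (c.symm s)) / p (F q (c.symm s)))
      ((r G * p (F q u₁) - r (F q u₁) * p G) / p (F q u₁) ^ 2) (c u₁) := by
    have := (r.hasFDerivAt.comp_hasDerivAt _ hd1).fun_div (p.hasFDerivAt.comp_hasDerivAt _ hd1)
      (by simpa [c.left_inv hs] using hneg u₁)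
    simpa [c.left_inv hs] using this
  rw [hq1.deriv, div_eq_zero_iff] at hd
  rcases hd with hd | hd
  · rw [c.left_inv hs] at h2
    -- The numerator of the derivative of the slope is `|p|²` times `f ∧ ∂f/∂u`, which never
    -- vanishes. So the slope has no critical point.
    have : (r G * p (F q u₁) - r (F q u₁) * p G) =
        p (sharp p) * area (F q u₁) G := by
      rw [covec_apply p G, covec_apply p (F q u₁), apply_sharp, hr, area_apply, area_apply,
        area_apply]
      simp [sharp]
      ring
    rw [this] at hd
    exact mul_ne_zero (apply_sharp_self_pos hp).ne' h2 hd
  · exact hneg u₁ (by simpa using hd)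

/-- A critical control with positive value is a maximizer. -/
theorem max_of_critical (hF : IsRegularSystem D F) {c : OpenPartialHomeomorph U ℝ}
    (hc : c ∈ IsManifold.maximalAtlas 𝓘(ℝ) ∞ U) {q : Plane} (hq : q ∈ D) {p : Covec} {t : ℝ}
    (ht : t ∈ c.target) (h0 : p (deriv (fun s => F q (c.symm s)) t) = 0)
    (hpos : 0 < p (F q (c.symm t))) (w : U) : p (F q w) ≤ p (F q (c.symm t)) := by
  -- The supporting covector at this control also annihilates the derivative of the curve and is
  -- positive on the velocity, so `p` is a positive multiple of it.
  obtain ⟨p', hp', hmax⟩ := hF.convex q hq (c.symm t)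
  have hpos' := hF.apply_pos_of_max hq hp' hmax
  have h0' := hF.covec_deriv_eq_zero_of_max hc hq (c.map_target ht) hmax
  rw [c.right_inv ht] at h0'
  have hreg := (hF.regular c hc q hq t ht).1
  have hpp : p = (p (F q (c.symm t)) / p' (F q (c.symm t))) • p' := by
    rw [← sub_eq_zero]
    refine covec_eq_zero hreg ?_ (by simp [h0, h0'])
    simp [div_mul_cancel₀ _ hpos'.ne']
  rw [hpp]
  simp only [smul_apply, smul_eq_mul]
  exact mul_le_mul_of_nonneg_left (hmax w) (div_pos hpos hpos').le

end IsRegularSystem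
end

/-! ### Smooth dependence of the maximizing control on the covector. -/

theorem isInvertible_of_apply_one_ne_zero {L : ℝ →L[ℝ] ℝ} (h : L 1 ≠ 0) : L.IsInvertible :=
  ⟨ContinuousLinearEquiv.unitsEquivAut ℝ (Units.mk0 (L 1) h), by ext; simp⟩

/-- Scalar implicit function theorem. -/
theorem exists_implicit {X : Type*} [NormedAddCommGroup X] [NormedSpace ℝ X] [CompleteSpace X]
    {Γ : X × ℝ → ℝ} {x₀ : X} {t₀ : ℝ} (hΓ : ContDiffAt ℝ ∞ Γ (x₀, t₀)) (h0 : Γ (x₀, t₀) = 0)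
    (h1 : fderiv ℝ Γ (x₀, t₀) (0, 1) ≠ 0) :
    ∃ τ : X → ℝ, ContDiffAt ℝ ∞ τ x₀ ∧ τ x₀ = t₀ ∧ (∀ᶠ x in 𝓝 x₀, Γ (x, τ x) = 0) ∧
      ∀ᶠ y in 𝓝 (x₀, t₀), Γ y = 0 → τ y.1 = y.2 := by
  have hinv : (fderiv ℝ Γ (x₀, t₀) ∘L .inr ℝ X ℝ).IsInvertible :=
    isInvertible_of_apply_one_ne_zero (by simpa using h1)
  refine ⟨hΓ.implicitFunction (by simp) hinv, hΓ.contDiffAt_implicitFunction (by simp) hinv,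
    hΓ.implicitFunction_apply_self (by simp) hinv, ?_, ?_⟩
  · simpa [h0] using hΓ.eventually_apply_implicitFunction (by simp) hinv
  · filter_upwards [hΓ.eventually_apply_eq_iff_implicitFunction (by simp) hinv] with y hy hy0
    exact hy.1 (hy0.trans h0.symm)

/-- The second-order necessary condition at a local maximum. -/
theorem deriv_deriv_nonpos_of_isLocalMax {γ : ℝ → ℝ} {t : ℝ} (hmax : IsLocalMax γ t)
    (hc : ContinuousAt γ t) : deriv (deriv γ) t ≤ 0 := by
  by_contra! hpos
  -- A positive second derivative makes the point a local minimum as well, so the function is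
  -- locally constant and its second derivative is zero.
  have hmin := isLocalMin_of_deriv_deriv_pos hpos hmax.deriv_eq_zero hc
  have heq : γ =ᶠ[𝓝 t] fun _ => γ t := by
    filter_upwards [hmin, hmax] with s h1 h2
    exact le_antisymm h2 h1
  have h2 : deriv γ =ᶠ[𝓝 t] fun _ => 0 := by
    filter_upwards [heq.eventuallyEq_nhds] with s hs
    rw [hs.deriv_eq]; simp
  rw [h2.deriv_eq] at hpos
  simp at hpos

namespace IsRegularSystem

variable {U : Type*} [TopologicalSpace U] [ChartedSpace ℝ U] [IsManifold 𝓘(ℝ) ∞ U]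
  [CompactSpace U] [Nonempty U] {D : Set Plane} {F : Plane → U → Plane}

/-- Near every covector the maximizing control can be chosen smoothly. The data are the maximizer
`τ` in a chart, the velocity `Φ` in this chart and its derivative `Ψ` in the control. -/
theorem exists_smooth_maximizer (hF : IsRegularSystem D F) {z₀ : Phase} (hz₀ : z₀ ∈ slit D) :
    ∃ (τ : Phase → ℝ) (Φ Ψ : Plane × ℝ → Plane),
      ContDiffAt ℝ ∞ τ z₀ ∧ ContDiffAt ℝ ∞ Φ (z₀.1, τ z₀) ∧ ContDiffAt ℝ ∞ Ψ (z₀.1, τ z₀) ∧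
      (∀ᶠ z in 𝓝 z₀, Ψ (z.1, τ z) = fderiv ℝ Φ (z.1, τ z) (0, 1)) ∧
      (∀ᶠ z in 𝓝 z₀, z.2 (Ψ (z.1, τ z)) = 0) ∧
      (∀ᶠ z in 𝓝 z₀, maxHam F z = z.2 (Φ (z.1, τ z)) - 1) ∧
      z₀.2 (fderiv ℝ Ψ (z₀.1, τ z₀) (0, 1)) < 0 ∧ area (Φ (z₀.1, τ z₀)) (Ψ (z₀.1, τ z₀)) ≠ 0 := by
  obtain ⟨hq, hp⟩ := hz₀
  obtain ⟨u, hu⟩ := hF.exists_max hq z₀.2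
  set c := chartAt ℝ u with hcdef
  have hc : c ∈ IsManifold.maximalAtlas 𝓘(ℝ) ∞ U :=
    IsManifold.chart_mem_maximalAtlas (I := 𝓘(ℝ)) (n := ∞) u
  have hs : u ∈ c.source := mem_chart_source ℝ u
  have ht := c.map_source hs
  set t := c u with htdef
  set Φ : Plane × ℝ → Plane := fun x => F x.1 (c.symm x.2) with hΦ
  set Ψ : Plane × ℝ → Plane := fun x => fderiv ℝ Φ x (0, 1) with hΨ
  have hopen : IsOpen (D ×ˢ c.target) := hF.isOpen.prod c.open_target
  have hΦs : ContDiffOn ℝ ∞ Φ (D ×ˢ c.target) := hF.contDiffOn_chart hc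
  have hΨs : ContDiffOn ℝ ∞ Ψ (D ×ˢ c.target) :=
    (hΦs.fderiv_of_isOpen hopen (m := ∞) (by simp)).clm_apply contDiffOn_const
  have hline : ∀ (q : Plane) (s : ℝ), HasDerivAt (fun s : ℝ => (q, s)) ((0, 1) : Plane × ℝ) s :=
    fun q s => (hasDerivAt_const s q).prodMk (hasDerivAt_id s)
  have hd1 : ∀ q ∈ D, ∀ s ∈ c.target, deriv (fun s => F q (c.symm s)) s = Ψ (q, s) := by
    intro q hq s hs
    exact (((hΦs.contDiffAt (hopen.mem_nhds ⟨hq, hs⟩)).differentiableAt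
      (by simp)).hasFDerivAt.comp_hasDerivAt s (hline q s)).deriv
  have hd2 : deriv (deriv (fun s => F z₀.1 (c.symm s))) t = fderiv ℝ Ψ (z₀.1, t) (0, 1) := by
    have : deriv (fun s => F z₀.1 (c.symm s)) =ᶠ[𝓝 t] fun s => Ψ (z₀.1, s) :=
      Filter.eventually_of_mem (c.open_target.mem_nhds ht) fun s hs => hd1 _ hq s hs
    rw [this.deriv_eq]
    exact (((hΨs.contDiffAt (hopen.mem_nhds ⟨hq, ht⟩)).differentiableAt
      (by simp)).hasFDerivAt.comp_hasDerivAt t (hline z₀.1 t)).deriv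
  have hFt : z₀.2 (Ψ (z₀.1, t)) = 0 := by
    rw [← hd1 _ hq t ht]; exact hF.covec_deriv_eq_zero_of_max hc hq hs hu
  have hreg := hF.regular c hc _ hq t ht
  rw [hd2, hd1 _ hq t ht] at hreg
  -- Equality in the second-order condition is excluded by `∂f/∂u ∧ ∂²f/∂u² ≠ 0`, since the covector
  -- already annihilates `∂f/∂u`. This nondegeneracy feeds the implicit function theorem.
  have hFtt : z₀.2 (fderiv ℝ Ψ (z₀.1, t) (0, 1)) < 0 := by
    refine lt_of_le_of_ne ?_ fun h0 => hp (covec_eq_zero hreg.2 hFt h0)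
    have hγ : ∀ s ∈ c.target, HasDerivAt (fun s => z₀.2 (F z₀.1 (c.symm s)))
        (z₀.2 (deriv (fun s => F z₀.1 (c.symm s)) s)) s := fun s hs =>
      z₀.2.hasFDerivAt.comp_hasDerivAt s (hF.hasDerivAt_curve hc hq hs)
    have hmax : IsLocalMax (fun s => z₀.2 (F z₀.1 (c.symm s))) t :=
      Filter.Eventually.of_forall fun s => by simpa [htdef, hs] using hu (c.symm s)
    have h2 := deriv_deriv_nonpos_of_isLocalMax hmax (hγ t ht).continuousAt
    have heq : deriv (fun s => z₀.2 (F z₀.1 (c.symm s))) =ᶠ[𝓝 t]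
        fun s => z₀.2 (deriv (fun s => F z₀.1 (c.symm s)) s) :=
      Filter.eventually_of_mem (c.open_target.mem_nhds ht) fun s hs => (hγ s hs).deriv
    have h3 : HasDerivAt (fun s => z₀.2 (deriv (fun s => F z₀.1 (c.symm s)) s))
        (z₀.2 (deriv (deriv (fun s => F z₀.1 (c.symm s))) t)) t :=
      z₀.2.hasFDerivAt.comp_hasDerivAt t (hF.hasDerivAt_deriv_curve hc hq ht)
    rwa [heq.deriv_eq, h3.deriv, hd2] at h2
  set Γ : Phase × ℝ → ℝ := fun y => y.1.2 (Ψ (y.1.1, y.2)) with hΓ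
  have hΨat : ContDiffAt ℝ ∞ Ψ (z₀.1, t) := hΨs.contDiffAt (hopen.mem_nhds ⟨hq, ht⟩)
  have hΦat : ContDiffAt ℝ ∞ Φ (z₀.1, t) := hΦs.contDiffAt (hopen.mem_nhds ⟨hq, ht⟩)
  have hΓs : ContDiffAt ℝ ∞ Γ (z₀, t) := by
    have h1 : ContDiffAt ℝ ∞ (fun y : Phase × ℝ => Ψ (y.1.1, y.2)) (z₀, t) :=
      ContDiffAt.comp (f := fun y : Phase × ℝ => (y.1.1, y.2)) (z₀, t) hΨat (by fun_prop)
    exact ContDiffAt.clm_apply (by fun_prop) h1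
  have hΓ1 : fderiv ℝ Γ (z₀, t) (0, 1) ≠ 0 := by
    have hl : HasDerivAt (fun s : ℝ => (z₀, s)) ((0, 1) : Phase × ℝ) t :=
      (hasDerivAt_const t z₀).prodMk (hasDerivAt_id t)
    have h1 := ((hΓs.differentiableAt (by simp)).hasFDerivAt.comp_hasDerivAt t hl).deriv
    have h2 := (z₀.2.hasFDerivAt.comp_hasDerivAt t
      ((hΨat.differentiableAt (by simp)).hasFDerivAt.comp_hasDerivAt t (hline z₀.1 t))).deriv
    rw [← h1, show (Γ ∘ fun s : ℝ => (z₀, s)) = z₀.2 ∘ Ψ ∘ fun s : ℝ => (z₀.1, s) from rfl, h2]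
    exact hFtt.ne
  obtain ⟨τ, hτs, hτ0, hτ, -⟩ := exists_implicit hΓs hFt hΓ1
  have hpos : 0 < z₀.2 (Φ (z₀.1, t)) := by
    have := hF.apply_pos_of_max hq hp hu
    simpa [hΦ, htdef, hs] using this
  have hpair : ContinuousAt (fun z : Phase => (z.1, τ z)) z₀ :=
    continuousAt_fst.prodMk hτs.continuousAt
  have hmem : ∀ᶠ z in 𝓝 z₀, (z.1, τ z) ∈ D ×ˢ c.target :=
    hpair.eventually (hopen.mem_nhds ⟨hq, by simpa [hτ0] using ht⟩)
  -- The implicit function gives only critical controls nearby; positivity of the value promotes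
  -- them to global maximizers by `max_of_critical`.
  have hposn : ∀ᶠ z in 𝓝 z₀, 0 < z.2 (Φ (z.1, τ z)) := by
    have h1 : ContinuousAt (fun z : Phase => Φ (z.1, τ z)) z₀ :=
      ContinuousAt.comp (g := Φ) (f := fun z : Phase => (z.1, τ z)) (by
        simpa only [hτ0] using hΦat.continuousAt) hpair
    have h2 : ContinuousAt (fun z : Phase => z.2 (Φ (z.1, τ z))) z₀ :=
      continuousAt_snd.clm_apply h1
    exact h2.eventually (lt_mem_nhds (by simpa only [hτ0] using hpos))
  refine ⟨τ, Φ, Ψ, hτs, by rwa [hτ0], by rwa [hτ0], Filter.Eventually.of_forall fun z => rfl, hτ,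
    ?_, by rwa [hτ0], ?_⟩
  · filter_upwards [hmem, hposn, hτ] with z hz hz1 hz2
    refine maxHam_eq (u := c.symm (τ z)) (hF.max_of_critical hc hz.1 hz.2 ?_ hz1)
    rw [hd1 _ hz.1 _ hz.2]; exact hz2
  · rw [hτ0]; exact hreg.1

/-- Smoothness comes from the smooth maximizer, homogeneity and positivity from the maximum itself.
For strong convexity, the fibre derivative of the velocity is a multiple of `∂f/∂u`, and the
implicit equation for the maximizer determines that multiple. -/
theorem isSmoothHam (hF : IsRegularSystem D F) : IsSmoothHam D (maxHam F) := by
  have hpair : ∀ {τ : Phase → ℝ} {z : Phase}, ContDiffAt ℝ ∞ τ z →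
      ContDiffAt ℝ ∞ (fun z : Phase => (z.1, τ z)) z := fun h => contDiffAt_fst.prodMk h
  have hsmooth : ContDiffOn ℝ ∞ (maxHam F) (slit D) := by
    intro z₀ hz₀
    obtain ⟨τ, Φ, Ψ, hτ, hΦ, -, -, -, hh, -⟩ := hF.exists_smooth_maximizer hz₀
    refine ContDiffAt.contDiffWithinAt (ContDiffAt.congr_of_eventuallyEq ?_ hh)
    exact ((ContDiffAt.clm_apply contDiffAt_snd
      (ContDiffAt.comp (f := fun z : Phase => (z.1, τ z)) z₀ hΦ (hpair hτ))).sub contDiffAt_const)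
  refine ⟨hF.isOpen, hsmooth, fun q hq p t ht => ?_, fun z hz => ?_, fun z₀ hz₀ => ?_⟩
  · obtain ⟨u, hu⟩ := hF.exists_max hq p
    rw [maxHam_eq (z := (q, p)) hu, maxHam_eq (z := (q, t • p)) (u := u) fun w => by
      simpa using mul_le_mul_of_nonneg_left (hu w) ht.le]
    simp
  · obtain ⟨u, hu⟩ := hF.exists_max hz.1 z.2
    rw [maxHam_eq hu]
    simpa using hF.apply_pos_of_max hz.1 hz.2 hu
  · obtain ⟨τ, Φ, Ψ, hτ, hΦ, hΨ, hΨΦ, h0, hh, hlt, hne⟩ := hF.exists_smooth_maximizer hz₀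
    have hτc : ContinuousAt (fun z : Phase => (z.1, τ z)) z₀ := (hpair hτ).continuousAt
    have hτn : ∀ᶠ z in 𝓝 z₀, DifferentiableAt ℝ τ z :=
      ((hτ.of_le (m := 1) (by simp)).eventually (by simp)).mono fun z hz =>
        hz.differentiableAt (by simp)
    have hΦn : ∀ᶠ z in 𝓝 z₀, DifferentiableAt ℝ Φ (z.1, τ z) :=
      hτc.eventually (((hΦ.of_le (m := 1) (by simp)).eventually (by simp)).mono
        fun x hx => hx.differentiableAt (by simp))
    -- the vertical derivative of a function of the form `Θ (q, τ (q, p))`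
    have hvert : ∀ {Θ : Plane × ℝ → Plane} {z : Phase} (ξ : Covec), DifferentiableAt ℝ τ z →
        DifferentiableAt ℝ Θ (z.1, τ z) → fderiv ℝ (fun z : Phase => Θ (z.1, τ z)) z (0, ξ) =
          fderiv ℝ τ z (0, ξ) • fderiv ℝ Θ (z.1, τ z) (0, 1) := by
      intro Θ z ξ hz hΘ
      have hp' : HasFDerivAt (fun z : Phase => (z.1, τ z))
          ((ContinuousLinearMap.fst ℝ Plane Covec).prod (fderiv ℝ τ z)) z :=
        hasFDerivAt_fst.prodMk hz.hasFDerivAt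
      have h1 := HasFDerivAt.comp (f := fun z : Phase => (z.1, τ z)) z hΘ.hasFDerivAt hp'
      have h2 : fderiv ℝ (fun z : Phase => Θ (z.1, τ z)) z =
          (fderiv ℝ Θ (z.1, τ z)).comp
            ((ContinuousLinearMap.fst ℝ Plane Covec).prod (fderiv ℝ τ z)) := h1.fderiv
      rw [h2]
      simp only [ContinuousLinearMap.comp_apply, ContinuousLinearMap.prod_apply,
        ContinuousLinearMap.coe_fst']
      rw [← map_smul]; simp
    -- The envelope principle: the variation of the maximizer does not contribute, because the
    -- covector annihilates `∂f/∂u` there.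
    have hfeq : (fun z => (hamVec (maxHam F) z).1) =ᶠ[𝓝 z₀] fun z => Φ (z.1, τ z) := by
      filter_upwards [hh.eventually_nhds, hτn, hΦn, h0, hΨΦ] with z hz hzτ hzΦ hz0 hzΨ
      have hξ : ∀ ξ : Covec, ξ (hamVec (maxHam F) z).1 = ξ (Φ (z.1, τ z)) := by
        intro ξ
        rw [apply_hamVec, Filter.EventuallyEq.fderiv_eq hz, fderiv_sub_const]
        have hΘ : DifferentiableAt ℝ (fun z : Phase => Φ (z.1, τ z)) z :=
          DifferentiableAt.comp (f := fun z : Phase => (z.1, τ z)) z hzΦ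
            (differentiableAt_fst.prodMk hzτ)
        rw [fderiv_clm_apply differentiableAt_snd hΘ]
        simp only [fderiv_snd, add_apply, ContinuousLinearMap.comp_apply,
          ContinuousLinearMap.flip_apply, ContinuousLinearMap.coe_snd']
        rw [hvert ξ hzτ hzΦ, map_smul, ← hzΨ, hz0]
        simp
      ext j; fin_cases j <;> simpa using hξ (EuclideanSpace.proj _)
    have hham : DifferentiableAt ℝ (hamVec (maxHam F)) z₀  :=
      ((contDiffOn_hamVec hF.isOpen hsmooth).contDiffAt
        ((isOpen_slit hF.isOpen).mem_nhds hz₀)).differentiableAt (by simp)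
    set η := area (hamVec (maxHam F) z₀).1 with hη
    have hW : (fderiv ℝ (hamVec (maxHam F)) z₀ (0, η)).1 =
        fderiv ℝ τ z₀ (0, η) • Ψ (z₀.1, τ z₀) := by
      have h1 : fderiv ℝ (fun z => (hamVec (maxHam F) z).1) z₀ (0, η) =
          (fderiv ℝ (hamVec (maxHam F)) z₀ (0, η)).1 := by
        rw [fderiv.fst hham]; rfl
      rw [← h1, hfeq.fderiv_eq, hvert η hτn.self_of_nhds hΦn.self_of_nhds,
        hΨΦ.self_of_nhds]
    -- The vertical derivative of the critical point equation. It makes the convexity expression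
    -- equal to `-η(∂f/∂u)² / ⟨p, ∂²f/∂u²⟩`, which is positive.
    have himp : η (Ψ (z₀.1, τ z₀)) +
        fderiv ℝ τ z₀ (0, η) * z₀.2 (fderiv ℝ Ψ (z₀.1, τ z₀) (0, 1)) = 0 := by
      have h1 : fderiv ℝ (fun z : Phase => z.2 (Ψ (z.1, τ z))) z₀ (0, η) = 0 := by
        rw [Filter.EventuallyEq.fderiv_eq (f := fun _ => (0 : ℝ)) h0]; simp
      have hΨd : DifferentiableAt ℝ Ψ (z₀.1, τ z₀) := hΨ.differentiableAt (by simp)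
      have hΘ : DifferentiableAt ℝ (fun z : Phase => Ψ (z.1, τ z)) z₀ :=
        DifferentiableAt.comp (f := fun z : Phase => (z.1, τ z)) z₀ hΨd
          (differentiableAt_fst.prodMk hτn.self_of_nhds)
      rw [fderiv_clm_apply differentiableAt_snd hΘ] at h1
      simp only [fderiv_snd, add_apply, ContinuousLinearMap.comp_apply,
        ContinuousLinearMap.flip_apply, ContinuousLinearMap.coe_snd',
        hvert η hτn.self_of_nhds hΨd, map_smul, smul_eq_mul] at h1
      linarith
    have hηΨ : η (Ψ (z₀.1, τ z₀)) ≠ 0 := by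
      have h1 : (hamVec (maxHam F) z₀).1 = Φ (z₀.1, τ z₀) := hfeq.self_of_nhds
      rw [hη, h1]; exact hne
    rw [hW, map_smul, smul_eq_mul]
    have hT : fderiv ℝ τ z₀ (0, η) =
        -η (Ψ (z₀.1, τ z₀)) / z₀.2 (fderiv ℝ Ψ (z₀.1, τ z₀) (0, 1)) := by
      rw [eq_div_iff hlt.ne]; linarith
    rw [hT, div_mul_eq_mul_div]
    refine div_pos_of_neg_of_neg ?_ hlt
    have := mul_self_pos.2 hηΨ
    linarith

end IsRegularSystem

/-! ### The canonical vertical field -/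

/-- The velocity `∂h/∂p`. -/
def vel (h : Phase → ℝ) (z : Phase) : Plane := (hamVec h z).1

theorem apply_vel (h : Phase → ℝ) (z : Phase) (ξ : Covec) :
    ξ (vel h z) = fderiv ℝ h z (0, ξ) := apply_hamVec h z ξ

/-- The canonical vertical direction. -/
def nu (h : Phase → ℝ) (z : Phase) : Covec :=
  √((h z + 1) / area (vel h z) (fderiv ℝ (vel h) z (0, area (vel h z)))) • area (vel h z)

/-- The canonical vertical field. -/
def vertField (h : Phase → ℝ) (z : Phase) : Phase := (0, nu h z)

/-- The invariant `b` of the canonical vertical field. -/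
def invB (h : Phase → ℝ) (z : Phase) : ℝ :=
  (fderiv ℝ (nu h) z (0, nu h z) + z.2) (sharp (nu h z)) / nu h z (sharp (nu h z))

namespace IsSmoothHam

variable {D : Set Plane} {h : Phase → ℝ}

theorem contDiffAt (hh : IsSmoothHam D h) {z : Phase} (hz : z ∈ slit D) : ContDiffAt ℝ ∞ h z :=
  hh.smooth.contDiffAt ((isOpen_slit hh.isOpen).mem_nhds hz)

theorem differentiableAt (hh : IsSmoothHam D h) {z : Phase} (hz : z ∈ slit D) :
    DifferentiableAt ℝ h z := (hh.contDiffAt hz).differentiableAt (by simp)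

theorem contDiffAt_hamVec (hh : IsSmoothHam D h) {z : Phase} (hz : z ∈ slit D) :
    ContDiffAt ℝ ∞ (hamVec h) z :=
  (contDiffOn_hamVec hh.isOpen hh.smooth).contDiffAt ((isOpen_slit hh.isOpen).mem_nhds hz)

theorem contDiffAt_vel (hh : IsSmoothHam D h) {z : Phase} (hz : z ∈ slit D) :
    ContDiffAt ℝ ∞ (vel h) z := (hh.contDiffAt_hamVec hz).fst

theorem convex' (hh : IsSmoothHam D h) {z : Phase} (hz : z ∈ slit D) :
    0 < area (vel h z) (fderiv ℝ (vel h) z (0, area (vel h z))) := by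
  have h1 : fderiv ℝ (vel h) z (0, area (vel h z)) =
      (fderiv ℝ (hamVec h) z (0, area (vel h z))).1 := by
    have := fderiv.fst ((hh.contDiffAt_hamVec hz).differentiableAt (by simp))
    rw [show vel h = fun z => (hamVec h z).1 from rfl, this]; rfl
  rw [h1]; exact hh.convex z hz

theorem apply_zero (hh : IsSmoothHam D h) {q : Plane} (hq : q ∈ D) : h (q, 0) = -1 := by
  have := hh.homogeneous q hq 0 2 (by norm_num)
  rw [smul_zero] at this
  linarith

/-- By homogeneity `h = -1` on the zero section, so the levels `e > -1` stay where `h` is smooth. -/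
theorem mem_slit (hh : IsSmoothHam D h) {e : ℝ} (he : -1 < e) {z : Phase}
    (hz : z ∈ levelSet D h e) : z ∈ slit D := by
  refine ⟨hz.1, fun h0 => ?_⟩
  have h1 : h z = -1 := by
    rw [show z = (z.1, 0) from Prod.ext rfl h0]; exact hh.apply_zero hz.1
  have := hz.2
  linarith

/-- Euler's identity. -/
theorem euler (hh : IsSmoothHam D h) {z : Phase} (hz : z ∈ slit D) : z.2 (vel h z) = h z + 1 := by
  rw [apply_vel]
  have hl : HasDerivAt (fun t : ℝ => ((z.1, t • z.2) : Phase)) (0, z.2) 1 := by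
    simpa using (hasDerivAt_const (1 : ℝ) z.1).prodMk ((hasDerivAt_id (1 : ℝ)).smul_const z.2)
  have h1 : HasDerivAt (fun t : ℝ => h (z.1, t • z.2)) (fderiv ℝ h z (0, z.2)) 1 := by
    have h2 : HasFDerivAt h (fderiv ℝ h z) ((fun t : ℝ => ((z.1, t • z.2) : Phase)) 1) := by
      simpa using (hh.differentiableAt hz).hasFDerivAt
    exact h2.comp_hasDerivAt 1 hl
  have h3 : HasDerivAt (fun t : ℝ => t * (h z + 1) - 1) (h z + 1) 1 := by
    simpa using ((hasDerivAt_id (1 : ℝ)).mul_const (h z + 1)).sub_const 1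
  have h4 : (fun t : ℝ => h (z.1, t • z.2)) =ᶠ[𝓝 1] fun t => t * (h z + 1) - 1 := by
    filter_upwards [lt_mem_nhds (zero_lt_one (α := ℝ))] with t ht
    have := hh.homogeneous z.1 hz.1 z.2 t ht
    linarith
  exact h1.unique (h3.congr_of_eventuallyEq h4)

theorem vel_ne_zero (hh : IsSmoothHam D h) {z : Phase} (hz : z ∈ slit D) : vel h z ≠ 0 := by
  intro h0
  have h1 := hh.euler hz
  have h2 := hh.pos z hz
  rw [h0, map_zero] at h1
  linarith

theorem contDiffAt_nu (hh : IsSmoothHam D h) {z : Phase} (hz : z ∈ slit D) :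
    ContDiffAt ℝ ∞ (nu h) z := by
  have hv := hh.contDiffAt_vel hz
  have hη : ContDiffAt ℝ ∞ (fun z => area (vel h z)) z :=
    area.contDiff.contDiffAt.comp z hv
  have hw : ContDiffAt ℝ ∞ (fun z => fderiv ℝ (vel h) z (0, area (vel h z))) z :=
    (hv.fderiv_right (m := ∞) (by simp)).clm_apply (contDiffAt_const.prodMk hη)
  have hpos := hh.convex' hz
  refine ContDiffAt.smul (ContDiffAt.sqrt ?_ ?_) hη
  · exact ((hh.contDiffAt hz).add contDiffAt_const).div (hη.clm_apply hw) hpos.ne'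
  · exact (div_pos (hh.pos z hz) hpos).ne'

theorem contDiffAt_vertField (hh : IsSmoothHam D h) {z : Phase} (hz : z ∈ slit D) :
    ContDiffAt ℝ ∞ (vertField h) z := contDiffAt_const.prodMk (hh.contDiffAt_nu hz)

theorem nu_vel (h : Phase → ℝ) (z : Phase) : nu h z (vel h z) = 0 := by
  simp [nu, area_self]

theorem nu_ne_zero (hh : IsSmoothHam D h) {z : Phase} (hz : z ∈ slit D) : nu h z ≠ 0 :=
  smul_ne_zero (Real.sqrt_pos.2 (div_pos (hh.pos z hz) (hh.convex' hz))).ne'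
    (area_ne_zero_vec (hh.vel_ne_zero hz))

/-- The normalization of the canonical vertical field. -/
theorem nu_fderiv_vel (hh : IsSmoothHam D h) {z : Phase} (hz : z ∈ slit D) :
    nu h z (fderiv ℝ (vel h) z (0, nu h z)) = h z + 1 := by
  have hpos := hh.convex' hz
  have hr : 0 ≤ (h z + 1) / area (vel h z) (fderiv ℝ (vel h) z (0, area (vel h z))) :=
    (div_pos (hh.pos z hz) hpos).le
  set r := (h z + 1) / area (vel h z) (fderiv ℝ (vel h) z (0, area (vel h z))) with hrdef
  have h1 : nu h z = √r • area (vel h z) := rfl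
  have h2 : ((0, √r • area (vel h z)) : Phase) = √r • (0, area (vel h z)) := by simp
  rw [h1, h2, map_smul, map_smul, smul_apply, smul_eq_mul, smul_eq_mul, ← mul_assoc,
    Real.mul_self_sqrt hr, hrdef, div_mul_cancel₀ _ hpos.ne']

/-- The relation `v² p = -p + b v p`. -/
theorem fderiv_nu (hh : IsSmoothHam D h) {z : Phase} (hz : z ∈ slit D) :
    fderiv ℝ (nu h) z (0, nu h z) + z.2 = invB h z • nu h z := by
  refine covec_eq_smul (hh.vel_ne_zero hz) (hh.nu_ne_zero hz) ?_ (nu_vel h z)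
  -- Differentiating `ν (vel) = 0` along `ν`, with the normalization of `ν` and Euler's identity,
  -- shows that `∂_ν ν + p` annihilates the velocity. It is therefore proportional to `ν`, and the
  -- factor is the invariant.
  have h0 : fderiv ℝ (fun z => nu h z (vel h z)) z (0, nu h z) = 0 := by
    simp [nu_vel]
  rw [fderiv_clm_apply ((hh.contDiffAt_nu hz).differentiableAt (by simp))
    ((hh.contDiffAt_vel hz).differentiableAt (by simp))] at h0
  simp only [add_apply, ContinuousLinearMap.comp_apply, ContinuousLinearMap.flip_apply] at h0
  rw [hh.nu_fderiv_vel hz] at h0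
  rw [add_apply, hh.euler hz]
  linarith

theorem contDiffAt_invB (hh : IsSmoothHam D h) {z : Phase} (hz : z ∈ slit D) :
    ContDiffAt ℝ ∞ (invB h) z := by
  have hn := hh.contDiffAt_nu hz
  have hs : ContDiffAt ℝ ∞ (fun z => sharp (nu h z)) z := sharp.contDiff.contDiffAt.comp z hn
  refine ContDiffAt.div (ContDiffAt.clm_apply (ContDiffAt.add ?_ contDiffAt_snd) hs)
    (hn.clm_apply hs) (apply_sharp_self_pos (hh.nu_ne_zero hz)).ne'
  exact (hn.fderiv_right (m := ∞) (by simp)).clm_apply (contDiffAt_const.prodMk hn)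

/-- The field is vertical, so its successive Lie derivatives of `p dq` are `ν dq` and `(∂_ν ν) dq`;
the structure equation is then `fderiv_nu`. -/
theorem isCanonicalField (hh : IsSmoothHam D h) {e : ℝ} (he : -1 < e) :
    IsCanonicalField D h e (vertField h) (invB h) := by
  refine ⟨fun z hz => (hh.contDiffAt_vertField hz).contDiffWithinAt,
    fun z hz => (hh.contDiffAt_invB hz).contDiffWithinAt, fun z hz => rfl, fun z hz => ?_,
    fun z hz X hX => ?_⟩
  · rw [vertField, ← apply_vel]; exact nu_vel h z
  · have hz' := hh.mem_slit he hz
    have hliou : ∀ z : Phase, HasFDerivAt liouville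
        (((ContinuousLinearMap.compL ℝ Phase Plane ℝ).flip
          (ContinuousLinearMap.fst ℝ Plane Covec)).comp
          (ContinuousLinearMap.snd ℝ Plane Covec)) z := fun z =>
      (((ContinuousLinearMap.compL ℝ Phase Plane ℝ).flip
          (ContinuousLinearMap.fst ℝ Plane Covec)).comp
          (ContinuousLinearMap.snd ℝ Plane Covec)).hasFDerivAt
    have hfv : ∀ y ∈ slit D, ∀ X, (fderiv ℝ (vertField h) y X).1 = 0 := by
      intro y hy X
      have h1 := (hasFDerivAt_const (0 : Plane) y).prodMk
        ((hh.contDiffAt_nu hy).differentiableAt (by simp)).hasFDerivAt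
      have h2 : fderiv ℝ (vertField h) y = _ := h1.fderiv
      rw [h2]; simp
    have hL1 : ∀ y ∈ slit D, lieDerivForm (vertField h) liouville y =
        (nu h y).comp (ContinuousLinearMap.fst ℝ Plane Covec) := by
      intro y hy
      refine ContinuousLinearMap.ext fun X => ?_
      have h3 := hfv y hy X
      simp [lieDerivForm, (hliou y).fderiv, liouville, h3]
      simp [vertField]
    have hL2 : lieDerivForm (vertField h) liouville =ᶠ[𝓝 z]
        fun y => (nu h y).comp (ContinuousLinearMap.fst ℝ Plane Covec) :=
      Filter.eventually_of_mem ((isOpen_slit hh.isOpen).mem_nhds hz') hL1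
    have hd := (HasFDerivAt.comp (f := nu h) (g := (ContinuousLinearMap.compL ℝ Phase Plane ℝ).flip
      (ContinuousLinearMap.fst ℝ Plane Covec)) z (ContinuousLinearMap.hasFDerivAt _)
      ((hh.contDiffAt_nu hz').differentiableAt (by simp)).hasFDerivAt).fderiv
    have hd' : fderiv ℝ (fun y => (nu h y).comp (ContinuousLinearMap.fst ℝ Plane Covec)) z =
      ((ContinuousLinearMap.compL ℝ Phase Plane ℝ).flip
          (ContinuousLinearMap.fst ℝ Plane Covec)).comp (fderiv ℝ (nu h) z) := hd
    have key := congrArg (fun ξ : Covec => ξ X.1) (hh.fderiv_nu hz')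
    simp only [add_apply, smul_apply, smul_eq_mul] at key
    have h3 := hfv z hz' X
    rw [lieDerivForm, hL2.fderiv_eq, hd', hL1 z hz']
    simp only [add_apply, ContinuousLinearMap.comp_apply, ContinuousLinearMap.flip_apply,
      ContinuousLinearMap.compL_apply, ContinuousLinearMap.coe_fst', h3, map_zero, liouville,
      vertField]
    linarith

end IsSmoothHam

/-! ### Vanishing of the invariants of a straightened Hamiltonian -/

/-- `φ` is a change of coordinates on `O` in which the Hamiltonian does not depend on the point. It is
normalized to be tangent to the identity at `q₀`. -/
structure IsStraightening (h : Phase → ℝ) (q₀ : Plane) (O : Set Plane) (φ : Plane → Plane) :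
    Prop where
  isOpen : IsOpen O
  mem : q₀ ∈ O
  smooth : ContDiffOn ℝ ∞ φ O
  base : fderiv ℝ φ q₀ = ContinuousLinearMap.id ℝ Plane
  det_pos : ∀ q ∈ O, 0 < planeDet (fderiv ℝ φ q)
  invariant : ∀ q ∈ O, ∀ π : Covec, h (q, π.comp (fderiv ℝ φ q)) = h (q₀, π)

theorem comp_ne_zero_of_planeDet {A : Plane →L[ℝ] Plane} (hA : planeDet A ≠ 0) {π : Covec}
    (hπ : π ≠ 0) : π.comp A ≠ 0 := by
  intro h0
  refine hπ (covec_eq_zero hA ?_ ?_)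
  · exact congrArg (fun ξ : Covec => ξ e₁) h0
  · exact congrArg (fun ξ : Covec => ξ e₂) h0

theorem eq_of_map_eq {A : Plane →L[ℝ] Plane} (hA : planeDet A ≠ 0) {x y : Plane}
    (hxy : A x = A y) : x = y := by
  rw [← sub_eq_zero]
  by_contra hne
  apply area_ne_zero_vec hne
  ext z
  have h1 := area_map A (x - y) z
  rw [map_sub, hxy, sub_self] at h1
  simpa [hA] using h1.symm

theorem vec_ext_of_covec {x y : Plane} (hxy : ∀ ξ : Covec, ξ x = ξ y) : x = y := by
  ext j; simpa using hxy (EuclideanSpace.proj j)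

namespace IsStraightening

variable {D O : Set Plane} {h : Phase → ℝ} {q₀ : Plane} {φ : Plane → Plane}

/-- The cotangent lift. -/
def lift (φ : Plane → Plane) (x : Phase) : Phase := (x.1, x.2.comp (fderiv ℝ φ x.1))

theorem lift_base (hφ : IsStraightening h q₀ O φ) (π : Covec) : lift φ (q₀, π) = (q₀, π) := by
  simp [lift, hφ.base]

theorem lift_mem (hφ : IsStraightening h q₀ O φ) (hO : O ⊆ D) {x : Phase} (hx : x ∈ slit O) :
    lift φ x ∈ slit D :=
  ⟨hO hx.1, comp_ne_zero_of_planeDet (hφ.det_pos _ hx.1).ne' hx.2⟩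

theorem contDiffAt_fderiv (hφ : IsStraightening h q₀ O φ) {q : Plane} (hq : q ∈ O) :
    ContDiffAt ℝ ∞ (fderiv ℝ φ) q :=
  (hφ.smooth.contDiffAt (hφ.isOpen.mem_nhds hq)).fderiv_right (by simp)

theorem contDiffAt_lift (hφ : IsStraightening h q₀ O φ) {x : Phase} (hx : x.1 ∈ O) :
    ContDiffAt ℝ ∞ (lift φ) x :=
  contDiffAt_fst.prodMk (contDiffAt_snd.clm_comp ((hφ.contDiffAt_fderiv hx).comp x contDiffAt_fst))

theorem fderiv_lift (hφ : IsStraightening h q₀ O φ) {x : Phase} (hx : x.1 ∈ O) (y : Plane)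
    (ζ : Covec) : fderiv ℝ (lift φ) x (y, ζ) =
      (y, ζ.comp (fderiv ℝ φ x.1) + x.2.comp (fderiv ℝ (fderiv ℝ φ) x.1 y)) := by
  have h1 : HasFDerivAt (fun x : Phase => fderiv ℝ φ x.1)
      ((fderiv ℝ (fderiv ℝ φ) x.1).comp (ContinuousLinearMap.fst ℝ Plane Covec)) x :=
    HasFDerivAt.comp (f := fun x : Phase => x.1) x
      ((hφ.contDiffAt_fderiv hx).differentiableAt (by simp)).hasFDerivAt hasFDerivAt_fst
  have h2 : fderiv ℝ (lift φ) x = _ :=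
    (hasFDerivAt_fst.prodMk ((hasFDerivAt_snd (p := x)).clm_comp h1)).fderiv
  rw [h2]
  ext <;> simp [add_comm]

theorem apply_second_symm (hφ : IsStraightening h q₀ O φ) {q : Plane} (hq : q ∈ O) (y w : Plane) :
    fderiv ℝ (fderiv ℝ φ) q y w = fderiv ℝ (fderiv ℝ φ) q w y := by
  have : IsSymmSndFDerivAt ℝ φ q := (hφ.smooth.contDiffAt (hφ.isOpen.mem_nhds hq)).isSymmSndFDerivAt
    (by rw [minSmoothness_of_isRCLikeNormedField]; exact two_le_infty)
  exact this y w

theorem ham_lift (hφ : IsStraightening h q₀ O φ) {x : Phase} (hx : x.1 ∈ O) :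
    h (lift φ x) = h (q₀, x.2) := hφ.invariant _ hx _

theorem base_mem (_ : IsSmoothHam D h) (hφ : IsStraightening h q₀ O φ) (hO : O ⊆ D) {π : Covec}
    (hπ : π ≠ 0) : ((q₀, π) : Phase) ∈ slit D := ⟨hO hφ.mem, hπ⟩

/-- The derivative of a function that is carried by the lift to a function of the covector. -/
theorem fderiv_of_lift (hφ : IsStraightening h q₀ O φ) {G : Type*} [NormedAddCommGroup G] [NormedSpace ℝ G] {Θ : Phase → G}
    {Θ' : Phase → G} {x : Phase} (hx : x ∈ slit O) (hΘ : DifferentiableAt ℝ Θ (lift φ x))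
    (h0 : ∀ᶠ y in 𝓝 x, Θ (lift φ y) = Θ' y) (X : Phase) :
    fderiv ℝ Θ (lift φ x) (fderiv ℝ (lift φ) x X) = fderiv ℝ Θ' x X := by
  rw [← Filter.EventuallyEq.fderiv_eq h0]
  have h1 := fderiv_comp x hΘ ((hφ.contDiffAt_lift hx.1).differentiableAt (by simp))
  have h2 : fderiv ℝ (fun y => Θ (lift φ y)) x = _ := h1
  rw [h2]; rfl

theorem fderiv_base {G : Type*} [NormedAddCommGroup G] [NormedSpace ℝ G] {Θ : Phase → G}
    {q₀ : Plane} {π : Covec} (hΘ : DifferentiableAt ℝ Θ (q₀, π)) (q y : Plane) (ζ : Covec) :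
    fderiv ℝ (fun x : Phase => Θ (q₀, x.2)) (q, π) (y, ζ) = fderiv ℝ Θ (q₀, π) (0, ζ) := by
  have h1 : HasFDerivAt (fun x : Phase => ((q₀, x.2) : Phase))
      ((0 : Phase →L[ℝ] Plane).prod (ContinuousLinearMap.snd ℝ Plane Covec)) (q, π) :=
    (hasFDerivAt_const q₀ _).prodMk hasFDerivAt_snd
  have h2 : fderiv ℝ (fun x : Phase => Θ (q₀, x.2)) (q, π) = _ :=
    (HasFDerivAt.comp (f := fun x : Phase => ((q₀, x.2) : Phase)) (q, π)
      hΘ.hasFDerivAt h1).fderiv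
  rw [h2]; simp

variable (hh : IsSmoothHam D h) (hφ : IsStraightening h q₀ O φ) (hO : O ⊆ D)
include hh hφ hO

/-- Vertical differentiation of the invariance of `h`: in the straightening coordinates the velocity
depends on the covector only. -/
theorem map_vel {x : Phase} (hx : x ∈ slit O) :
    fderiv ℝ φ x.1 (vel h (lift φ x)) = vel h (q₀, x.2) := by
  refine vec_ext_of_covec fun ζ => ?_
  have h1 := hφ.fderiv_of_lift (Θ' := fun x : Phase => h (q₀, x.2)) hx
    (hh.differentiableAt (hφ.lift_mem hO hx))
    (Filter.eventually_of_mem ((isOpen_slit hφ.isOpen).mem_nhds hx) fun y hy => hφ.ham_lift hy.1)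
    (0, ζ)
  rw [hφ.fderiv_lift hx.1, fderiv_base (hh.differentiableAt (hφ.base_mem hh hO hx.2)) x.1,
    map_zero, ContinuousLinearMap.comp_zero, add_zero, ← apply_vel, ← apply_vel] at h1
  exact h1

/-- In the lifted coordinates `h` does not depend on the point, so its Hamiltonian field has no
momentum component. Symmetry of `D²φ` accounts for the derivative of the lift. -/
theorem hamVec_lift {x : Phase} (hx : x ∈ slit O) :
    hamVec h (lift φ x) = fderiv ℝ (lift φ) x (vel h (lift φ x), 0) := by
  rw [hφ.fderiv_lift hx.1]
  refine Prod.ext rfl ?_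
  ext y
  have h1 := hφ.fderiv_of_lift (Θ' := fun x : Phase => h (q₀, x.2)) hx
    (hh.differentiableAt (hφ.lift_mem hO hx))
    (Filter.eventually_of_mem ((isOpen_slit hφ.isOpen).mem_nhds hx) fun y hy => hφ.ham_lift hy.1)
    (y, 0)
  rw [hφ.fderiv_lift hx.1, fderiv_base (hh.differentiableAt (hφ.base_mem hh hO hx.2)) x.1,
    ContinuousLinearMap.zero_comp, zero_add, show ((0, 0) : Phase) = 0 from rfl, map_zero,
    show ((y, x.2.comp (fderiv ℝ (fderiv ℝ φ) x.1 y)) : Phase) =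
      (y, 0) + (0, x.2.comp (fderiv ℝ (fderiv ℝ φ) x.1 y)) by simp, map_add, ← apply_vel] at h1
  rw [hamVec_snd, ContinuousLinearMap.zero_comp, zero_add, ContinuousLinearMap.comp_apply,
    hφ.apply_second_symm hx.1]
  rw [ContinuousLinearMap.comp_apply] at h1
  linarith

/-- The area covector scales by the inverse of `det Dφ` and the square root in `nu` by `det Dφ`, so
the factors cancel. Positivity of the determinant fixes the sign of the root. -/
theorem nu_lift {x : Phase} (hx : x ∈ slit O) :
    nu h (lift φ x) = (nu h (q₀, x.2)).comp (fderiv ℝ φ x.1) := by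
  set A := fderiv ℝ φ x.1 with hA
  have hdet := hφ.det_pos _ hx.1
  rw [← hA] at hdet
  have hbase := hφ.base_mem hh hO hx.2
  have hη : area (vel h (lift φ x)) = (planeDet A)⁻¹ • (area (vel h (q₀, x.2))).comp A := by
    ext y
    have h1 := area_map A (vel h (lift φ x)) y
    rw [map_vel hh hφ hO hx] at h1
    simp only [smul_apply, ContinuousLinearMap.comp_apply, smul_eq_mul, h1]
    rw [← mul_assoc, inv_mul_cancel₀ hdet.ne', one_mul]
  have hw : ∀ ζ : Covec, A (fderiv ℝ (vel h) (lift φ x) (0, ζ.comp A)) =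
      fderiv ℝ (vel h) (q₀, x.2) (0, ζ) := by
    intro ζ
    have hvd : DifferentiableAt ℝ (vel h) (lift φ x) :=
      (hh.contDiffAt_vel (hφ.lift_mem hO hx)).differentiableAt (by simp)
    have h2 : fderiv ℝ (fun y : Phase => fderiv ℝ φ y.1 (vel h (lift φ y))) x (0, ζ) =
        fderiv ℝ (vel h) (q₀, x.2) (0, ζ) := by
      rw [← fderiv_base ((hh.contDiffAt_vel hbase).differentiableAt (by simp)) x.1 0 ζ]
      congr 1
      exact Filter.EventuallyEq.fderiv_eq (Filter.eventually_of_mem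
        ((isOpen_slit hφ.isOpen).mem_nhds hx) fun y hy => map_vel hh hφ hO hy)
    have h3 : HasFDerivAt (fun x : Phase => fderiv ℝ φ x.1)
        ((fderiv ℝ (fderiv ℝ φ) x.1).comp (ContinuousLinearMap.fst ℝ Plane Covec)) x :=
      HasFDerivAt.comp (f := fun x : Phase => x.1) x
        ((hφ.contDiffAt_fderiv hx.1).differentiableAt (by simp)).hasFDerivAt hasFDerivAt_fst
    have h4 : HasFDerivAt (fun y : Phase => vel h (lift φ y))
        ((fderiv ℝ (vel h) (lift φ x)).comp (fderiv ℝ (lift φ) x)) x :=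
      hvd.hasFDerivAt.comp x ((hφ.contDiffAt_lift hx.1).differentiableAt (by simp)).hasFDerivAt
    rw [(h3.clm_apply h4).fderiv] at h2
    simpa [hφ.fderiv_lift hx.1] using h2
  have hg : area (vel h (lift φ x)) (fderiv ℝ (vel h) (lift φ x) (0, area (vel h (lift φ x)))) =
      ((planeDet A)⁻¹) ^ 2 *
        area (vel h (q₀, x.2)) (fderiv ℝ (vel h) (q₀, x.2) (0, area (vel h (q₀, x.2)))) := by
    rw [hη, ← hw]
    have : ((0, (planeDet A)⁻¹ • (area (vel h (q₀, x.2))).comp A) : Phase) =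
        (planeDet A)⁻¹ • (0, (area (vel h (q₀, x.2))).comp A) := by simp
    rw [this, map_smul]
    simp only [smul_apply, ContinuousLinearMap.comp_apply, smul_eq_mul, map_smul]
    ring
  rw [nu, nu, hg, hφ.ham_lift hx.1, hη]
  have hs : √((h (q₀, x.2) + 1) / (((planeDet A)⁻¹) ^ 2 *
        area (vel h (q₀, x.2)) (fderiv ℝ (vel h) (q₀, x.2) (0, area (vel h (q₀, x.2)))))) =
      planeDet A * √((h (q₀, x.2) + 1) /
        area (vel h (q₀, x.2)) (fderiv ℝ (vel h) (q₀, x.2) (0, area (vel h (q₀, x.2))))) := by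
    rw [← Real.sqrt_sq hdet.le, ← Real.sqrt_mul (sq_nonneg _), Real.sqrt_sq hdet.le]
    congr 1
    field_simp
  rw [hs, smul_smul, ContinuousLinearMap.smul_comp]
  congr 1
  field_simp

/-- Pulling back the relation `∂_ν ν + p = b ν` from the base point gives the relation at the lifted
point, and the coefficient of the nonzero `ν` is unique. -/
theorem invB_lift {x : Phase} (hx : x ∈ slit O) : invB h (lift φ x) = invB h (q₀, x.2) := by
  set A := fderiv ℝ φ x.1 with hA
  have hdet := hφ.det_pos _ hx.1
  have hbase := hφ.base_mem hh hO hx.2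
  have hmem := hφ.lift_mem hO hx
  have h1 := hh.fderiv_nu hmem
  have h2 := hh.fderiv_nu hbase
  have hd : fderiv ℝ (nu h) (lift φ x) (0, nu h (lift φ x)) =
      (fderiv ℝ (nu h) (q₀, x.2) (0, nu h (q₀, x.2))).comp A := by
    have h3 := hφ.fderiv_of_lift
      (Θ' := fun y : Phase => (nu h (q₀, y.2)).comp (fderiv ℝ φ y.1)) hx
      ((hh.contDiffAt_nu hmem).differentiableAt (by simp))
      (Filter.eventually_of_mem ((isOpen_slit hφ.isOpen).mem_nhds hx)
        fun y hy => nu_lift hh hφ hO hy) (0, nu h (q₀, x.2))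
    rw [hφ.fderiv_lift hx.1, map_zero, ContinuousLinearMap.comp_zero, add_zero,
      ← nu_lift hh hφ hO hx] at h3
    have h4 : HasFDerivAt (fun x : Phase => fderiv ℝ φ x.1)
        ((fderiv ℝ (fderiv ℝ φ) x.1).comp (ContinuousLinearMap.fst ℝ Plane Covec)) x :=
      HasFDerivAt.comp (f := fun x : Phase => x.1) x
        ((hφ.contDiffAt_fderiv hx.1).differentiableAt (by simp)).hasFDerivAt hasFDerivAt_fst
    have h5 : DifferentiableAt ℝ (fun y : Phase => nu h (q₀, y.2)) x :=
      DifferentiableAt.comp (f := fun y : Phase => ((q₀, y.2) : Phase)) x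
        ((hh.contDiffAt_nu hbase).differentiableAt (by simp)) (by fun_prop)
    rw [h3, (h5.hasFDerivAt.clm_comp h4).fderiv]
    have h6 := fderiv_base ((hh.contDiffAt_nu hbase).differentiableAt (by simp)) x.1 0
      (nu h (q₀, x.2))
    simp only [add_apply, ContinuousLinearMap.comp_apply,
      ContinuousLinearMap.coe_fst', map_zero, ContinuousLinearMap.flip_apply,
      ContinuousLinearMap.compL_apply, zero_add]
    rw [h6]
  rw [hd, show (lift φ x).2 = x.2.comp A from rfl, nu_lift hh hφ hO hx,
    ← ContinuousLinearMap.add_comp, h2, ContinuousLinearMap.smul_comp] at h1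
  have hne : (nu h (q₀, x.2)).comp A ≠ 0 :=
    comp_ne_zero_of_planeDet hdet.ne' (hh.nu_ne_zero hbase)
  exact (smul_left_injective ℝ hne h1).symm

/-- In the lifted coordinates `v` is vertical with components independent of the point and `h⃗` is
horizontal, so their bracket is horizontal: only the derivative of the velocity along `v` survives.
-/
theorem bracket_lift {x : Phase} (hx : x ∈ slit O) :
    lieBracket ℝ (vertField h) (hamVec h) (lift φ x) = fderiv ℝ (lift φ) x
      (fderiv ℝ (fun y => vel h (lift φ y)) x (0, nu h (q₀, x.2)), 0) := by
  have hmem := hφ.lift_mem hO hx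
  have hbase := hφ.base_mem hh hO hx.2
  have hnb : DifferentiableAt ℝ (fun y : Phase => nu h (q₀, y.2)) x :=
    DifferentiableAt.comp (f := fun y : Phase => ((q₀, y.2) : Phase)) x
      ((hh.contDiffAt_nu hbase).differentiableAt (by simp)) (by fun_prop)
  have hvl : DifferentiableAt ℝ (fun y : Phase => vel h (lift φ y)) x :=
    DifferentiableAt.comp (f := lift φ) x
      ((hh.contDiffAt_vel hmem).differentiableAt (by simp))
      ((hφ.contDiffAt_lift hx.1).differentiableAt (by simp))
  have hnhds := (isOpen_slit hφ.isOpen).mem_nhds hx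
  have h1 := lieBracket_related (Z := lift φ) (X := fun y => ((0, nu h (q₀, y.2)) : Phase))
    (Y := fun y => ((vel h (lift φ y), 0) : Phase)) (V := vertField h) (W := hamVec h)
    (hφ.contDiffAt_lift hx.1) ((differentiableAt_const _).prodMk hnb)
    (hvl.prodMk (differentiableAt_const _))
    ((hh.contDiffAt_vertField hmem).differentiableAt (by simp))
    ((hh.contDiffAt_hamVec hmem).differentiableAt (by simp))
    (Filter.eventually_of_mem hnhds fun y hy => by
      rw [hφ.fderiv_lift hy.1, vertField, nu_lift hh hφ hO hy]; simp)
    (Filter.eventually_of_mem hnhds fun y hy => hamVec_lift hh hφ hO hy)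
  rw [h1]
  congr 1
  have e1 : fderiv ℝ (fun y => ((vel h (lift φ y), 0) : Phase)) x (0, nu h (q₀, x.2)) =
      (fderiv ℝ (fun y => vel h (lift φ y)) x (0, nu h (q₀, x.2)), 0) := by
    rw [(hvl.hasFDerivAt.prodMk (hasFDerivAt_const (0 : Covec) x)).fderiv]; simp
  have e2 : fderiv ℝ (fun y => ((0, nu h (q₀, y.2)) : Phase)) x (vel h (lift φ x), 0) = 0 := by
    rw [((hasFDerivAt_const (0 : Plane) x).prodMk hnb.hasFDerivAt).fderiv]
    have := fderiv_base ((hh.contDiffAt_nu hbase).differentiableAt (by simp)) x.1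
      (vel h (lift φ x)) (0 : Covec)
    rw [show ((0, 0) : Phase) = 0 from rfl, map_zero] at this
    simp [this]
  rw [lieBracket, e1, e2, sub_zero]

/-- Both fields are horizontal and `Dφ` carries their components to functions of the covector only.
Where `Dφ = id`, their horizontal derivatives are therefore given by `-D²φ`, and the bracket
vanishes by symmetry. -/
theorem curvature_base {π : Covec} (hπ : π ≠ 0) :
    lieBracket ℝ (hamVec h) (lieBracket ℝ (vertField h) (hamVec h)) (q₀, π) = 0 := by
  set x : Phase := (q₀, π) with hxdef
  have hx : x ∈ slit O := ⟨hφ.mem, hπ⟩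
  have hxl : lift φ x = x := hφ.lift_base π
  have hbase : x ∈ slit D := hφ.base_mem hh hO hπ
  set V : Phase → Plane := fun y => vel h (lift φ y) with hV
  set W : Phase → Plane := fun y => fderiv ℝ V y (0, nu h (q₀, y.2)) with hW
  have hVs : ∀ y ∈ slit O, ContDiffAt ℝ ∞ V y := fun y hy =>
    ContDiffAt.comp (f := lift φ) y (hh.contDiffAt_vel (hφ.lift_mem hO hy))
      (hφ.contDiffAt_lift hy.1)
  have hns : ∀ y ∈ slit O, ContDiffAt ℝ ∞ (fun y : Phase => nu h (q₀, y.2)) y := fun y hy =>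
    ContDiffAt.comp (f := fun y : Phase => ((q₀, y.2) : Phase)) y
      (hh.contDiffAt_nu (hφ.base_mem hh hO hy.2)) (by fun_prop)
  have hWs : ∀ y ∈ slit O, ContDiffAt ℝ ∞ W y := fun y hy =>
    ((hVs y hy).fderiv_right (m := ∞) (by simp)).clm_apply (contDiffAt_const.prodMk (hns y hy))
  have hVd := (hVs x hx).differentiableAt (by simp)
  have hWd := (hWs x hx).differentiableAt (by simp)
  have hnhds := (isOpen_slit hφ.isOpen).mem_nhds hx
  have h1 := lieBracket_related (Z := lift φ) (X := fun y => ((V y, 0) : Phase))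
    (Y := fun y => ((W y, 0) : Phase)) (V := hamVec h)
    (W := lieBracket ℝ (vertField h) (hamVec h)) (x := x)
    (hφ.contDiffAt_lift hx.1) (hVd.prodMk (differentiableAt_const _))
    (hWd.prodMk (differentiableAt_const _))
    (by rw [hxl]; exact (hh.contDiffAt_hamVec hbase).differentiableAt (by simp))
    (by rw [hxl]
        exact ((hh.contDiffAt_vertField hbase).lieBracket_vectorField (hh.contDiffAt_hamVec hbase)
          (m := ∞) (by simp)).differentiableAt (by simp))
    (Filter.eventually_of_mem hnhds fun y hy => hamVec_lift hh hφ hO hy)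
    (Filter.eventually_of_mem hnhds fun y hy => bracket_lift hh hφ hO hy)
  rw [hxl] at h1
  rw [h1]
  have e0 : ∀ {Y : Phase → Plane}, DifferentiableAt ℝ Y x → ∀ y : Plane,
      fderiv ℝ (fun y => ((Y y, 0) : Phase)) x (y, 0) = (fderiv ℝ Y x (y, 0), 0) := by
    intro Y hY y
    rw [(hY.hasFDerivAt.prodMk (hasFDerivAt_const (0 : Covec) x)).fderiv]; simp
  -- fields with constant components in the straightening coordinates
  have e1 : ∀ {Y : Phase → Plane} {Θ : Phase → Plane}, DifferentiableAt ℝ Y x →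
      DifferentiableAt ℝ Θ x →
      (∀ y ∈ slit O, fderiv ℝ φ y.1 (Y y) = Θ (q₀, y.2)) → ∀ y : Plane,
      fderiv ℝ Y x (y, 0) = -fderiv ℝ (fderiv ℝ φ) q₀ y (Y x) := by
    intro Y Θ hY hΘ hYΘ y
    have h3 : HasFDerivAt (fun x : Phase => fderiv ℝ φ x.1)
        ((fderiv ℝ (fderiv ℝ φ) x.1).comp (ContinuousLinearMap.fst ℝ Plane Covec)) x :=
      HasFDerivAt.comp (f := fun x : Phase => x.1) x
        ((hφ.contDiffAt_fderiv hx.1).differentiableAt (by simp)).hasFDerivAt hasFDerivAt_fst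
    have h4 : fderiv ℝ (fun y : Phase => fderiv ℝ φ y.1 (Y y)) x (y, 0) = 0 := by
      rw [Filter.EventuallyEq.fderiv_eq (Filter.eventually_of_mem hnhds hYΘ),
        fderiv_base hΘ q₀ y 0]
      exact map_zero _
    rw [(h3.clm_apply hY.hasFDerivAt).fderiv] at h4
    have hb : fderiv ℝ φ x.1 = ContinuousLinearMap.id ℝ Plane := hφ.base
    simp [hb] at h4
    exact eq_neg_of_add_eq_zero_left h4
  have hVeq := e1 hVd ((hh.contDiffAt_vel hbase).differentiableAt (by simp))
    fun y hy => map_vel hh hφ hO hy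
  have hWΘ : ∀ y ∈ slit O, fderiv ℝ φ y.1 (W y) =
      (fun y : Phase => fderiv ℝ (vel h) y (0, nu h y)) (q₀, y.2) := by
    intro y hy
    have h3 : HasFDerivAt (fun x : Phase => fderiv ℝ φ x.1)
        ((fderiv ℝ (fderiv ℝ φ) y.1).comp (ContinuousLinearMap.fst ℝ Plane Covec)) y :=
      HasFDerivAt.comp (f := fun x : Phase => x.1) y
        ((hφ.contDiffAt_fderiv hy.1).differentiableAt (by simp)).hasFDerivAt hasFDerivAt_fst
    have h4 : fderiv ℝ (fun y : Phase => fderiv ℝ φ y.1 (V y)) y (0, nu h (q₀, y.2)) =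
        fderiv ℝ (vel h) (q₀, y.2) (0, nu h (q₀, y.2)) := by
      rw [Filter.EventuallyEq.fderiv_eq (Filter.eventually_of_mem
        ((isOpen_slit hφ.isOpen).mem_nhds hy) fun y hy => map_vel hh hφ hO hy)]
      exact fderiv_base ((hh.contDiffAt_vel (hφ.base_mem hh hO hy.2)).differentiableAt (by simp))
        y.1 0 _
    rw [(h3.clm_apply ((hVs y hy).differentiableAt (by simp)).hasFDerivAt).fderiv] at h4
    simpa using h4
  have hΘd : DifferentiableAt ℝ (fun y : Phase => fderiv ℝ (vel h) y (0, nu h y)) x :=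
    (((hh.contDiffAt_vel hbase).fderiv_right (m := ∞) (by simp)).clm_apply
      (contDiffAt_const.prodMk (hh.contDiffAt_nu hbase))).differentiableAt (by simp)
  have hWeq := e1 hWd hΘd hWΘ
  have : lieBracket ℝ (fun y => ((V y, 0) : Phase)) (fun y => ((W y, 0) : Phase)) x = 0 := by
    rw [lieBracket, e0 hWd, e0 hVd, hVeq, hWeq, hφ.apply_second_symm hφ.mem (V x)]
    simp
  rw [this, map_zero]

/-- Both fields are horizontal in the lifted coordinates, where `invB` depends on the covector only.
-/
theorem lieDeriv_invB_base {π : Covec} (hπ : π ≠ 0) :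
    lieDeriv (hamVec h) (invB h) (q₀, π) = 0 ∧
      lieDeriv (lieBracket ℝ (vertField h) (hamVec h)) (invB h) (q₀, π) = 0 := by
  set x : Phase := (q₀, π) with hxdef
  have hx : x ∈ slit O := ⟨hφ.mem, hπ⟩
  have hxl : lift φ x = x := hφ.lift_base π
  have hbase : x ∈ slit D := hφ.base_mem hh hO hπ
  have hbd : DifferentiableAt ℝ (invB h) x := (hh.contDiffAt_invB hbase).differentiableAt (by simp)
  have key : ∀ y : Plane, fderiv ℝ (invB h) x (fderiv ℝ (lift φ) x (y, 0)) = 0 := by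
    intro y
    have h1 := hφ.fderiv_of_lift (Θ := invB h) (Θ' := fun x : Phase => invB h (q₀, x.2)) hx
      (by rwa [hxl])
      (Filter.eventually_of_mem ((isOpen_slit hφ.isOpen).mem_nhds hx)
        fun y hy => invB_lift hh hφ hO hy) (y, 0)
    rw [hxl] at h1
    rw [h1, fderiv_base hbd q₀ y 0]
    exact map_zero _
  have h1 := hamVec_lift hh hφ hO hx
  have h2 := bracket_lift hh hφ hO hx
  rw [hxl] at h1 h2
  rw [lieDeriv, lieDeriv, h1, h2]
  exact ⟨key _, key _⟩

end IsStraightening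

/-- The invariants of a Hamiltonian that can be straightened near every point vanish. -/
theorem invariantsVanishOn_of_straightening {D : Set Plane} {h : Phase → ℝ}
    (hh : IsSmoothHam D h) {e : ℝ} (he : -1 < e)
    (hflat : ∀ q₀ ∈ D, ∃ O φ, O ⊆ D ∧ IsStraightening h q₀ O φ) : InvariantsVanishOn D h e := by
  refine ⟨vertField h, invB h, fun _ => 0, hh.isCanonicalField he, fun z hz => ?_, fun z hz => ?_⟩
  · obtain ⟨O, φ, hO, hφ⟩ := hflat z.1 hz.1
    rw [zero_smul]
    exact hφ.curvature_base hh hO (hh.mem_slit he hz).2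
  · obtain ⟨O, φ, hO, hφ⟩ := hflat z.1 hz.1
    exact ⟨rfl, hφ.lieDeriv_invB_base hh hO (hh.mem_slit he hz).2⟩

/-! ### Level sets of the Hamiltonian in polar coordinates -/

/-- Points of the plane together with an angular coordinate of the fibre. -/
abbrev Polar : Type := Plane × ℝ

/-- The points over `D`. -/
def cyl (D : Set Plane) : Set Polar := D ×ˢ (univ : Set ℝ)

theorem isOpen_cyl {D : Set Plane} (hD : IsOpen D) : IsOpen (cyl D) := hD.prod isOpen_univ

/-- A full turn in the fibre. -/
def turn : Polar := (0, 2 * Real.pi)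

/-- The unit covector with angle `θ`. -/
def unitCov (θ : ℝ) : Covec :=
  Real.cos θ • (EuclideanSpace.proj 0 : Covec) + Real.sin θ • (EuclideanSpace.proj 1 : Covec)

theorem unitCov_apply (θ : ℝ) (x : Plane) : unitCov θ x = Real.cos θ * x 0 + Real.sin θ * x 1 := by
  simp [unitCov]

theorem contDiff_unitCov : ContDiff ℝ ∞ unitCov :=
  (Real.contDiff_cos.smul contDiff_const).add (Real.contDiff_sin.smul contDiff_const)

theorem unitCov_ne_zero (θ : ℝ) : unitCov θ ≠ 0 := by
  intro h0
  have h1 := congrArg (fun ξ : Covec => ξ e₁) h0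
  have h2 := congrArg (fun ξ : Covec => ξ e₂) h0
  simp [unitCov_apply] at h1 h2
  have := Real.sin_sq_add_cos_sq θ
  rw [h1, h2] at this
  norm_num at this

theorem exists_eq_smul_unitCov {π : Covec} (hπ : π ≠ 0) : ∃ ρ θ : ℝ, 0 < ρ ∧ π = ρ • unitCov θ := by
  set w : ℂ := ⟨π e₁, π e₂⟩ with hw
  have hw0 : w ≠ 0 := by
    intro h0
    apply hπ
    have h1 := congrArg Complex.re h0
    have h2 := congrArg Complex.im h0
    exact covec_ext h1 h2
  refine ⟨‖w‖, w.arg, norm_pos_iff.2 hw0, covec_ext ?_ ?_⟩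
  · simp [unitCov_apply, hw]
  · simp [unitCov_apply, hw]

/-- The covector of the level set `h + 1 = c` over a point with a given angle. -/
def levelCov (h : Phase → ℝ) (c : ℝ) (x : Polar) : Covec :=
  (c / (h (x.1, unitCov x.2) + 1)) • unitCov x.2

/-- The parametrization of the level set `h + 1 = c`. -/
def levelPoint (h : Phase → ℝ) (c : ℝ) (x : Polar) : Phase := (x.1, levelCov h c x)

/-- The derivative of the covector in the angle. -/
def levelTan (h : Phase → ℝ) (c : ℝ) (x : Polar) : Covec := fderiv ℝ (levelCov h c) x (0, 1)

/-- The angular component of a tangent vector to the level set. -/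
def angular (h : Phase → ℝ) (c : ℝ) (x : Polar) (V : Phase) : ℝ :=
  (V.2 - fderiv ℝ (levelCov h c) x (V.1, 0)) (sharp (levelTan h c x)) /
    levelTan h c x (sharp (levelTan h c x))

theorem unitCov_mem {D : Set Plane} {x : Polar} (hx : x ∈ cyl D) :
    ((x.1, unitCov x.2) : Phase) ∈ slit D := ⟨hx.1, unitCov_ne_zero _⟩

theorem levelCov_periodic (h : Phase → ℝ) (c : ℝ) (x : Polar) :
    levelCov h c (x + turn) = levelCov h c x := by
  have : unitCov (x.2 + 2 * Real.pi) = unitCov x.2 := by simp [unitCov]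
  simp [levelCov, turn, this]

theorem levelPoint_periodic (h : Phase → ℝ) (c : ℝ) (x : Polar) :
    levelPoint h c (x + turn) = levelPoint h c x := by
  rw [levelPoint, levelCov_periodic]; simp [levelPoint, turn]

theorem fderiv_periodic {G : Type*} [NormedAddCommGroup G] [NormedSpace ℝ G] {f : Polar → G}
    (hf : ∀ x, f (x + turn) = f x) (x : Polar) : fderiv ℝ f (x + turn) = fderiv ℝ f x := by
  rw [← fderiv_comp_add_right]; simp only [hf]

theorem levelTan_periodic (h : Phase → ℝ) (c : ℝ) (x : Polar) :
    levelTan h c (x + turn) = levelTan h c x := by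
  rw [levelTan, fderiv_periodic (levelCov_periodic h c)]; rfl

theorem angular_periodic (h : Phase → ℝ) (c : ℝ) (x : Polar) (V : Phase) :
    angular h c (x + turn) V = angular h c x V := by
  rw [angular, levelTan_periodic, fderiv_periodic (levelCov_periodic h c)]; rfl

/-- The Lie derivative of a form along a field, computed in a parametrization. -/
theorem lieDerivForm_related {E : Type*} [NormedAddCommGroup E] [NormedSpace ℝ E] {Z : E → Phase}
    {X : E → E} {v : Phase → Phase} {η : Phase → (Phase →L[ℝ] ℝ)} {ζ : E → (E →L[ℝ] ℝ)} {x : E}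
    (hZ : ContDiffAt ℝ ∞ Z x) (hX : DifferentiableAt ℝ X x) (hv : DifferentiableAt ℝ v (Z x))
    (hη : DifferentiableAt ℝ η (Z x)) (hXv : ∀ᶠ y in 𝓝 x, v (Z y) = fderiv ℝ Z y (X y))
    (hζ : ∀ᶠ y in 𝓝 x, (η (Z y)).comp (fderiv ℝ Z y) = ζ y) (w : E) :
    lieDerivForm v η (Z x) (fderiv ℝ Z x w) = fderiv ℝ ζ x (X x) w + ζ x (fderiv ℝ X x w) := by
  have hdZ : DifferentiableAt ℝ Z x := hZ.differentiableAt (by simp)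
  have hd2Z : DifferentiableAt ℝ (fderiv ℝ Z) x :=
    (hZ.fderiv_right (m := ∞) (by simp)).differentiableAt (by simp)
  have hsymm : ∀ u w, fderiv ℝ (fderiv ℝ Z) x u w = fderiv ℝ (fderiv ℝ Z) x w u := by
    have : IsSymmSndFDerivAt ℝ Z x := hZ.isSymmSndFDerivAt (by
      rw [minSmoothness_of_isRCLikeNormedField]; exact two_le_infty)
    exact fun u w => this u w
  have h1 : fderiv ℝ v (Z x) (fderiv ℝ Z x w) =
      fderiv ℝ (fderiv ℝ Z) x w (X x) + fderiv ℝ Z x (fderiv ℝ X x w) := by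
    have h2 : fderiv ℝ (fun y => v (Z y)) x w = fderiv ℝ v (Z x) (fderiv ℝ Z x w) := by
      rw [show (fun y => v (Z y)) = v ∘ Z from rfl, fderiv_comp x hv hdZ]; rfl
    rw [← h2, Filter.EventuallyEq.fderiv_eq hXv, fderiv_clm_apply hd2Z hX]
    simp [add_comm]
  have h3 : HasFDerivAt (fun y => η (Z y)) ((fderiv ℝ η (Z x)).comp (fderiv ℝ Z x)) x :=
    HasFDerivAt.comp (g := η) (f := Z) x hη.hasFDerivAt hdZ.hasFDerivAt
  have h4 := (h3.clm_comp hd2Z.hasFDerivAt).fderiv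
  rw [Filter.EventuallyEq.fderiv_eq hζ] at h4
  rw [h4, ← hζ.self_of_nhds, lieDerivForm, add_apply, ContinuousLinearMap.comp_apply, h1,
    hXv.self_of_nhds, map_add, hsymm w]
  simp
  ring

namespace IsSmoothHam

variable {D : Set Plane} {h : Phase → ℝ} {c : ℝ}

theorem contDiffOn_levelCov (hh : IsSmoothHam D h) : ContDiffOn ℝ ∞ (levelCov h c) (cyl D) := by
  have hu : ContDiffOn ℝ ∞ (fun x : Polar => unitCov x.2) (cyl D) :=
    (contDiff_unitCov.comp contDiff_snd).contDiffOn
  have h1 : ContDiffOn ℝ ∞ (fun x : Polar => h (x.1, unitCov x.2)) (cyl D) :=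
    hh.smooth.comp (contDiffOn_fst.prodMk hu) fun x hx => unitCov_mem hx
  exact (contDiffOn_const.div (h1.add contDiffOn_const) fun x hx =>
    (hh.pos _ (unitCov_mem hx)).ne').smul hu

theorem contDiffAt_levelCov (hh : IsSmoothHam D h) {x : Polar} (hx : x ∈ cyl D) :
    ContDiffAt ℝ ∞ (levelCov h c) x :=
  hh.contDiffOn_levelCov.contDiffAt ((isOpen_cyl hh.isOpen).mem_nhds hx)

theorem contDiffAt_levelPoint (hh : IsSmoothHam D h) {x : Polar} (hx : x ∈ cyl D) :
    ContDiffAt ℝ ∞ (levelPoint h c) x := contDiffAt_fst.prodMk (hh.contDiffAt_levelCov hx)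

theorem fderiv_levelPoint (hh : IsSmoothHam D h) {x : Polar} (hx : x ∈ cyl D) (w : Polar) :
    fderiv ℝ (levelPoint h c) x w = (w.1, fderiv ℝ (levelCov h c) x w) := by
  have h1 : fderiv ℝ (levelPoint h c) x = _ := (hasFDerivAt_fst.prodMk
    ((hh.contDiffAt_levelCov hx).differentiableAt (by simp)).hasFDerivAt).fderiv
  rw [h1]; rfl

theorem ham_levelPoint (hh : IsSmoothHam D h) (hc : 0 < c) {x : Polar} (hx : x ∈ cyl D) :
    h (levelPoint h c x) = c - 1 := by
  have hpos := hh.pos _ (unitCov_mem hx)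
  have := hh.homogeneous x.1 hx.1 (unitCov x.2) _ (div_pos hc hpos)
  rw [div_mul_cancel₀ _ hpos.ne'] at this
  rw [levelPoint, levelCov]
  linarith

theorem levelPoint_mem (hh : IsSmoothHam D h) (hc : 0 < c) {x : Polar} (hx : x ∈ cyl D) :
    levelPoint h c x ∈ slit D :=
  ⟨hx.1, smul_ne_zero (div_pos hc (hh.pos _ (unitCov_mem hx))).ne' (unitCov_ne_zero _)⟩

theorem fderiv_ham_levelPoint (hh : IsSmoothHam D h) (hc : 0 < c) {x : Polar} (hx : x ∈ cyl D)
    (w : Polar) : fderiv ℝ h (levelPoint h c x) (fderiv ℝ (levelPoint h c) x w) = 0 := by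
  have h1 : fderiv ℝ (fun y => h (levelPoint h c y)) x =
      (fderiv ℝ h (levelPoint h c x)).comp (fderiv ℝ (levelPoint h c) x) :=
    fderiv_comp x (hh.differentiableAt (hh.levelPoint_mem hc hx))
      ((hh.contDiffAt_levelPoint hx).differentiableAt (by simp))
  have h2 : (fun y => h (levelPoint h c y)) =ᶠ[𝓝 x] fun _ => c - 1 :=
    Filter.eventually_of_mem ((isOpen_cyl hh.isOpen).mem_nhds hx) fun y hy =>
      hh.ham_levelPoint hc hy
  rw [h2.fderiv_eq] at h1
  have := congrArg (fun L : Polar →L[ℝ] ℝ => L w) h1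
  simpa using this.symm

/-- Tested on the vector `y` of the unit frame that the unit covector kills, the angular derivative
sees only the rotation and not the radial factor, so it equals that positive factor. -/
theorem levelTan_ne_zero (hh : IsSmoothHam D h) (hc : 0 < c) {x : Polar} (hx : x ∈ cyl D) :
    levelTan h c x ≠ 0 := by
  set y : Plane := -Real.sin x.2 • e₁ + Real.cos x.2 • e₂ with hy
  intro h0
  have hl : HasDerivAt (fun s : ℝ => ((x.1, s) : Polar)) (0, 1) x.2 :=
    (hasDerivAt_const x.2 x.1).prodMk (hasDerivAt_id x.2)
  have h1 : HasDerivAt (fun s : ℝ => levelCov h c (x.1, s)) (levelTan h c x) x.2 :=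
    HasFDerivAt.comp_hasDerivAt (f := fun s : ℝ => ((x.1, s) : Polar)) x.2
      ((hh.contDiffAt_levelCov (c := c) hx).differentiableAt (by simp)).hasFDerivAt hl
  have h1' : HasDerivAt (fun s : ℝ => levelCov h c (x.1, s) y) (levelTan h c x y) x.2 := by
    simpa using h1.clm_apply (hasDerivAt_const x.2 y)
  have hρ : DifferentiableAt ℝ (fun s : ℝ => c / (h (x.1, unitCov s) + 1)) x.2 := by
    have h2 : DifferentiableAt ℝ (fun s : ℝ => h (x.1, unitCov s)) x.2 :=
      DifferentiableAt.comp (f := fun s : ℝ => ((x.1, unitCov s) : Phase)) x.2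
        (hh.differentiableAt (unitCov_mem hx))
        ((differentiableAt_const _).prodMk (contDiff_unitCov.contDiffAt.differentiableAt (by simp)))
    exact (differentiableAt_const _).div (h2.add (differentiableAt_const _))
      (hh.pos _ (unitCov_mem hx)).ne'
  have hn : HasDerivAt (fun s : ℝ => unitCov s y) 1 x.2 := by
    have h3 : HasDerivAt (fun s : ℝ => Real.cos s * y 0 + Real.sin s * y 1)
        (-Real.sin x.2 * y 0 + Real.cos x.2 * y 1) x.2 :=
      ((Real.hasDerivAt_cos _).mul_const _).add ((Real.hasDerivAt_sin _).mul_const _)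
    have h4 : -Real.sin x.2 * y 0 + Real.cos x.2 * y 1 = 1 := by
      have := Real.sin_sq_add_cos_sq x.2
      simp [hy]; linarith
    rw [h4] at h3
    simpa only [unitCov_apply] using h3
  have h5 := hρ.hasDerivAt.mul hn
  have h6 : unitCov x.2 y = 0 := by rw [unitCov_apply]; simp [hy]; ring
  have h7 := h1'.unique (h5.congr_of_eventuallyEq (Filter.Eventually.of_forall fun s => by
    simp [levelCov]))
  rw [h0, h6] at h7
  simp only [zero_apply, mul_zero, mul_one, zero_add] at h7
  exact (div_pos hc (hh.pos _ (unitCov_mem hx))).ne h7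

/-- Tangent vectors to the level set come from the parametrization. -/
theorem eq_fderiv_levelPoint (hh : IsSmoothHam D h) (hc : 0 < c) {x : Polar} (hx : x ∈ cyl D)
    {V : Phase} (hV : fderiv ℝ h (levelPoint h c x) V = 0) :
    V = fderiv ℝ (levelPoint h c) x (V.1, angular h c x V) := by
  have h1 := hh.fderiv_ham_levelPoint hc hx (V.1, 0)
  have h2 := hh.fderiv_ham_levelPoint hc hx (0, 1)
  rw [hh.fderiv_levelPoint hx] at h1 h2 ⊢
  have h3 : (V.2 - fderiv ℝ (levelCov h c) x (V.1, 0)) (vel h (levelPoint h c x)) = 0 := by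
    rw [apply_vel]
    have : ((0, V.2 - fderiv ℝ (levelCov h c) x (V.1, 0)) : Phase) =
      V - (V.1, fderiv ℝ (levelCov h c) x (V.1, 0)) := by ext <;> simp
    rw [this, map_sub, hV, h1, sub_zero]
  have h4 : levelTan h c x (vel h (levelPoint h c x)) = 0 := by rw [apply_vel]; exact h2
  have h5 := covec_eq_smul (hh.vel_ne_zero (hh.levelPoint_mem hc hx)) (hh.levelTan_ne_zero hc hx)
    h3 h4
  refine Prod.ext rfl ?_
  rw [show ((V.1, angular h c x V) : Polar) = (V.1, 0) + angular h c x V • (0, 1) by simp,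
    map_add, map_smul]
  exact (eq_add_of_sub_eq' h5)

/-- The parametrization is an immersion, so a vanishing bracket on the level set gives a vanishing
bracket in polar coordinates. -/
theorem fderiv_levelPoint_injective (hh : IsSmoothHam D h) (hc : 0 < c) {x : Polar}
    (hx : x ∈ cyl D) {w : Polar} (hw : fderiv ℝ (levelPoint h c) x w = 0) : w = 0 := by
  rw [hh.fderiv_levelPoint hx] at hw
  have h1 : w.1 = 0 := congrArg Prod.fst hw
  have h2 : fderiv ℝ (levelCov h c) x w = 0 := congrArg Prod.snd hw
  rw [show w = w.2 • (0, 1) by ext <;> simp [h1], map_smul] at h2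
  rcases smul_eq_zero.1 h2 with h3 | h3
  · exact Prod.ext h1 h3
  · exact absurd h3 (hh.levelTan_ne_zero hc hx)

theorem contDiffOn_angular (hh : IsSmoothHam D h) (hc : 0 < c) {V : Polar → Phase}
    (hV : ContDiffOn ℝ ∞ V (cyl D)) : ContDiffOn ℝ ∞ (fun x => angular h c x (V x)) (cyl D) := by
  have hd : ContDiffOn ℝ ∞ (fderiv ℝ (levelCov h c)) (cyl D) :=
    hh.contDiffOn_levelCov.fderiv_of_isOpen (isOpen_cyl hh.isOpen) (by simp)
  have ht : ContDiffOn ℝ ∞ (levelTan h c) (cyl D) := hd.clm_apply contDiffOn_const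
  have hs : ContDiffOn ℝ ∞ (fun x => sharp (levelTan h c x)) (cyl D) :=
    sharp.contDiff.comp_contDiffOn ht
  exact ((hV.snd.sub (hd.clm_apply (hV.fst.prodMk contDiffOn_const))).clm_apply hs).div
    (ht.clm_apply hs) fun x hx => (apply_sharp_self_pos (hh.levelTan_ne_zero hc hx)).ne'

end IsSmoothHam

/-! ### Moving frames with vanishing invariants -/

/-- A form `P` on `D`, depending on an angle, with the fields `a ∂_θ` and `X` of a flat structure. -/
structure IsFlatFrame (D : Set Plane) (c : ℝ) (P : Polar → Covec) (a b : Polar → ℝ)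
    (X : Polar → Polar) : Prop where
  isOpen : IsOpen D
  pos : 0 < c
  smooth_form : ContDiffOn ℝ ∞ P (cyl D)
  smooth_a : ContDiffOn ℝ ∞ a (cyl D)
  smooth_b : ContDiffOn ℝ ∞ b (cyl D)
  smooth_field : ContDiffOn ℝ ∞ X (cyl D)
  periodic_form : ∀ x, P (x + turn) = P x
  periodic_a : ∀ x, a (x + turn) = a x
  periodic_b : ∀ x, b (x + turn) = b x
  periodic_field : ∀ x, X (x + turn) = X x
  form_field : ∀ x ∈ cyl D, P x (X x).1 = c
  dform_field : ∀ x ∈ cyl D, fderiv ℝ P x (0, 1) (X x).1 = 0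
  structure_eq : ∀ x ∈ cyl D, fderiv ℝ (fun y => a y • fderiv ℝ P y (0, 1)) x (0, a x) =
    -P x + b x • a x • fderiv ℝ P x (0, 1)
  commute : ∀ x ∈ cyl D, lieBracket ℝ X (lieBracket ℝ (fun y => (0, a y)) X) x = 0
  deriv_b : ∀ x ∈ cyl D, fderiv ℝ b x (X x) = 0
  deriv_b' : ∀ x ∈ cyl D, fderiv ℝ b x (lieBracket ℝ (fun y => (0, a y)) X x) = 0

/-- The vertical field. -/
def vertical (a : Polar → ℝ) (x : Polar) : Polar := (0, a x)

/-- The bracket of the vertical field and `X`. -/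
def bracket (a : Polar → ℝ) (X : Polar → Polar) : Polar → Polar := lieBracket ℝ (vertical a) X

/-- The derivative of `P` along the vertical field. -/
def dform (P : Polar → Covec) (a : Polar → ℝ) (x : Polar) : Covec := a x • fderiv ℝ P x (0, 1)

/-- The form whose graph is spanned by the frame. -/
def slope (c : ℝ) (P : Polar → Covec) (a : Polar → ℝ) (X : Polar → Polar) (x : Polar) : Covec :=
  c⁻¹ • ((X x).2 • P x + (bracket a X x).2 • dform P a x)

namespace IsFlatFrame

variable {D : Set Plane} {c : ℝ} {P : Polar → Covec} {a b : Polar → ℝ} {X : Polar → Polar}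
  {x : Polar}

theorem mem_nhds (hF : IsFlatFrame D c P a b X) (hx : x ∈ cyl D) : cyl D ∈ 𝓝 x :=
  (isOpen_cyl hF.isOpen).mem_nhds hx

theorem contDiffOn_vertical (hF : IsFlatFrame D c P a b X) :
    ContDiffOn ℝ ∞ (vertical a) (cyl D) := contDiffOn_const.prodMk hF.smooth_a

theorem contDiffOn_bracket (hF : IsFlatFrame D c P a b X) :
    ContDiffOn ℝ ∞ (bracket a X) (cyl D) := by
  have ho := isOpen_cyl hF.isOpen
  exact ((hF.smooth_field.fderiv_of_isOpen ho (by simp)).clm_apply hF.contDiffOn_vertical).sub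
    ((hF.contDiffOn_vertical.fderiv_of_isOpen ho (by simp)).clm_apply hF.smooth_field)

theorem contDiffOn_dform (hF : IsFlatFrame D c P a b X) : ContDiffOn ℝ ∞ (dform P a) (cyl D) :=
  hF.smooth_a.smul ((hF.smooth_form.fderiv_of_isOpen (isOpen_cyl hF.isOpen) (by simp)).clm_apply
    contDiffOn_const)

theorem contDiffOn_slope (hF : IsFlatFrame D c P a b X) :
    ContDiffOn ℝ ∞ (slope c P a X) (cyl D) :=
  ((hF.smooth_field.snd.smul hF.smooth_form).add
    (hF.contDiffOn_bracket.snd.smul hF.contDiffOn_dform)).const_smul _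

theorem differentiableAt (hF : IsFlatFrame D c P a b X) {G : Type*} [NormedAddCommGroup G]
    [NormedSpace ℝ G] {f : Polar → G} (hf : ContDiffOn ℝ ∞ f (cyl D)) (hx : x ∈ cyl D) :
    DifferentiableAt ℝ f x := (hf.contDiffAt (hF.mem_nhds hx)).differentiableAt (by simp)

/-- Differentiation of a constant pairing. -/
theorem fderiv_pairing (hF : IsFlatFrame D c P a b X) {R : Polar → Covec} {Y : Polar → Plane}
    {k : ℝ} (hR : ContDiffOn ℝ ∞ R (cyl D)) (hY : ContDiffOn ℝ ∞ Y (cyl D))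
    (hk : ∀ x ∈ cyl D, R x (Y x) = k) (hx : x ∈ cyl D) (w : Polar) :
    fderiv ℝ R x w (Y x) + R x (fderiv ℝ Y x w) = 0 := by
  have h1 : fderiv ℝ (fun y => R y (Y y)) x = 0 := by
    have h2 : (fun y => R y (Y y)) =ᶠ[𝓝 x] fun _ => k :=
      Filter.eventually_of_mem (hF.mem_nhds hx) hk
    rw [h2.fderiv_eq]
    simp
  rw [fderiv_clm_apply (hF.differentiableAt hR hx) (hF.differentiableAt hY hx)] at h1
  have := congrArg (fun L : Polar →L[ℝ] ℝ => L w) h1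
  simp at this
  linarith

theorem fderiv_fst_field (hF : IsFlatFrame D c P a b X) {Y : Polar → Polar}
    (hY : ContDiffOn ℝ ∞ Y (cyl D)) (hx : x ∈ cyl D) (w : Polar) :
    fderiv ℝ (fun y => (Y y).1) x w = (fderiv ℝ Y x w).1 := by
  rw [fderiv.fst (hF.differentiableAt hY hx)]; rfl

theorem fderiv_snd_field (hF : IsFlatFrame D c P a b X) {Y : Polar → Polar}
    (hY : ContDiffOn ℝ ∞ Y (cyl D)) (hx : x ∈ cyl D) (w : Polar) :
    fderiv ℝ (fun y => (Y y).2) x w = (fderiv ℝ Y x w).2 := by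
  rw [fderiv.snd (hF.differentiableAt hY hx)]; rfl

theorem fderiv_vertical (hF : IsFlatFrame D c P a b X) (hx : x ∈ cyl D) (w : Polar) :
    fderiv ℝ (vertical a) x w = (0, fderiv ℝ a x w) := by
  have h1 : fderiv ℝ (vertical a) x = _ := ((hasFDerivAt_const (0 : Plane) x).prodMk
    (hF.differentiableAt hF.smooth_a hx).hasFDerivAt).fderiv
  rw [h1]; simp

theorem fderiv_form_vertical (x : Polar) (P : Polar → Covec) (a : Polar → ℝ) :
    fderiv ℝ P x (vertical a x) = dform P a x := by
  rw [vertical, dform, ← map_smul]; simp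

theorem bracket_fst (hF : IsFlatFrame D c P a b X) (hx : x ∈ cyl D) :
    (bracket a X x).1 = (fderiv ℝ X x (vertical a x)).1 := by
  simp [bracket, lieBracket, hF.fderiv_vertical hx]

theorem bracket_snd (hF : IsFlatFrame D c P a b X) (hx : x ∈ cyl D) :
    (bracket a X x).2 = (fderiv ℝ X x (vertical a x)).2 - fderiv ℝ a x (X x) := by
  simp [bracket, lieBracket, hF.fderiv_vertical hx]

theorem dform_field' (hF : IsFlatFrame D c P a b X) (hx : x ∈ cyl D) :
    dform P a x (X x).1 = 0 := by
  simp [dform, hF.dform_field x hx]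

/-- The constant pairing of `P` with `X`, differentiated along the vertical field. The same argument
with `dform P a` gives `dform_bracket`; together they make the two forms dual to the two fields up
to the factor `c`. -/
theorem form_bracket (hF : IsFlatFrame D c P a b X) (hx : x ∈ cyl D) :
    P x (bracket a X x).1 = 0 := by
  have := hF.fderiv_pairing hF.smooth_form hF.smooth_field.fst hF.form_field hx (vertical a x)
  rw [fderiv_form_vertical, hF.dform_field' hx, hF.fderiv_fst_field hF.smooth_field hx] at this
  rw [hF.bracket_fst hx]
  linarith

theorem fderiv_dform (hF : IsFlatFrame D c P a b X) (hx : x ∈ cyl D) :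
    fderiv ℝ (dform P a) x (vertical a x) = -P x + b x • dform P a x := hF.structure_eq x hx

theorem dform_bracket (hF : IsFlatFrame D c P a b X) (hx : x ∈ cyl D) :
    dform P a x (bracket a X x).1 = c := by
  have := hF.fderiv_pairing hF.contDiffOn_dform hF.smooth_field.fst
    (fun x hx => hF.dform_field' hx) hx (vertical a x)
  rw [hF.fderiv_dform hx, hF.fderiv_fst_field hF.smooth_field hx, ← hF.bracket_fst hx] at this
  simp [hF.form_field x hx, hF.dform_field' hx] at this
  linarith

theorem a_ne_zero (hF : IsFlatFrame D c P a b X) (hx : x ∈ cyl D) : a x ≠ 0 := by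
  intro h0
  have h1 := hF.dform_bracket hx
  simp [dform, h0] at h1
  exact hF.pos.ne h1

/-- The dual frame. -/
theorem smul_eq_frame (hF : IsFlatFrame D c P a b X) (hx : x ∈ cyl D) (y : Plane) :
    c • y = P x y • (X x).1 + dform P a x y • (bracket a X x).1 := by
  have hc := hF.pos
  set z := c • y - (P x y • (X x).1 + dform P a x y • (bracket a X x).1) with hz
  have h1 : P x z = 0 := by
    simp [hz, hF.form_field x hx, hF.form_bracket hx]; ring
  have h2 : dform P a x z = 0 := by
    simp [hz, hF.dform_field' hx, hF.dform_bracket hx]; ring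
  by_contra hne
  have hz0 : z ≠ 0 := fun h => hne (sub_eq_zero.1 h)
  have hP0 : P x ≠ 0 := by
    intro h0; have := hF.form_field x hx; rw [h0] at this; exact hc.ne this
  have h3 := covec_eq_smul hz0 hP0 h2 h1
  have h4 := hF.dform_bracket hx
  rw [h3, smul_apply, hF.form_bracket hx, smul_zero] at h4
  exact hc.ne h4

theorem eq_frame (hF : IsFlatFrame D c P a b X) (hx : x ∈ cyl D) (y : Plane) :
    y = (c⁻¹ * P x y) • (X x).1 + (c⁻¹ * dform P a x y) • (bracket a X x).1 := by
  rw [mul_smul, mul_smul, ← smul_add, ← hF.smul_eq_frame hx, inv_smul_smul₀ hF.pos.ne']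

theorem slope_field (hF : IsFlatFrame D c P a b X) (hx : x ∈ cyl D) :
    slope c P a X x (X x).1 = (X x).2 := by
  have hc := hF.pos.ne'
  simp [slope, hF.form_field x hx, hF.dform_field' hx]
  field_simp

theorem slope_bracket (hF : IsFlatFrame D c P a b X) (hx : x ∈ cyl D) :
    slope c P a X x (bracket a X x).1 = (bracket a X x).2 := by
  have hc := hF.pos.ne'
  simp [slope, hF.form_bracket hx, hF.dform_bracket hx]
  field_simp

/-- The planar part of `[v, [v, X]] = -X - b [v, X]`: differentiate the pairings of both forms with
`[v, X]` along `v` and read off the components in the dual frame. -/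
theorem fderiv_bracket_fst (hF : IsFlatFrame D c P a b X) (hx : x ∈ cyl D) :
    (fderiv ℝ (bracket a X) x (vertical a x)).1 = -(X x).1 - b x • (bracket a X x).1 := by
  have h1 := hF.fderiv_pairing hF.smooth_form hF.contDiffOn_bracket.fst
    (fun x hx => hF.form_bracket hx) hx (vertical a x)
  have h2 := hF.fderiv_pairing hF.contDiffOn_dform hF.contDiffOn_bracket.fst
    (fun x hx => hF.dform_bracket hx) hx (vertical a x)
  rw [hF.fderiv_fst_field hF.contDiffOn_bracket hx] at h1 h2
  rw [fderiv_form_vertical, hF.dform_bracket hx] at h1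
  rw [hF.fderiv_dform hx] at h2
  simp only [add_apply, neg_apply, smul_apply, smul_eq_mul, hF.form_bracket hx,
    hF.dform_bracket hx] at h2
  have hc := hF.pos.ne'
  rw [hF.eq_frame hx (fderiv ℝ (bracket a X) x (vertical a x)).1]
  rw [show P x (fderiv ℝ (bracket a X) x (vertical a x)).1 = -c by linarith,
    show dform P a x (fderiv ℝ (bracket a X) x (vertical a x)).1 = -(b x * c) by linarith]
  rw [show c⁻¹ * -c = -1 by field_simp, show c⁻¹ * -(b x * c) = -b x by field_simp]
  module

theorem commute' (hF : IsFlatFrame D c P a b X) (hx : x ∈ cyl D) :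
    fderiv ℝ (bracket a X) x (X x) = fderiv ℝ X x (bracket a X x) :=
  sub_eq_zero.1 (hF.commute x hx)

/-- The angular part of the bracket of the vertical field and `bracket a X`. -/
theorem fderiv_bracket_snd (hF : IsFlatFrame D c P a b X) (hx : x ∈ cyl D) :
    (fderiv ℝ (bracket a X) x (vertical a x)).2 - fderiv ℝ a x (bracket a X x) =
      -(X x).2 - b x * (bracket a X x).2 := by
  -- The planar part of `[v, [v, X]] = -X - b [v, X]` is already known, so `γ` measures the only
  -- possible defect, in the angular direction.
  set γ : Polar → ℝ := fun y => (fderiv ℝ (bracket a X) y (vertical a y)).2 -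
    fderiv ℝ a y (bracket a X y) + (X y).2 + b y * (bracket a X y).2 with hγ
  have ho := isOpen_cyl hF.isOpen
  have hγs : ContDiffOn ℝ ∞ γ (cyl D) := by
    have h1 := (hF.contDiffOn_bracket.fderiv_of_isOpen ho (m := ∞) (by simp)).clm_apply
      hF.contDiffOn_vertical
    have h2 := (hF.smooth_a.fderiv_of_isOpen ho (m := ∞) (by simp)).clm_apply
      hF.contDiffOn_bracket
    exact ((h1.snd.sub h2).add hF.smooth_field.snd).add
      (hF.smooth_b.mul hF.contDiffOn_bracket.snd)
  have hX2 : lieBracket ℝ (vertical a) (bracket a X) =ᶠ[𝓝 x]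
      fun y => vertical γ y - (X y + b y • bracket a X y) := by
    filter_upwards [hF.mem_nhds hx] with y hy
    refine Prod.ext ?_ ?_
    · have := hF.fderiv_bracket_fst hy
      rw [lieBracket, Prod.fst_sub, this, hF.fderiv_vertical hy]
      simp [vertical]
      abel
    · simp [lieBracket, hF.fderiv_vertical hy, vertical, hγ]
  have hsmooth : ∀ {Y : Polar → Polar}, ContDiffOn ℝ ∞ Y (cyl D) →
      ContDiffAt ℝ (minSmoothness ℝ 2) Y x := fun hY =>
    (hY.contDiffAt (hF.mem_nhds hx)).of_le
      (by rw [minSmoothness_of_isRCLikeNormedField]; exact two_le_infty)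
  -- By the Jacobi identity and `[X, [v, X]] = 0`, the field `X` commutes with `[v, [v, X]]`. As `X
  -- b = 0`, it also commutes with `X + b [v, X]`, so only the defect term remains.
  have hjac := leibniz_identity_lieBracket (𝕜 := ℝ) le_rfl (hsmooth hF.smooth_field)
    (hsmooth hF.contDiffOn_vertical) (hsmooth hF.contDiffOn_bracket)
  have h0 : lieBracket ℝ X (vertical a) = -bracket a X := by
    funext y; exact lieBracket_swap
  have hz : lieBracket ℝ X (bracket a X) =ᶠ[𝓝 x] fun _ => 0 :=
    Filter.eventually_of_mem (hF.mem_nhds hx) hF.commute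
  have h1 : lieBracket ℝ X (lieBracket ℝ (vertical a) (bracket a X)) x = 0 := by
    rw [hjac, h0]
    have h5 : lieBracket ℝ (-bracket a X) (bracket a X) x = 0 := by
      rw [lieBracket, fderiv_neg]
      simp
    have h6 : lieBracket ℝ (vertical a) (lieBracket ℝ X (bracket a X)) x = 0 := by
      rw [lieBracket, hz.fderiv_eq, hz.self_of_nhds]
      simp
    rw [h5, h6, add_zero]
  have hdγ := hF.differentiableAt hγs hx
  have h2 : fderiv ℝ (lieBracket ℝ (vertical a) (bracket a X)) x (X x) =
      (0, fderiv ℝ γ x (X x)) - (fderiv ℝ X x (X x) + b x • fderiv ℝ (bracket a X) x (X x)) := by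
    have h3 : fderiv ℝ (fun y => vertical γ y - (X y + b y • bracket a X y)) x = _ :=
      (((hasFDerivAt_const (0 : Plane) x).prodMk hdγ.hasFDerivAt).sub
      ((hF.differentiableAt hF.smooth_field hx).hasFDerivAt.add
      ((hF.differentiableAt hF.smooth_b hx).hasFDerivAt.smul
        (hF.differentiableAt hF.contDiffOn_bracket hx).hasFDerivAt))).fderiv
    rw [hX2.fderiv_eq, h3]
    simp [hF.deriv_b x hx]
  -- The planar part of `[X, γ ∂_θ] = 0`. Up to sign it is `γ / a` times the projection of `[v, X]`,
  -- which is nonzero, so `γ` vanishes.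
  have h4 : (fderiv ℝ X x (vertical γ x)).1 = 0 := by
    have h5 := congrArg Prod.fst h1
    rw [lieBracket, h2, hX2.self_of_nhds, map_sub, map_add, map_smul, hF.commute' hx] at h5
    simpa using h5
  have ha := hF.a_ne_zero hx
  have h6 : vertical γ x = (γ x / a x) • vertical a x := by
    simp [vertical]; field_simp
  rw [h6, map_smul, Prod.smul_fst, ← hF.bracket_fst hx] at h4
  have h7 : (bracket a X x).1 ≠ 0 := by
    intro h8
    have := hF.dform_bracket hx
    rw [h8, map_zero] at this
    exact hF.pos.ne this
  have h9 : γ x = 0 := by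
    rcases smul_eq_zero.1 h4 with h10 | h10
    · exact (div_eq_zero_iff.1 h10).resolve_right ha
    · exact absurd h10 h7
  simp only [hγ] at h9
  linarith

end IsFlatFrame

/-! ### The completely integrable equation for the angle. -/

/-- The fibre coordinate runs over the whole line, but by periodicity one turn suffices, and that is
compact. Such bounds give global existence in the angle and in time. -/
theorem exists_bound_of_periodic {G : Type*} [NormedAddCommGroup G] {D : Set Plane}
    {f : Polar → G} (hf : ContinuousOn f (cyl D)) (hper : ∀ x, f (x + turn) = f x) {K : Set Plane}
    (hK : IsCompact K) (hKD : K ⊆ D) : ∃ C : ℝ≥0, ∀ x ∈ cyl K, ‖f x‖ ≤ C := by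
  obtain ⟨C, hC⟩ := (hK.prod
    (isCompact_Icc (a := (0 : ℝ)) (b := 2 * Real.pi))).exists_bound_of_continuousOn (hf.mono (prod_mono hKD (subset_univ _)))
  refine ⟨C.toNNReal, fun x hx => ?_⟩
  have hp : Function.Periodic (fun s : ℝ => f (x.1, s)) (2 * Real.pi) := fun s => by
    have := hper (x.1, s)
    simpa [turn] using this
  obtain ⟨y, hy, hxy⟩ := hp.exists_mem_Ico₀ Real.two_pi_pos x.2
  have h1 : f x = f (x.1, y) := hxy
  rw [h1]
  exact (hC (x.1, y) ⟨hx.1, Ico_subset_Icc_self hy⟩).trans (Real.le_coe_toNNReal C)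

/-- The form of the total differential of an angle whose graph is tangent to the frame. -/
def totalForm (c : ℝ) (P : Polar → Covec) (a : Polar → ℝ) (X : Polar → Polar) (x : Polar) :
    Polar →L[ℝ] ℝ :=
  (slope c P a X x).comp (ContinuousLinearMap.fst ℝ Plane ℝ) +
    a x • ContinuousLinearMap.snd ℝ Plane ℝ

namespace IsFlatFrame

variable {D : Set Plane} {c : ℝ} {P : Polar → Covec} {a b : Polar → ℝ} {X : Polar → Polar}
  {x : Polar}

theorem bracket_periodic (hF : IsFlatFrame D c P a b X) (x : Polar) :
    bracket a X (x + turn) = bracket a X x := by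
  have hv : ∀ x, vertical a (x + turn) = vertical a x := fun x => by
    simp [vertical, hF.periodic_a]
  simp only [bracket, lieBracket, fderiv_periodic hv, fderiv_periodic hF.periodic_field, hv,
    hF.periodic_field]

theorem dform_periodic (hF : IsFlatFrame D c P a b X) (x : Polar) :
    dform P a (x + turn) = dform P a x := by
  simp only [dform, fderiv_periodic hF.periodic_form, hF.periodic_a]

theorem totalForm_periodic (hF : IsFlatFrame D c P a b X) (x : Polar) :
    totalForm c P a X (x + turn) = totalForm c P a X x := by
  simp only [totalForm, slope, hF.bracket_periodic, hF.dform_periodic, hF.periodic_a,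
    hF.periodic_form, hF.periodic_field]

theorem contDiffOn_totalForm (hF : IsFlatFrame D c P a b X) :
    ContDiffOn ℝ ∞ (totalForm c P a X) (cyl D) :=
  (hF.contDiffOn_slope.clm_comp contDiffOn_const).add (hF.smooth_a.smul contDiffOn_const)

theorem fderiv_totalForm (hF : IsFlatFrame D c P a b X) (hx : x ∈ cyl D) (v w : Polar) :
    fderiv ℝ (totalForm c P a X) x v w =
      fderiv ℝ (slope c P a X) x v w.1 + fderiv ℝ a x v * w.2 := by
  have h1 : fderiv ℝ (totalForm c P a X) x = _ :=
    (((hF.differentiableAt hF.contDiffOn_slope hx).hasFDerivAt.clm_comp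
      (hasFDerivAt_const (ContinuousLinearMap.fst ℝ Plane ℝ) x)).add
    ((hF.differentiableAt hF.smooth_a hx).hasFDerivAt.smul
      (hasFDerivAt_const (ContinuousLinearMap.snd ℝ Plane ℝ) x))).fderiv
  rw [h1]
  simp

theorem fderiv_slope_field (hF : IsFlatFrame D c P a b X) (hx : x ∈ cyl D) (v : Polar) :
    fderiv ℝ (slope c P a X) x v (X x).1 =
      (fderiv ℝ X x v).2 - slope c P a X x (fderiv ℝ X x v).1 := by
  have h1 : ∀ y ∈ cyl D, (slope c P a X y) (X y).1 - (X y).2 = 0 := fun y hy => by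
    rw [hF.slope_field hy, sub_self]
  have h2 : fderiv ℝ (fun y => (slope c P a X y) (X y).1 - (X y).2) x v = 0 := by
    have h3 : (fun y => (slope c P a X y) (X y).1 - (X y).2) =ᶠ[𝓝 x] fun _ => 0 :=
      Filter.eventually_of_mem (hF.mem_nhds hx) h1
    rw [h3.fderiv_eq]; simp
  have hs := hF.differentiableAt hF.contDiffOn_slope hx
  have hX := hF.differentiableAt hF.smooth_field hx
  rw [fderiv_fun_sub (hs.clm_apply hX.fst) hX.snd, fderiv_clm_apply hs hX.fst, sub_apply,
    hF.fderiv_snd_field hF.smooth_field hx] at h2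
  simp [hF.fderiv_fst_field hF.smooth_field hx] at h2
  linarith

theorem fderiv_slope_bracket (hF : IsFlatFrame D c P a b X) (hx : x ∈ cyl D) (v : Polar) :
    fderiv ℝ (slope c P a X) x v (bracket a X x).1 =
      (fderiv ℝ (bracket a X) x v).2 - slope c P a X x (fderiv ℝ (bracket a X) x v).1 := by
  have h1 : ∀ y ∈ cyl D, (slope c P a X y) (bracket a X y).1 - (bracket a X y).2 = 0 :=
    fun y hy => by rw [hF.slope_bracket hy, sub_self]
  have h2 : fderiv ℝ (fun y => (slope c P a X y) (bracket a X y).1 - (bracket a X y).2) x v = 0 := by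
    have h3 : (fun y => (slope c P a X y) (bracket a X y).1 - (bracket a X y).2) =ᶠ[𝓝 x]
        fun _ => 0 := Filter.eventually_of_mem (hF.mem_nhds hx) h1
    rw [h3.fderiv_eq]; simp
  have hs := hF.differentiableAt hF.contDiffOn_slope hx
  have hX := hF.differentiableAt hF.contDiffOn_bracket hx
  rw [fderiv_fun_sub (hs.clm_apply hX.fst) hX.snd, fderiv_clm_apply hs hX.fst, sub_apply,
    hF.fderiv_snd_field hF.contDiffOn_bracket hx] at h2
  simp [hF.fderiv_fst_field hF.contDiffOn_bracket hx] at h2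
  linarith

/-- Complete integrability of the equation for the angle. -/
theorem integrable (hF : IsFlatFrame D c P a b X) (hx : x ∈ cyl D) (u w : Polar) :
    fderiv ℝ (totalForm c P a X) x (u.1, totalForm c P a X x u) w =
      fderiv ℝ (totalForm c P a X) x (w.1, totalForm c P a X x w) u := by
  set T := totalForm c P a X x with hT
  set Λ : Polar →L[ℝ] Polar := (ContinuousLinearMap.fst ℝ Plane ℝ).prod T with hΛ
  -- `Λ` lifts a vector in the variables `(q, t)` to one in `(q, θ)` and sends the frame to `X`,
  -- `[v, X]` and `v`. Integrability is symmetry of `B`, checked on the three pairs of the frame;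
  -- they correspond to `[X, [v, X]] = 0`, to the definition of `[v, X]` and to the formula for `[v,
  -- [v, X]]`.
  set B := (fderiv ℝ (totalForm c P a X) x).comp Λ with hB
  have h0 : Λ ((X x).1, 0) = X x := by
    refine Prod.ext rfl ?_
    simp [hΛ, hT, totalForm, hF.slope_field hx]
  have h1 : Λ ((bracket a X x).1, 0) = bracket a X x := by
    refine Prod.ext rfl ?_
    simp [hΛ, hT, totalForm, hF.slope_bracket hx]
  have hv : Λ (0, 1) = vertical a x := by
    refine Prod.ext rfl ?_
    simp [hΛ, hT, totalForm, vertical]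
  have hB0 : B ((X x).1, 0) = fderiv ℝ (totalForm c P a X) x (X x) := by rw [hB, ← h0]; simp [h0]
  have hB1 : B ((bracket a X x).1, 0) = fderiv ℝ (totalForm c P a X) x (bracket a X x) := by
    rw [hB, ContinuousLinearMap.comp_apply, h1]
  have hBv : B (0, 1) = fderiv ℝ (totalForm c P a X) x (vertical a x) := by
    rw [hB, ContinuousLinearMap.comp_apply, hv]
  have s01 : B ((X x).1, 0) ((bracket a X x).1, 0) = B ((bracket a X x).1, 0) ((X x).1, 0) := by
    rw [hB0, hB1, hF.fderiv_totalForm hx, hF.fderiv_totalForm hx, hF.fderiv_slope_field hx,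
      hF.fderiv_slope_bracket hx, hF.commute' hx]
    simp
  have s0v : B ((X x).1, 0) (0, 1) = B (0, 1) ((X x).1, 0) := by
    rw [hB0, hBv, hF.fderiv_totalForm hx, hF.fderiv_totalForm hx, hF.fderiv_slope_field hx,
      ← hF.bracket_fst hx, hF.slope_bracket hx, hF.bracket_snd hx]
    simp
  have s1v : B ((bracket a X x).1, 0) (0, 1) = B (0, 1) ((bracket a X x).1, 0) := by
    rw [hB1, hBv, hF.fderiv_totalForm hx, hF.fderiv_totalForm hx, hF.fderiv_slope_bracket hx,
      hF.fderiv_bracket_fst hx, map_sub, map_neg, map_smul, hF.slope_field hx, hF.slope_bracket hx]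
    have := hF.fderiv_bracket_snd hx
    simp
    linarith
  have hdec : ∀ u : Polar, ∃ α β σ : ℝ,
      u = α • ((X x).1, (0 : ℝ)) + β • ((bracket a X x).1, (0 : ℝ)) + σ • (0, 1) := fun u =>
    ⟨_, _, u.2, Prod.ext (by simpa using hF.eq_frame hx u.1) (by simp)⟩
  change B u w = B w u
  obtain ⟨α, β, σ, rfl⟩ := hdec u
  obtain ⟨α', β', σ', rfl⟩ := hdec w
  simp only [map_add, map_smul, add_apply, smul_apply, smul_eq_mul]
  linear_combination (α * β' - α' * β) * s01 + (α * σ' - α' * σ) * s0v + (β * σ' - β' * σ) * s1v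

set_option maxSynthPendingDepth 3 in
/-- The angle as a function of the point and of the time along the vertical field. -/
theorem exists_angle (hF : IsFlatFrame D c P a b X) {q₀ : Plane} {r : ℝ} (hr : 0 < r)
    (hD : Metric.closedBall q₀ r ⊆ D) :
    ∃ ϑ : Polar → ℝ, ϑ (q₀, 0) = 0 ∧ ContDiffOn ℝ ∞ ϑ (cyl (Metric.ball q₀ r)) ∧
      ∀ y ∈ cyl (Metric.ball q₀ r), HasFDerivAt ϑ (totalForm c P a X (y.1, ϑ y)) y := by
  set K := Metric.closedBall q₀ r
  have hK : IsCompact K := isCompact_closedBall q₀ r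
  set S := cyl (Metric.ball q₀ r) with hS
  have hSo : IsOpen S := isOpen_cyl Metric.isOpen_ball
  have hSc : Convex ℝ S := (convex_ball q₀ r).prod convex_univ
  set T := totalForm c P a X with hT
  have hTs := hF.contDiffOn_totalForm
  have ho := isOpen_cyl hF.isOpen
  have hT1 : ContDiffOn ℝ ∞ (fderiv ℝ T) (cyl D) := hTs.fderiv_of_isOpen ho (by simp)
  have hT2 : ContDiffOn ℝ ∞ (fderiv ℝ (fderiv ℝ T)) (cyl D) := hT1.fderiv_of_isOpen ho (by simp)
  obtain ⟨C0, hC0⟩ := exists_bound_of_periodic hTs.continuousOn hF.totalForm_periodic hK hD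
  obtain ⟨C1, hC1⟩ := exists_bound_of_periodic hT1.continuousOn
    (fderiv_periodic hF.totalForm_periodic) hK hD
  obtain ⟨C2, hC2⟩ := exists_bound_of_periodic hT2.continuousOn
    (fderiv_periodic (fderiv_periodic hF.totalForm_periodic)) hK hD
  -- The independent variables are `(q, t)` and the unknown is the angle. The equation is autonomous
  -- in `t`, so `pr` forgets `t` and substitutes the unknown for it.
  set pr : Polar × ℝ →L[ℝ] Polar := ((ContinuousLinearMap.fst ℝ Plane ℝ).comp
    (ContinuousLinearMap.fst ℝ Polar ℝ)).prod (ContinuousLinearMap.snd ℝ Polar ℝ) with hpr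
  have hprz : ∀ z : Polar × ℝ, ‖pr z‖ ≤ ‖z‖ := fun z => by
    rw [Prod.norm_def, Prod.norm_def]
    exact max_le_max (norm_fst_le z.1) le_rfl
  have hprn : ‖pr‖ ≤ 1 := ContinuousLinearMap.opNorm_le_bound _ zero_le_one fun z => by
    rw [one_mul]; exact hprz z
  have hmemB : ∀ z ∈ S ×ˢ (univ : Set ℝ), pr z ∈ S := fun z hz => ⟨hz.1.1, mem_univ _⟩
  have hmemK : ∀ y ∈ S, y ∈ cyl K := fun y hy => ⟨Metric.ball_subset_closedBall hy.1, mem_univ _⟩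
  have hmemD : ∀ y ∈ S, y ∈ cyl D := fun y hy => ⟨hD (hmemK y hy).1, mem_univ _⟩
  have hder : ∀ z ∈ S ×ˢ (univ : Set ℝ), HasFDerivAt (fun z => T (pr z))
      ((fderiv ℝ T (pr z)).comp pr) z := fun z hz =>
    HasFDerivAt.comp (g := T) (f := pr) z
      (hF.differentiableAt hTs (hmemD _ (hmemB z hz))).hasFDerivAt pr.hasFDerivAt
  have hle : ∀ L : Polar →L[ℝ] Polar →L[ℝ] ℝ, ‖L.comp pr‖ ≤ ‖L‖ := fun L =>
    (ContinuousLinearMap.opNorm_comp_le _ _).trans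
      (mul_le_of_le_one_right (norm_nonneg _) hprn)
  obtain ⟨ϑ, h0, hϑ⟩ := exists_hasFDerivAt_of_integrable (A := fun z => T (pr z))
    (C := max C0 (max C1 C2)) hSc hSo (fun z hz => (hder z hz).differentiableAt)
    (fun z hz => (hC0 _ (hmemK _ (hmemB z hz))).trans (by exact_mod_cast le_max_left _ _))
    (fun z hz => by
      rw [(hder z hz).fderiv]
      exact (hle _).trans ((hC1 _ (hmemK _ (hmemB z hz))).trans (by
        exact_mod_cast (le_max_left C1 C2).trans (le_max_right _ _))))
    (fun z hz z' hz' => by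
      rw [(hder z hz).fderiv, (hder z' hz').fderiv, ← ContinuousLinearMap.sub_comp]
      have h1 := hSc.norm_image_sub_le_of_norm_fderiv_le (𝕜 := ℝ) (f := fderiv ℝ T) (C := C2)
        (fun y hy => hF.differentiableAt hT1 (hmemD y hy)) (fun y hy => hC2 y (hmemK y hy))
        (hmemB z hz) (hmemB z' hz')
      have h2 : ‖pr z' - pr z‖ ≤ ‖z' - z‖ := by rw [← map_sub]; exact hprz _
      have h3 : (C2 : ℝ) ≤ ((max C0 (max C1 C2) : ℝ≥0) : ℝ) := by
        exact_mod_cast (le_max_right C1 C2).trans (le_max_right _ _)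
      exact (hle _).trans (h1.trans (mul_le_mul h3 h2 (norm_nonneg _) (NNReal.coe_nonneg _))))
    (fun z hz u w => by
      rw [(hder z hz).fderiv]
      exact hF.integrable (hmemD _ (hmemB z hz)) u w)
    (x₀ := (q₀, 0)) ⟨Metric.mem_ball_self hr, mem_univ _⟩ 0
  refine ⟨ϑ, h0, ?_, hϑ⟩
  refine contDiffOn_of_hasFDerivAt hSo (A := fun z => T (pr z)) ?_ hϑ
  exact hTs.comp pr.contDiff.contDiffOn fun z hz => hmemD _ (hmemB z hz)

end IsFlatFrame

/-- Solutions of `y' = z`, `z' = -y + β z` are determined by their initial values. -/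
theorem second_order_unique {V : Type*} [NormedAddCommGroup V] [NormedSpace ℝ V] {β : ℝ → ℝ}
    {C : ℝ≥0} (hβ : ∀ t, ‖β t‖ ≤ C) {y z y' z' : ℝ → V} (hy : ∀ t, HasDerivAt y (z t) t)
    (hz : ∀ t, HasDerivAt z (-y t + β t • z t) t) (hy' : ∀ t, HasDerivAt y' (z' t) t)
    (hz' : ∀ t, HasDerivAt z' (-y' t + β t • z' t) t) (h0 : y 0 = y' 0) (h1 : z 0 = z' 0) :
    y = y' := by
  -- The equation as a first-order system for `(y, z)`; a bound `C` on `β` makes it `1 +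
  -- C`-Lipschitz.
  have key := ODE_solution_unique_univ (v := fun t (w : V × V) => (w.2, -w.1 + β t • w.2))
    (s := fun _ => univ) (K := 1 + C) (f := fun t => (y t, z t)) (g := fun t => (y' t, z' t))
    (t₀ := 0) (fun t => ?_) (fun t => ⟨(hy t).prodMk (hz t), mem_univ _⟩)
    (fun t => ⟨(hy' t).prodMk (hz' t), mem_univ _⟩) (Prod.ext h0 h1)
  · funext t; exact congrArg Prod.fst (congrFun key t)
  · refine LipschitzOnWith.of_dist_le_mul fun w _ w' _ => ?_
    rw [dist_eq_norm, dist_eq_norm, Prod.norm_def]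
    have e1 : ‖(w - w').1‖ ≤ ‖w - w'‖ := norm_fst_le _
    have e2 : ‖(w - w').2‖ ≤ ‖w - w'‖ := norm_snd_le _
    have hC := mul_le_mul (hβ t) e2 (norm_nonneg _) C.2
    have hC0 : (0 : ℝ) ≤ C * ‖w - w'‖ := mul_nonneg C.2 (norm_nonneg _)
    push_cast
    refine max_le ?_ ?_
    · change ‖w.2 - w'.2‖ ≤ _
      rw [add_mul, one_mul]
      exact e2.trans (by linarith)
    · change ‖(-w.1 + β t • w.2) - (-w'.1 + β t • w'.2)‖ ≤ _
      rw [show (-w.1 + β t • w.2) - (-w'.1 + β t • w'.2) =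
        -(w - w').1 + β t • (w - w').2 by simp only [Prod.fst_sub, Prod.snd_sub]; module]
      refine (norm_add_le _ _).trans ?_
      rw [norm_neg, norm_smul]
      linarith

/-- Never zero and continuous, `a` has constant sign, so `ϑ` or `-ϑ` grows at least linearly with
rate `m`. -/
theorem surjective_of_deriv_bound {ϑ a : ℝ → ℝ} {m : ℝ} (hm : 0 < m) (ha : Continuous a)
    (ham : ∀ s, m ≤ |a s|) (hϑ : ∀ t, HasDerivAt ϑ (a (ϑ t)) t) : Function.Surjective ϑ := by
  have hd : Differentiable ℝ ϑ := fun t => (hϑ t).differentiableAt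
  have hsurj : ∀ {ϑ : ℝ → ℝ}, Differentiable ℝ ϑ → (∀ t, m ≤ deriv ϑ t) →
      Function.Surjective ϑ := by
    intro ϑ hd hb
    have hgrow := mul_sub_le_image_sub_of_le_deriv hd hb
    refine hd.continuous.surjective ?_ ?_
    · refine tendsto_atTop_mono' atTop (f₁ := fun t => ϑ 0 + m * t) ?_
        (tendsto_atTop_add_const_left _ _ (tendsto_id.const_mul_atTop hm))
      filter_upwards [eventually_ge_atTop 0] with t ht
      have := hgrow ht
      linarith
    · refine tendsto_atBot_mono' atBot (f₂ := ϑ) (f₁ := fun t => ϑ 0 + m * t) ?_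
        (tendsto_atBot_add_const_left _ _ (tendsto_id.const_mul_atBot hm))
      filter_upwards [eventually_le_atBot 0] with t ht
      have := hgrow ht
      linarith
  have hne : ∀ s, a s ≠ 0 := fun s h0 => by have := ham s; rw [h0, abs_zero] at this; linarith
  have hsign : (∀ s, 0 < a s) ∨ ∀ s, a s < 0 := by
    by_contra! hcon
    obtain ⟨⟨s, hs⟩, ⟨s', hs'⟩⟩ := hcon
    obtain ⟨t, ht⟩ := mem_range_of_exists_le_of_exists_ge ha ⟨s, hs⟩ ⟨s', hs'⟩
    exact hne t ht
  rcases hsign with hpos | hneg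
  · refine hsurj hd fun t => ?_
    rw [(hϑ t).deriv, ← abs_of_pos (hpos _)]
    exact ham _
  · have h1 := hsurj hd.neg fun t => by
      rw [deriv.neg, (hϑ t).deriv, ← abs_of_neg (hneg _)]
      exact ham _
    intro s
    obtain ⟨t, ht⟩ := h1 (-s)
    exact ⟨t, neg_injective ht⟩

/-! ### Flat coordinates on the base. -/

namespace IsFlatFrame

variable {D : Set Plane} {c : ℝ} {P : Polar → Covec} {a b : Polar → ℝ} {X : Polar → Polar}
  {x : Polar}

theorem totalForm_field (hF : IsFlatFrame D c P a b X) (hx : x ∈ cyl D) :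
    totalForm c P a X x ((X x).1, 0) = (X x).2 := by
  simp [totalForm, hF.slope_field hx]

theorem totalForm_bracket (hF : IsFlatFrame D c P a b X) (hx : x ∈ cyl D) :
    totalForm c P a X x ((bracket a X x).1, 0) = (bracket a X x).2 := by
  simp [totalForm, hF.slope_bracket hx]

theorem totalForm_vertical (x : Polar) : totalForm c P a X x (0, 1) = a x := by
  simp [totalForm]

/-- The invariant `b` does not vary along the horizontal lift. -/
theorem fderiv_b_lift (hF : IsFlatFrame D c P a b X) (hx : x ∈ cyl D) (y : Plane) :
    fderiv ℝ b x (y, totalForm c P a X x (y, 0)) = 0 := by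
  set T := totalForm c P a X x
  have h : ∀ (α β : ℝ) (u v : Plane), ((α • u + β • v, T (α • u + β • v, 0)) : Polar) =
      α • (u, T (u, 0)) + β • (v, T (v, 0)) := fun α β u v => by
    rw [show ((α • u + β • v, 0) : Polar) = α • (u, 0) + β • (v, 0) by simp, map_add, map_smul,
      map_smul]
    simp
  rw [hF.eq_frame hx y, h, hF.totalForm_field hx, hF.totalForm_bracket hx]
  have h1 : fderiv ℝ b x (X x) = 0 := hF.deriv_b x hx
  have h2 : fderiv ℝ b x (bracket a X x) = 0 := hF.deriv_b' x hx
  simp only [map_add, map_smul, Prod.mk.eta, h1, h2, smul_zero, add_zero]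

/-- A form constant on the frame is closed along the horizontal lift. -/
theorem fderiv_form_lift (hF : IsFlatFrame D c P a b X) {R : Polar → Covec} {k k' : ℝ}
    (hR : ContDiffOn ℝ ∞ R (cyl D)) (hk : ∀ x ∈ cyl D, R x (X x).1 = k)
    (hk' : ∀ x ∈ cyl D, R x (bracket a X x).1 = k') (hx : x ∈ cyl D) (y y' : Plane) :
    fderiv ℝ R x (y, totalForm c P a X x (y, 0)) y' =
      fderiv ℝ R x (y', totalForm c P a X x (y', 0)) y := by
  set T := totalForm c P a X x
  set B : Plane →L[ℝ] Plane →L[ℝ] ℝ := (fderiv ℝ R x).comp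
    ((ContinuousLinearMap.id ℝ Plane).prod (T.comp (ContinuousLinearMap.inl ℝ Plane ℝ))) with hB
  change B y y' = B y' y
  have hB0 : B (X x).1 = fderiv ℝ R x (X x) := by
    simp [hB, T, hF.totalForm_field hx]
  have hB1 : B (bracket a X x).1 = fderiv ℝ R x (bracket a X x) := by
    simp [hB, T, hF.totalForm_bracket hx]
  have s : B (X x).1 (bracket a X x).1 = B (bracket a X x).1 (X x).1 := by
    have h1 := hF.fderiv_pairing hR hF.contDiffOn_bracket.fst hk' hx (X x)
    have h2 := hF.fderiv_pairing hR hF.smooth_field.fst hk hx (bracket a X x)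
    rw [hF.fderiv_fst_field hF.contDiffOn_bracket hx, hF.commute' hx] at h1
    rw [hF.fderiv_fst_field hF.smooth_field hx] at h2
    rw [hB0, hB1]
    linarith
  obtain ⟨α, β, hy⟩ : ∃ α β : ℝ, y = α • (X x).1 + β • (bracket a X x).1 := ⟨_, _, hF.eq_frame hx y⟩
  obtain ⟨α', β', hy'⟩ : ∃ α β : ℝ, y' = α • (X x).1 + β • (bracket a X x).1 :=
    ⟨_, _, hF.eq_frame hx y'⟩
  rw [hy, hy']
  simp only [map_add, map_smul, add_apply, smul_apply, smul_eq_mul]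
  linear_combination (α * β' - α' * β) * s

/-- The base space can be flattened near every point. -/
theorem exists_flattening (hF : IsFlatFrame D c P a b X) {q₀ : Plane} (hq₀ : q₀ ∈ D) :
    ∃ (O : Set Plane) (φ : Plane → Plane), O ⊆ D ∧ IsOpen O ∧ q₀ ∈ O ∧ ContDiffOn ℝ ∞ φ O ∧
      fderiv ℝ φ q₀ = ContinuousLinearMap.id ℝ Plane ∧ (∀ q ∈ O, 0 < planeDet (fderiv ℝ φ q)) ∧
      ∀ q ∈ O, ∀ s, ∃ s', P (q, s') = (P (q₀, s)).comp (fderiv ℝ φ q) := by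
  obtain ⟨r, hr, hrD⟩ := Metric.nhds_basis_closedBall.mem_iff.1 (hF.isOpen.mem_nhds hq₀)
  obtain ⟨ϑ, hϑ0, hϑs, hϑ⟩ := hF.exists_angle hr hrD
  set W := Metric.ball q₀ r with hW
  have hWo : IsOpen W := Metric.isOpen_ball
  have hq₀W : q₀ ∈ W := Metric.mem_ball_self hr
  have hWD : W ⊆ D := Metric.ball_subset_closedBall.trans hrD
  have hm : ∀ q ∈ W, ∀ s : ℝ, ((q, s) : Polar) ∈ cyl D := fun q hq s => ⟨hWD hq, mem_univ _⟩
  have hmW : ∀ q ∈ W, ∀ s : ℝ, ((q, s) : Polar) ∈ cyl W := fun q hq s => ⟨hq, mem_univ _⟩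
  have hc := hF.pos
  -- derivatives along the horizontal and vertical directions
  have hvert : ∀ q ∈ W, ∀ t, HasDerivAt (fun t => ϑ (q, t)) (a (q, ϑ (q, t))) t := by
    intro q hq t
    have h1 : HasDerivAt (fun t : ℝ => ((q, t) : Polar)) (0, 1) t :=
      (hasDerivAt_const t q).prodMk (hasDerivAt_id t)
    have h2 := HasFDerivAt.comp_hasDerivAt (f := fun t : ℝ => ((q, t) : Polar)) t
      (hϑ (q, t) (hmW q hq t)) h1
    rwa [totalForm_vertical] at h2
  have hvertLift : ∀ q ∈ W, ∀ t,
      HasDerivAt (fun t => ((q, ϑ (q, t)) : Polar)) (vertical a (q, ϑ (q, t))) t :=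
    fun q hq t => (hasDerivAt_const t q).prodMk (hvert q hq t)
  have hhor : ∀ q ∈ W, ∀ t, HasFDerivAt (fun q => ((q, ϑ (q, t)) : Polar))
      ((ContinuousLinearMap.id ℝ Plane).prod ((totalForm c P a X (q, ϑ (q, t))).comp
        (ContinuousLinearMap.inl ℝ Plane ℝ))) q := by
    intro q hq t
    have h1 : HasFDerivAt (fun q : Plane => ((q, t) : Polar))
        (ContinuousLinearMap.inl ℝ Plane ℝ) q := hasFDerivAt_prodMk_left q t
    exact (hasFDerivAt_id q).prodMk
      (HasFDerivAt.comp (f := fun q : Plane => ((q, t) : Polar)) q (hϑ (q, t) (hmW q hq t)) h1)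
  -- the invariant depends on the time only
  have hβ : ∀ q ∈ W, ∀ t, b (q, ϑ (q, t)) = b (q₀, ϑ (q₀, t)) := by
    intro q hq t
    have hd : ∀ q ∈ W, HasFDerivAt (fun q => b (q, ϑ (q, t))) (0 : Plane →L[ℝ] ℝ) q := by
      intro q hq
      have h1 := HasFDerivAt.comp (f := fun q => ((q, ϑ (q, t)) : Polar)) q
        (hF.differentiableAt hF.smooth_b (hm q hq _)).hasFDerivAt (hhor q hq t)
      refine h1.congr_fderiv (ContinuousLinearMap.ext fun y => ?_)
      simpa using hF.fderiv_b_lift (hm q hq (ϑ (q, t))) y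
    exact hWo.is_const_of_fderiv_eq_zero (𝕜 := ℝ) (convex_ball q₀ r).isPreconnected
      (fun q hq => (hd q hq).differentiableAt.differentiableWithinAt)
      (fun q hq => (hd q hq).fderiv) hq hq₀W
  set Q := dform P a with hQ
  have hQs := hF.contDiffOn_dform
  -- the form `ϖ`
  set F₀ := (X (q₀, 0)).1 with hF₀
  set F₁ := (bracket a X (q₀, 0)).1 with hF₁
  set lift : Plane → Polar := fun q => (q, ϑ (q, 0)) with hlift
  have hlifts : ContDiffOn ℝ ∞ lift W := contDiffOn_id.prodMk
    (hϑs.comp (contDiffOn_id.prodMk contDiffOn_const) fun q hq => hmW q hq 0)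
  -- The linear map that matches the coframe at `lift q` with the coframe at `(q₀, 0)`. It is the
  -- candidate for the differential of the flat coordinates.
  set ϖ : Plane → Plane →L[ℝ] Plane := fun q =>
    c⁻¹ • ((P (lift q)).smulRight F₀ + (Q (lift q)).smulRight F₁) with hϖ
  have hPl : ContDiffOn ℝ ∞ (fun q => P (lift q)) W :=
    hF.smooth_form.comp hlifts fun q hq => hm q hq _
  have hQl : ContDiffOn ℝ ∞ (fun q => Q (lift q)) W := hQs.comp hlifts fun q hq => hm q hq _
  have hϖs : ContDiffOn ℝ ∞ ϖ W :=
    ((hPl.smulRight contDiffOn_const).add (hQl.smulRight contDiffOn_const)).const_smul _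
  -- On the slice `t = 0` the section is tangent to the commuting fields `X` and `[v, X]`; a form
  -- with constant pairings on both is closed there.
  have hclosed : ∀ {R : Polar → Covec} {k k' : ℝ}, ContDiffOn ℝ ∞ R (cyl D) →
      (∀ x ∈ cyl D, R x (X x).1 = k) → (∀ x ∈ cyl D, R x (bracket a X x).1 = k') →
      ∀ q ∈ W, ∀ y y', fderiv ℝ (fun q => R (lift q)) q y y' =
        fderiv ℝ (fun q => R (lift q)) q y' y := by
    intro R k k' hR hk hk' q hq y y'
    have h1 : fderiv ℝ (fun q => R (lift q)) q = _ := (HasFDerivAt.comp (g := R) (f := lift) q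
      (hF.differentiableAt hR (hm q hq _)).hasFDerivAt (hhor q hq 0)).fderiv
    rw [h1]
    exact hF.fderiv_form_lift hR hk hk' (hm q hq _) y y'
  have hϖsymm : ∀ q ∈ W, ∀ y y', fderiv ℝ ϖ q y y' = fderiv ℝ ϖ q y' y := by
    intro q hq y y'
    have hdP := (hPl.contDiffAt (hWo.mem_nhds hq)).differentiableAt (by simp)
    have hdQ := (hQl.contDiffAt (hWo.mem_nhds hq)).differentiableAt (by simp)
    have h1 : ∀ y y', fderiv ℝ ϖ q y y' = c⁻¹ • (fderiv ℝ (fun q => P (lift q)) q y y' • F₀ +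
        fderiv ℝ (fun q => Q (lift q)) q y y' • F₁) := by
      intro y y'
      have hev : ∀ z, ϖ z y' = c⁻¹ • (P (lift z) y' • F₀ + Q (lift z) y' • F₁) := fun z => rfl
      have hϖd := ((hϖs.contDiffAt (hWo.mem_nhds hq)).differentiableAt (by simp)).hasFDerivAt
      have h2 := (hϖd.clm_apply (hasFDerivAt_const y' q))
      have h3 := (((hdP.hasFDerivAt.clm_apply (hasFDerivAt_const y' q)).smul_const F₀).add
        ((hdQ.hasFDerivAt.clm_apply (hasFDerivAt_const y' q)).smul_const F₁)).const_smul c⁻¹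
      have h4 := congrArg (fun L : Plane →L[ℝ] Plane => L y) (h2.unique h3)
      simpa using h4
    rw [h1, h1, hclosed hF.smooth_form hF.form_field (fun x hx => hF.form_bracket hx) q hq,
      hclosed hQs (fun x hx => hF.dform_field' hx) (fun x hx => hF.dform_bracket hx) q hq]
  -- Poincaré's lemma on the ball for the closed vector-valued form `ϖ`.
  obtain ⟨φ, hφ⟩ := (convex_ball q₀ r).exists_forall_hasFDerivAt_of_fderiv_symmetric (𝕜 := ℝ) hWo
    (fun q hq => ((hϖs.contDiffAt (hWo.mem_nhds hq)).differentiableAt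
      (by simp)).differentiableWithinAt) hϖsymm
  have hlift0 : lift q₀ = (q₀, 0) := by simp [hlift, hϑ0]
  have hϖ0 : ϖ q₀ = ContinuousLinearMap.id ℝ Plane := by
    refine ContinuousLinearMap.ext fun y => ?_
    have h1 : ϖ q₀ y = c⁻¹ • (P (q₀, 0) y • F₀ + Q (q₀, 0) y • F₁) := by
      simp only [hϖ, hlift0]; rfl
    rw [h1, hF₀, hF₁, hQ, ← hF.smul_eq_frame (hm q₀ hq₀W 0), inv_smul_smul₀ hc.ne']
    rfl
  -- the solution of the linear equation
  have hode : ∀ q ∈ W, ∀ t, HasDerivAt (fun t => P (q, ϑ (q, t))) (Q (q, ϑ (q, t))) t ∧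
      HasDerivAt (fun t => Q (q, ϑ (q, t)))
        (-P (q, ϑ (q, t)) + b (q₀, ϑ (q₀, t)) • Q (q, ϑ (q, t))) t := by
    intro q hq t
    have hx := hm q hq (ϑ (q, t))
    constructor
    · have h1 := HasFDerivAt.comp_hasDerivAt (f := fun t => ((q, ϑ (q, t)) : Polar)) t
        (hF.differentiableAt hF.smooth_form hx).hasFDerivAt (hvertLift q hq t)
      rwa [fderiv_form_vertical] at h1
    · have h1 := HasFDerivAt.comp_hasDerivAt (f := fun t => ((q, ϑ (q, t)) : Polar)) t
        (hF.differentiableAt hQs hx).hasFDerivAt (hvertLift q hq t)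
      rwa [hF.fderiv_dform hx, hβ q hq t] at h1
  have hsing : ({q₀} : Set Plane) ⊆ D := by simpa using hq₀
  obtain ⟨C, hC⟩ := exists_bound_of_periodic hF.smooth_b.continuousOn hF.periodic_b
    isCompact_singleton hsing
  have hϖP : ∀ q ∈ W, (P (q₀, 0)).comp (ϖ q) = P (lift q) := by
    intro q _
    refine ContinuousLinearMap.ext fun y => ?_
    have h1 : ϖ q y = c⁻¹ • (P (lift q) y • F₀ + Q (lift q) y • F₁) := rfl
    have h2 : P (q₀, 0) F₀ = c := hF.form_field _ (hm q₀ hq₀W 0)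
    have h3 : P (q₀, 0) F₁ = 0 := hF.form_bracket (hm q₀ hq₀W 0)
    rw [ContinuousLinearMap.comp_apply, h1]
    simp [h2, h3]
    field_simp
  have hϖQ : ∀ q ∈ W, (Q (q₀, 0)).comp (ϖ q) = Q (lift q) := by
    intro q _
    refine ContinuousLinearMap.ext fun y => ?_
    have h1 : ϖ q y = c⁻¹ • (P (lift q) y • F₀ + Q (lift q) y • F₁) := rfl
    have h2 : Q (q₀, 0) F₀ = 0 := hF.dform_field' (hm q₀ hq₀W 0)
    have h3 : Q (q₀, 0) F₁ = c := hF.dform_bracket (hm q₀ hq₀W 0)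
    rw [ContinuousLinearMap.comp_apply, h1]
    simp [h2, h3]
    field_simp
  -- Over `q` and over `q₀` the forms solve the same linear equation in `t`, and `ϖ q` matches both
  -- initial values. Uniqueness propagates the match from `t = 0` to all times.
  have htransport : ∀ q ∈ W, ∀ t, P (q, ϑ (q, t)) = (P (q₀, ϑ (q₀, t))).comp (ϖ q) := by
    intro q hq t
    set L : Covec →L[ℝ] Covec := (ContinuousLinearMap.compL ℝ Plane Plane ℝ).flip (ϖ q) with hL
    have hLa : ∀ ξ : Covec, L ξ = ξ.comp (ϖ q) := fun ξ => rfl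
    refine congrFun (second_order_unique (β := fun t => b (q₀, ϑ (q₀, t))) (C := C)
      (fun t => hC _ ⟨rfl, mem_univ _⟩) (z := fun t => Q (q, ϑ (q, t)))
      (z' := fun t => L (Q (q₀, ϑ (q₀, t)))) (y' := fun t => L (P (q₀, ϑ (q₀, t))))
      (fun t => (hode q hq t).1) (fun t => (hode q hq t).2)
      (fun t => L.hasFDerivAt.comp_hasDerivAt t (hode q₀ hq₀W t).1) (fun t => ?_) ?_ ?_) t
    · have h1 := L.hasFDerivAt.comp_hasDerivAt t (hode q₀ hq₀W t).2
      rw [map_add, map_neg, map_smul] at h1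
      exact h1
    · simp only [hLa, hϑ0]; exact (hϖP q hq).symm
    · simp only [hLa, hϑ0]; exact (hϖQ q hq).symm
  -- the angle takes all values over the base point
  have hsurj : Function.Surjective fun t => ϑ (q₀, t) := by
    have hinv : ContinuousOn (fun x => (a x)⁻¹) (cyl D) :=
      hF.smooth_a.continuousOn.inv₀ fun x hx => hF.a_ne_zero hx
    obtain ⟨C', hC'⟩ := exists_bound_of_periodic hinv (fun x => by rw [hF.periodic_a])
      isCompact_singleton hsing
    have hac : Continuous fun s : ℝ => a (q₀, s) :=
      hF.smooth_a.continuousOn.comp_continuous (by fun_prop) fun s => hm q₀ hq₀W s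
    have hbd : ∀ s, |a (q₀, s)|⁻¹ ≤ C' := fun s => by
      have := hC' (q₀, s) ⟨rfl, mem_univ _⟩
      rwa [norm_inv, Real.norm_eq_abs] at this
    have hapos : ∀ s, 0 < |a (q₀, s)| := fun s => abs_pos.2 (hF.a_ne_zero (hm q₀ hq₀W s))
    have hC'pos : (0 : ℝ) < C' := (inv_pos.2 (hapos 0)).trans_le (hbd 0)
    exact surjective_of_deriv_bound (inv_pos.2 hC'pos) hac
      (fun s => inv_le_of_inv_le₀ (hapos s) (hbd s)) (hvert q₀ hq₀W)
  have hdet : ContinuousOn (fun q => planeDet (ϖ q)) W := by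
    have h1 : ContinuousOn ϖ W := hϖs.continuousOn
    have h2 : Continuous planeDet := by unfold planeDet; fun_prop
    exact h2.comp_continuousOn h1
  -- The determinant is one at `q₀`, so shrinking the ball makes it positive and keeps `q₀` inside.
  refine ⟨W ∩ (fun q => planeDet (ϖ q)) ⁻¹' Ioi 0, φ, inter_subset_left.trans hWD,
    hdet.isOpen_inter_preimage hWo isOpen_Ioi, ⟨hq₀W, ?_⟩, ?_, ?_, ?_, ?_⟩
  · simp only [mem_preimage, mem_Ioi, hϖ0, planeDet, ContinuousLinearMap.id_apply, area_apply]
    simp [e₁, e₂]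
  · refine ContDiffOn.mono ?_ inter_subset_left
    have h1 : ContDiffOn ℝ (∞ + 1) φ W := by
      rw [contDiffOn_succ_iff_fderiv_of_isOpen hWo]
      exact ⟨fun q hq => (hφ q hq).differentiableAt.differentiableWithinAt, by simp,
        hϖs.congr fun q hq => (hφ q hq).fderiv⟩
    exact h1.of_le (by simp)
  · rw [(hφ q₀ hq₀W).fderiv, hϖ0]
  · intro q hq
    rw [(hφ q hq.1).fderiv]
    exact hq.2
  · intro q hq s
    obtain ⟨t, ht⟩ := hsurj s
    refine ⟨ϑ (q, t), ?_⟩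
    rw [(hφ q hq.1).fderiv, htransport q hq.1 t]
    simp only at ht
    rw [ht]

end IsFlatFrame

/-! ### The flat frame of a Hamiltonian with vanishing invariants. -/

theorem contDiff_liouville : ContDiff ℝ ∞ liouville :=
  contDiff_snd.clm_comp contDiff_const

theorem fderiv_hamVec_self (h : Phase → ℝ) (z : Phase) : fderiv ℝ h z (hamVec h z) = 0 := by
  rw [← symplectic_hamVec, symplectic, sub_self]

/-- The Hamiltonian field in polar coordinates of the level set. -/
def polarHam (h : Phase → ℝ) (c : ℝ) (x : Polar) : Polar :=
  ((hamVec h (levelPoint h c x)).1, angular h c x (hamVec h (levelPoint h c x)))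

namespace IsSmoothHam

variable {D : Set Plane} {h : Phase → ℝ} {e : ℝ} {v : Phase → Phase} {b : Phase → ℝ}

theorem levelPoint_mem_levelSet (hh : IsSmoothHam D h) (he : -1 < e) {x : Polar}
    (hx : x ∈ cyl D) : levelPoint h (e + 1) x ∈ levelSet D h e := by
  refine ⟨hx.1, ?_⟩
  rw [hh.ham_levelPoint (by linarith) hx]; ring

/-- The fields `v` and `h⃗` are tangent to the level set, hence related to fields in polar
coordinates, and their brackets and Lie derivatives are related too. The pairings of the form with
`X` are Euler's identity and the constancy of `h` along a fibre of the level set. Any admissible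
pair `v`, `b` will do. -/
theorem isFlatFrame (hh : IsSmoothHam D h) (he : -1 < e) (hv : IsCanonicalField D h e v b)
    (hκ : IsCurvature D h e v 0)
    (hb : ∀ z ∈ levelSet D h e, lieDeriv (hamVec h) b z = 0 ∧
      lieDeriv (lieBracket ℝ v (hamVec h)) b z = 0) :
    IsFlatFrame D (e + 1) (levelCov h (e + 1))
      (fun x => angular h (e + 1) x (v (levelPoint h (e + 1) x)))
      (fun x => b (levelPoint h (e + 1) x)) (polarHam h (e + 1)) := by
  have hc : 0 < e + 1 := by linarith
  set c := e + 1 with hcdef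
  set Z := levelPoint h c with hZ
  set a : Polar → ℝ := fun x => angular h c x (v (Z x)) with ha
  set X := polarHam h c with hX
  have ho := isOpen_cyl hh.isOpen
  have hmem : ∀ x ∈ cyl D, Z x ∈ slit D := fun x hx => hh.levelPoint_mem hc hx
  have hlev : ∀ x ∈ cyl D, Z x ∈ levelSet D h e := fun x hx => hh.levelPoint_mem_levelSet he hx
  have hZs : ContDiffOn ℝ ∞ Z (cyl D) := fun x hx =>
    (hh.contDiffAt_levelPoint hx).contDiffWithinAt
  have hvs : ContDiffOn ℝ ∞ (fun x => v (Z x)) (cyl D) := hv.smooth_field.comp hZs hmem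
  have hhs : ContDiffOn ℝ ∞ (fun x => hamVec h (Z x)) (cyl D) :=
    (contDiffOn_hamVec hh.isOpen hh.smooth).comp hZs hmem
  have has : ContDiffOn ℝ ∞ a (cyl D) := hh.contDiffOn_angular hc hvs
  have hXs : ContDiffOn ℝ ∞ X (cyl D) := hhs.fst.prodMk (hh.contDiffOn_angular hc hhs)
  have hAs : ContDiffOn ℝ ∞ (vertical a) (cyl D) := contDiffOn_const.prodMk has
  have hvat : ∀ x ∈ cyl D, ContDiffAt ℝ ∞ v (Z x) := fun x hx =>
    hv.smooth_field.contDiffAt ((isOpen_slit hh.isOpen).mem_nhds (hmem x hx))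
  have hbat : ∀ x ∈ cyl D, ContDiffAt ℝ ∞ b (Z x) := fun x hx =>
    hv.smooth_invariant.contDiffAt ((isOpen_slit hh.isOpen).mem_nhds (hmem x hx))
  have hdiff : ∀ {f : Polar → Polar}, ContDiffOn ℝ ∞ f (cyl D) → ∀ x ∈ cyl D,
      DifferentiableAt ℝ f x := fun hf x hx =>
    (hf.contDiffAt (ho.mem_nhds hx)).differentiableAt (by simp)
  have relv : ∀ x ∈ cyl D, v (Z x) = fderiv ℝ Z x (vertical a x) := by
    intro x hx
    have h1 := hh.eq_fderiv_levelPoint hc hx (hv.tangent _ (hlev x hx))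
    rwa [hv.vertical _ (hlev x hx)] at h1
  have relh : ∀ x ∈ cyl D, hamVec h (Z x) = fderiv ℝ Z x (X x) := fun x hx =>
    hh.eq_fderiv_levelPoint hc hx (fderiv_hamVec_self h _)
  have hnear : ∀ {p : Polar → Prop}, (∀ x ∈ cyl D, p x) → ∀ x ∈ cyl D, ∀ᶠ y in 𝓝 x, p y :=
    fun hp x hx => Filter.eventually_of_mem (ho.mem_nhds hx) hp
  have relb : ∀ x ∈ cyl D, lieBracket ℝ v (hamVec h) (Z x) = fderiv ℝ Z x (bracket a X x) :=
    fun x hx => lieBracket_related (hh.contDiffAt_levelPoint hx) (hdiff hAs x hx) (hdiff hXs x hx)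
      ((hvat x hx).differentiableAt (by simp))
      ((hh.contDiffAt_hamVec (hmem x hx)).differentiableAt (by simp)) (hnear relv x hx)
      (hnear relh x hx)
  have hBs : ContDiffOn ℝ ∞ (bracket a X) (cyl D) :=
    ((hXs.fderiv_of_isOpen ho (by simp)).clm_apply hAs).sub
      ((hAs.fderiv_of_isOpen ho (by simp)).clm_apply hXs)
  have hbrat : ∀ x ∈ cyl D, ContDiffAt ℝ ∞ (lieBracket ℝ v (hamVec h)) (Z x) := fun x hx =>
    (((hh.contDiffAt_hamVec (hmem x hx)).fderiv_right (m := ∞) (by simp)).clm_apply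
      (hvat x hx)).sub (((hvat x hx).fderiv_right (m := ∞) (by simp)).clm_apply
      (hh.contDiffAt_hamVec (hmem x hx)))
  have hbZ : ∀ x ∈ cyl D, ∀ w, fderiv ℝ (fun x => b (Z x)) x w =
      fderiv ℝ b (Z x) (fderiv ℝ Z x w) := by
    intro x hx w
    have h1 : fderiv ℝ (fun x => b (Z x)) x = _ := (HasFDerivAt.comp (g := b) (f := Z) x
      ((hbat x hx).differentiableAt (by simp)).hasFDerivAt
      ((hh.contDiffAt_levelPoint hx).differentiableAt (by simp)).hasFDerivAt).fderiv
    rw [h1]; rfl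
  have hfA : ∀ x ∈ cyl D, ∀ w, (fderiv ℝ (vertical a) x w).1 = 0 := by
    intro x hx w
    have h1 : fderiv ℝ (vertical a) x = _ := ((hasFDerivAt_const (0 : Plane) x).prodMk
      ((has.contDiffAt (ho.mem_nhds hx)).differentiableAt (by simp)).hasFDerivAt).fderiv
    rw [h1]; simp
  have hliou : ∀ x ∈ cyl D, (liouville (Z x)).comp (fderiv ℝ Z x) =
      (levelCov h c x).comp (ContinuousLinearMap.fst ℝ Plane ℝ) := by
    intro x hx
    refine ContinuousLinearMap.ext fun w => ?_
    rw [ContinuousLinearMap.comp_apply, hZ, hh.fderiv_levelPoint hx]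
    rfl
  have hcomp : ∀ {R : Polar → Covec}, ContDiffOn ℝ ∞ R (cyl D) → ∀ x ∈ cyl D, ∀ u w,
      fderiv ℝ (fun x => (R x).comp (ContinuousLinearMap.fst ℝ Plane ℝ)) x u w =
        fderiv ℝ R x u w.1 := by
    intro R hR x hx u w
    have h1 : fderiv ℝ (fun x => (R x).comp (ContinuousLinearMap.fst ℝ Plane ℝ)) x = _ :=
      (((hR.contDiffAt (ho.mem_nhds hx)).differentiableAt (by simp)).hasFDerivAt.clm_comp
        (hasFDerivAt_const (ContinuousLinearMap.fst ℝ Plane ℝ) x)).fderiv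
    rw [h1]; simp
  have hL1 : ∀ x ∈ cyl D, (lieDerivForm v liouville (Z x)).comp (fderiv ℝ Z x) =
      (dform (levelCov h c) a x).comp (ContinuousLinearMap.fst ℝ Plane ℝ) := by
    intro x hx
    refine ContinuousLinearMap.ext fun w => ?_
    have h1 := lieDerivForm_related (hh.contDiffAt_levelPoint hx) (hdiff hAs x hx)
      ((hvat x hx).differentiableAt (by simp))
      (contDiff_liouville.contDiffAt.differentiableAt (by simp)) (hnear relv x hx)
      (hnear hliou x hx) w
    rw [ContinuousLinearMap.comp_apply, h1, hcomp hh.contDiffOn_levelCov x hx,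
      IsFlatFrame.fderiv_form_vertical]
    simp [hfA x hx]
  have hLs : ∀ x ∈ cyl D, ContDiffAt ℝ ∞ (lieDerivForm v liouville) (Z x) := fun x hx =>
    ((contDiff_liouville.fderiv_right (m := ∞) (by simp)).contDiffAt.clm_apply (hvat x hx)).add
      (contDiff_liouville.contDiffAt.clm_comp ((hvat x hx).fderiv_right (m := ∞) (by simp)))
  have hQs : ContDiffOn ℝ ∞ (dform (levelCov h c) a) (cyl D) :=
    has.smul ((hh.contDiffOn_levelCov.fderiv_of_isOpen ho (by simp)).clm_apply contDiffOn_const)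
  refine ⟨hh.isOpen, hc, hh.contDiffOn_levelCov, has, hv.smooth_invariant.comp hZs hmem, hXs,
    levelCov_periodic h c, fun x => ?_, fun x => ?_, fun x => ?_, fun x hx => ?_, fun x hx => ?_,
    fun x hx => ?_, fun x hx => ?_, fun x hx => ?_, fun x hx => ?_⟩
  · simp only [ha, hZ, levelPoint_periodic, angular_periodic]
  · simp only [hZ, levelPoint_periodic]
  · simp only [hX, polarHam, levelPoint_periodic, angular_periodic]
  · have h1 := hh.euler (hmem x hx)
    rw [(hlev x hx).2] at h1
    exact h1
  · have h1 := hh.fderiv_ham_levelPoint hc hx (0, 1)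
    rw [hh.fderiv_levelPoint hx, ← apply_vel] at h1
    exact h1
  · refine ContinuousLinearMap.ext fun y => ?_
    have h1 := lieDerivForm_related (hh.contDiffAt_levelPoint hx) (hdiff hAs x hx)
      ((hvat x hx).differentiableAt (by simp)) ((hLs x hx).differentiableAt (by simp))
      (hnear relv x hx) (hnear hL1 x hx) (y, 0)
    rw [hcomp hQs x hx, hv.structure_eq _ (hlev x hx) _ (hh.fderiv_ham_levelPoint hc hx _)] at h1
    have h2 := congrArg (fun L : Polar →L[ℝ] ℝ => L (y, 0)) (hliou x hx)
    have h3 := congrArg (fun L : Polar →L[ℝ] ℝ => L (y, 0)) (hL1 x hx)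
    simp only [ContinuousLinearMap.comp_apply, ContinuousLinearMap.coe_fst', hfA x hx, map_zero,
      add_zero] at h1 h2 h3
    rw [h2, h3] at h1
    exact h1.symm
  · refine hh.fderiv_levelPoint_injective hc hx ?_
    have h1 := lieBracket_related (hh.contDiffAt_levelPoint hx) (hdiff hXs x hx) (hdiff hBs x hx)
      ((hh.contDiffAt_hamVec (hmem x hx)).differentiableAt (by simp))
      ((hbrat x hx).differentiableAt (by simp)) (hnear relh x hx) (hnear relb x hx)
    exact h1.symm.trans ((hκ _ (hlev x hx)).trans (by simp))
  · rw [hbZ x hx, ← relh x hx]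
    exact (hb _ (hlev x hx)).1
  · have h1 := hbZ x hx (bracket a X x)
    rw [← relb x hx] at h1
    exact h1.trans (hb _ (hlev x hx)).2

/-- Vanishing of the invariants implies straightening. -/
theorem exists_straightening (hh : IsSmoothHam D h) (he : -1 < e)
    (hinv : InvariantsVanishOn D h e) {q₀ : Plane} (hq₀ : q₀ ∈ D) :
    ∃ O φ, O ⊆ D ∧ IsStraightening h q₀ O φ := by
  obtain ⟨v, b, κ, hv, hκ, hz⟩ := hinv
  have hκ0 : IsCurvature D h e v 0 := fun z hz' => by
    rw [hκ z hz', (hz z hz').1]; simp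
  obtain ⟨O, φ, hOD, hO, hqO, hφ, hbase, hdet, hP⟩ :=
    (hh.isFlatFrame he hv hκ0 fun z hz' => (hz z hz').2).exists_flattening hq₀
  refine ⟨O, φ, hOD, hO, hqO, hφ, hbase, hdet, fun q hq π => ?_⟩
  have hc : 0 < e + 1 := by linarith
  by_cases hπ : π = 0
  · rw [hπ, ContinuousLinearMap.zero_comp, hh.apply_zero (hOD hq), hh.apply_zero hq₀]
  obtain ⟨ρ, s, hρ, rfl⟩ := exists_eq_smul_unitCov hπ
  have hx : ((q₀, s) : Polar) ∈ cyl D := ⟨hq₀, mem_univ _⟩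
  obtain ⟨s', hs'⟩ := hP q hq s
  have hpos := hh.pos _ (unitCov_mem hx)
  set k := (e + 1) / (h (q₀, unitCov s) + 1) with hk
  have hk0 : 0 < k := div_pos hc hpos
  have h1 : levelCov h (e + 1) (q₀, s) = k • unitCov s := rfl
  -- Every nonzero covector is a positive multiple of one on the level set, so homogeneity carries
  -- the invariance there to all covectors.
  have h2 : ρ • unitCov s = (ρ / k) • levelCov h (e + 1) (q₀, s) := by
    rw [h1, smul_smul, div_mul_cancel₀ _ hk0.ne']
  have h3 : 0 < ρ / k := div_pos hρ hk0
  rw [h2, ContinuousLinearMap.smul_comp, ← hs']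
  have h4 := hh.homogeneous q (hOD hq) (levelCov h (e + 1) (q, s')) _ h3
  have h5 := hh.homogeneous q₀ hq₀ (levelCov h (e + 1) (q₀, s)) _ h3
  have h6 : h (q, levelCov h (e + 1) (q, s')) = e + 1 - 1 :=
    hh.ham_levelPoint hc (x := (q, s')) ⟨hOD hq, mem_univ _⟩
  have h7 : h (q₀, levelCov h (e + 1) (q₀, s)) = e + 1 - 1 := hh.ham_levelPoint hc hx
  rw [h6] at h4
  rw [h7] at h5
  linarith

end IsSmoothHam

/-! ### Matching the controls of systems with the same support functions -/

/-- A property that holds near the diagonal over a point holds uniformly. -/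
theorem eventually_near_diagonal {X U : Type*} [TopologicalSpace X] [MetricSpace U]
    [CompactSpace U] {x₀ : X} {p : X → U → U → U → Prop}
    (hp : ∀ u : U, ∀ᶠ y : X × U × U × U in 𝓝 (x₀, u, u, u), p y.1 y.2.1 y.2.2.1 y.2.2.2) :
    ∃ δ > 0, ∀ᶠ x in 𝓝 x₀, ∀ u w w', dist w u < δ → dist w' u < δ → p x u w w' := by
  -- The admissible distance is treated as a further parameter tending to zero, so that compactness
  -- of `U` gives one radius for all controls.
  have h1 : ∀ᶠ y : X × ℝ in 𝓝 (x₀, 0), ∀ u ∈ (univ : Set U), ∀ w w', dist w u < y.2 →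
      dist w' u < y.2 → p y.1 u w w' := by
    refine isCompact_univ.eventually_forall_of_forall_eventually fun u₀ _ => ?_
    have h2 := hp u₀
    rw [nhds_prod_eq, nhds_prod_eq, nhds_prod_eq] at h2
    obtain ⟨A, hA, B, hB, hAB⟩ := Filter.eventually_prod_iff.1 h2
    have hB' : ∀ᶠ y : U × U × U in 𝓝 (u₀, u₀, u₀), B y := by
      rw [nhds_prod_eq, nhds_prod_eq]; exact hB
    obtain ⟨ε, hε, hball⟩ := Metric.eventually_nhds_iff.1 hB'
    have e1 : ∀ᶠ z : (X × ℝ) × U in 𝓝 ((x₀, 0), u₀), A z.1.1 :=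
      (continuous_fst.comp continuous_fst).continuousAt.eventually hA
    have e2 : ∀ᶠ z : (X × ℝ) × U in 𝓝 ((x₀, (0 : ℝ)), u₀), z.1.2 < ε / 2 :=
      (continuous_snd.comp continuous_fst).continuousAt.eventually (gt_mem_nhds (half_pos hε))
    have e3 : ∀ᶠ z : (X × ℝ) × U in 𝓝 ((x₀, (0 : ℝ)), u₀), dist z.2 u₀ < ε / 2 :=
      continuous_snd.continuousAt.eventually (Metric.eventually_nhds_iff.2 ⟨ε / 2, half_pos hε, fun _ h => h⟩)
    filter_upwards [e1, e2, e3] with z hz1 hz2 hz3 w w' hw hw'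
    refine hAB hz1 (hball (y := (z.2, w, w')) ?_)
    have d1 := dist_triangle w z.2 u₀
    have d2 := dist_triangle w' z.2 u₀
    simp only [Prod.dist_eq, max_lt_iff]
    exact ⟨by linarith, by linarith, by linarith⟩
  rw [nhds_prod_eq] at h1
  obtain ⟨A, hA, B, hB, hAB⟩ := Filter.eventually_prod_iff.1 h1
  obtain ⟨ε, hε, hball⟩ := Metric.eventually_nhds_iff.1 hB
  refine ⟨ε / 2, half_pos hε, hA.mono fun x hx u w w' hw hw' => ?_⟩
  exact hAB hx (hball (y := ε / 2) (by
    rw [Real.dist_eq, sub_zero, abs_of_pos (half_pos hε)]; linarith)) u (mem_univ u) w w' hw hw'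

theorem exists_equiv_of_planeDet {A : Plane →L[ℝ] Plane} (hA : planeDet A ≠ 0) :
    ∃ L : Plane ≃L[ℝ] Plane, (L : Plane →L[ℝ] Plane) = A :=
  ⟨(LinearEquiv.ofInjectiveEndo (A : Plane →ₗ[ℝ] Plane)
    fun _ _ h => eq_of_map_eq hA h).toContinuousLinearEquiv, by ext x; rfl⟩

namespace IsRegularSystem

section

variable {U : Type*} [TopologicalSpace U] [ChartedSpace ℝ U] {D : Set Plane}
  {F : Plane → U → Plane}

theorem const (hF : IsRegularSystem D F) {q₀ : Plane} (hq₀ : q₀ ∈ D) :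
    IsRegularSystem D fun _ => F q₀ := by
  refine ⟨hF.isOpen, ?_, fun c hc _ _ => hF.regular c hc q₀ hq₀, fun _ _ => hF.convex q₀ hq₀⟩
  exact hF.smooth.comp (f := fun x : Plane × U => (q₀, x.2))
    (contMDiff_const.prodMk contMDiff_snd).contMDiffOn fun _ _ => ⟨hq₀, mem_univ _⟩

theorem mono (hF : IsRegularSystem D F) {O : Set Plane} (hO : IsOpen O) (hOD : O ⊆ D) :
    IsRegularSystem O F :=
  ⟨hO, hF.smooth.mono (prod_mono hOD subset_rfl), fun c hc q hq => hF.regular c hc q (hOD hq),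
    fun q hq => hF.convex q (hOD hq)⟩

/-- The image of a system under linear maps of the fibres. -/
theorem map (hF : IsRegularSystem D F) {A : Plane → Plane →L[ℝ] Plane}
    (hA : ContDiffOn ℝ ∞ A D) (hdet : ∀ q ∈ D, planeDet (A q) ≠ 0) :
    IsRegularSystem D fun q u => A q (F q u) := by
  refine ⟨hF.isOpen, ?_, fun c hc q hq t ht => ?_, fun q hq u => ?_⟩
  · have h1 : ContMDiffOn ((𝓡 2).prod 𝓘(ℝ)) 𝓘(ℝ, Plane →L[ℝ] Plane) ∞
        (fun x : Plane × U => A x.1) (D ×ˢ univ) :=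
      (contMDiffOn_iff_contDiffOn.2 hA).comp contMDiffOn_fst fun x hx => hx.1
    exact h1.clm_apply hF.smooth
  · have h1 : ∀ s ∈ c.target, deriv (fun s => A q (F q (c.symm s))) s =
        A q (deriv (fun s => F q (c.symm s)) s) := fun s hs =>
      ((A q).hasFDerivAt.comp_hasDerivAt s (hF.hasDerivAt_curve hc hq hs)).deriv
    have h2 : deriv (fun s => A q (F q (c.symm s))) =ᶠ[𝓝 t]
        fun s => A q (deriv (fun s => F q (c.symm s)) s) :=
      Filter.eventually_of_mem (c.open_target.mem_nhds ht) h1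
    have h3 : deriv (fun s => A q (deriv (fun s => F q (c.symm s)) s)) t =
        A q (deriv (deriv (fun s => F q (c.symm s))) t) :=
      ((A q).hasFDerivAt.comp_hasDerivAt t (hF.hasDerivAt_deriv_curve hc hq ht)).deriv
    rw [h2.deriv_eq, h3, h1 t ht, area_map, area_map]
    obtain ⟨r1, r2⟩ := hF.regular c hc q hq t ht
    exact ⟨mul_ne_zero (hdet q hq) r1, mul_ne_zero (hdet q hq) r2⟩
  · obtain ⟨p, hp, hmax⟩ := hF.convex q hq u
    obtain ⟨L, hL⟩ := exists_equiv_of_planeDet (hdet q hq)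
    have h1 : ∀ x, p.comp (L.symm : Plane →L[ℝ] Plane) (A q x) = p x := fun x => by
      rw [← hL]; simp
    refine ⟨p.comp (L.symm : Plane →L[ℝ] Plane), fun h0 => hp ?_, fun w => ?_⟩
    · refine ContinuousLinearMap.ext fun x => ?_
      rw [← h1, h0]; simp
    · rw [h1, h1]; exact hmax w

/-- A smooth choice of the control with a velocity of a given direction. -/
theorem exists_parallel_control [IsManifold 𝓘(ℝ) ∞ U] {G : Plane → U → Plane}
    (hF : IsRegularSystem D F)
    (hG : IsRegularSystem D G) {q₁ : Plane} (hq₁ : q₁ ∈ D) {u₁ w₁ : U}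
    (h0 : area (F q₁ u₁) (G q₁ w₁) = 0) :
    ∃ τ : Plane × U → U, ContMDiffAt ((𝓡 2).prod 𝓘(ℝ)) 𝓘(ℝ) ∞ τ (q₁, u₁) ∧ τ (q₁, u₁) = w₁ ∧
      (∀ᶠ y in 𝓝 (q₁, u₁), area (F y.1 y.2) (G y.1 (τ y)) = 0) ∧
      ∀ᶠ y : Plane × U × U in 𝓝 (q₁, u₁, w₁),
        area (F y.1 y.2.1) (G y.1 y.2.2) = 0 → y.2.2 = τ (y.1, y.2.1) := by
  set c := chartAt ℝ u₁ with hc'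
  set d := chartAt ℝ w₁ with hd'
  have hc : c ∈ IsManifold.maximalAtlas 𝓘(ℝ) ∞ U :=
    IsManifold.chart_mem_maximalAtlas (I := 𝓘(ℝ)) (n := ∞) u₁
  have hd : d ∈ IsManifold.maximalAtlas 𝓘(ℝ) ∞ U :=
    IsManifold.chart_mem_maximalAtlas (I := 𝓘(ℝ)) (n := ∞) w₁
  have hu : u₁ ∈ c.source := mem_chart_source ℝ u₁
  have hw : w₁ ∈ d.source := mem_chart_source ℝ w₁
  set Γ : (Plane × ℝ) × ℝ → ℝ := fun y => area (F y.1.1 (c.symm y.1.2)) (G y.1.1 (d.symm y.2))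
    with hΓ
  have hFc : ContDiffAt ℝ ∞ (fun x : Plane × ℝ => F x.1 (c.symm x.2)) (q₁, c u₁) :=
    (hF.contDiffOn_chart hc).contDiffAt
      ((hF.isOpen.prod c.open_target).mem_nhds ⟨hq₁, c.map_source hu⟩)
  have hGd : ContDiffAt ℝ ∞ (fun x : Plane × ℝ => G x.1 (d.symm x.2)) (q₁, d w₁) :=
    (hG.contDiffOn_chart hd).contDiffAt
      ((hF.isOpen.prod d.open_target).mem_nhds ⟨hq₁, d.map_source hw⟩)
  have hF1 : ContDiffAt ℝ ∞ (fun y : (Plane × ℝ) × ℝ => F y.1.1 (c.symm y.1.2))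
      ((q₁, c u₁), d w₁) :=
    ContDiffAt.comp (g := fun x : Plane × ℝ => F x.1 (c.symm x.2))
      (f := fun y : (Plane × ℝ) × ℝ => y.1) ((q₁, c u₁), d w₁) hFc contDiffAt_fst
  have hG1 : ContDiffAt ℝ ∞ (fun y : (Plane × ℝ) × ℝ => G y.1.1 (d.symm y.2))
      ((q₁, c u₁), d w₁) :=
    ContDiffAt.comp (g := fun x : Plane × ℝ => G x.1 (d.symm x.2))
      (f := fun y : (Plane × ℝ) × ℝ => (y.1.1, y.2)) ((q₁, c u₁), d w₁) hGd
      (contDiffAt_fst.fst.prodMk contDiffAt_snd)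
  have hΓs : ContDiffAt ℝ ∞ Γ ((q₁, c u₁), d w₁) :=
    (area.contDiff.contDiffAt.comp _ hF1).clm_apply hG1
  have hΓ0 : Γ ((q₁, c u₁), d w₁) = 0 := by
    simp only [hΓ, c.left_inv hu, d.left_inv hw]; exact h0
  have hFne : F q₁ u₁ ≠ 0 := by
    intro h1
    have := (hF.regular c hc q₁ hq₁ _ (c.map_source hu)).1
    rw [c.left_inv hu, h1] at this
    simp at this
  -- `F` is parallel to `G` at these controls, and `G` is independent of its derivative in the
  -- control, so the derivative of the parallelism condition is nonzero.
  have hΓ1 : fderiv ℝ Γ ((q₁, c u₁), d w₁) (0, 1) ≠ 0 := by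
    have h1 : HasDerivAt (fun s : ℝ => (((q₁, c u₁), s) : (Plane × ℝ) × ℝ)) (0, 1) (d w₁) :=
      (hasDerivAt_const (d w₁) (q₁, c u₁)).prodMk (hasDerivAt_id (d w₁))
    have h2 := HasFDerivAt.comp_hasDerivAt (f := fun s : ℝ => (((q₁, c u₁), s) : (Plane × ℝ) × ℝ))
      (d w₁) (hΓs.differentiableAt (by simp)).hasFDerivAt h1
    have h3 : HasDerivAt (fun s => area (F q₁ u₁) (G q₁ (d.symm s)))
        (area (F q₁ u₁) (deriv (fun s => G q₁ (d.symm s)) (d w₁))) (d w₁) :=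
      (area (F q₁ u₁)).hasFDerivAt.comp_hasDerivAt (d w₁)
        (hG.hasDerivAt_curve hd hq₁ (d.map_source hw))
    have h4 : (Γ ∘ fun s : ℝ => (((q₁, c u₁), s) : (Plane × ℝ) × ℝ)) =
        fun s => area (F q₁ u₁) (G q₁ (d.symm s)) := by
      funext s; simp [hΓ, c.left_inv hu]
    rw [h4] at h2
    rw [h2.unique h3]
    intro h5
    have h6 := (hG.regular d hd q₁ hq₁ _ (d.map_source hw)).1
    rw [d.left_inv hw] at h6
    exact area_ne_zero_vec hFne (covec_eq_zero h6 h0 h5)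
  obtain ⟨τ, hτ, hτ0, hτz, hτu⟩ := exists_implicit hΓs hΓ0 hΓ1
  -- the chart on the product
  have hlift : ContMDiffAt ((𝓡 2).prod 𝓘(ℝ)) 𝓘(ℝ, Plane × ℝ) ∞
      (fun y : Plane × U => (y.1, c y.2)) (q₁, u₁) :=
    contMDiffAt_fst.prodMk_space
      ((contMDiffAt_of_mem_maximalAtlas hc hu).comp (q₁, u₁) contMDiffAt_snd)
  have hτc : ContMDiffAt ((𝓡 2).prod 𝓘(ℝ)) 𝓘(ℝ) ∞ (fun y : Plane × U => τ (y.1, c y.2))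
      (q₁, u₁) :=
    ContMDiffAt.comp (g := τ) (f := fun y : Plane × U => (y.1, c y.2)) (q₁, u₁) hτ.contMDiffAt hlift
  have hτt : τ (q₁, c u₁) ∈ d.target := by rw [hτ0]; exact d.map_source hw
  have hcsrc : ∀ᶠ y : Plane × U in 𝓝 (q₁, u₁), y.2 ∈ c.source :=
    continuousAt_snd.eventually (c.open_source.mem_nhds hu)
  refine ⟨fun y => d.symm (τ (y.1, c y.2)), ?_, ?_, ?_, ?_⟩
  · exact ContMDiffAt.comp (g := d.symm) (f := fun y : Plane × U => τ (y.1, c y.2)) (q₁, u₁)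
      (contMDiffAt_symm_of_mem_maximalAtlas hd hτt) hτc
  · simp only [hτ0]; exact d.left_inv hw
  · filter_upwards [hlift.continuousAt.eventually hτz, hcsrc] with y hy hys
    simpa [hΓ, c.left_inv hys] using hy
  · have hmap : ContinuousAt (fun y : Plane × U × U => (((y.1, c y.2.1), d y.2.2) : (Plane × ℝ) × ℝ))
        (q₁, u₁, w₁) := by
      refine ContinuousAt.prodMk (ContinuousAt.prodMk continuousAt_fst ?_) ?_
      · exact ContinuousAt.comp (g := c) (f := fun y : Plane × U × U => y.2.1)
          (c.continuousAt hu) (by fun_prop)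
      · exact ContinuousAt.comp (g := d) (f := fun y : Plane × U × U => y.2.2)
          (d.continuousAt hw) (by fun_prop)
    have s1 : ∀ᶠ y : Plane × U × U in 𝓝 (q₁, u₁, w₁), y.2.1 ∈ c.source :=
      (continuous_fst.comp continuous_snd).continuousAt.eventually (c.open_source.mem_nhds hu)
    have s2 : ∀ᶠ y : Plane × U × U in 𝓝 (q₁, u₁, w₁), y.2.2 ∈ d.source :=
      (continuous_snd.comp continuous_snd).continuousAt.eventually (d.open_source.mem_nhds hw)
    filter_upwards [hmap.eventually hτu, s1, s2] with y hy hy1 hy2 hK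
    have := hy (by simpa [hΓ, c.left_inv hy1, d.left_inv hy2] using hK)
    rw [this, d.left_inv hy2]

end

section

variable {U : Type*} [TopologicalSpace U] [ChartedSpace ℝ U] [IsManifold 𝓘(ℝ) ∞ U]
  [CompactSpace U] [Nonempty U] {D : Set Plane} {F : Plane → U → Plane}

/-- Parallel velocities of systems with the same support function are equal. -/
theorem eq_of_eq_smul (hF : IsRegularSystem D F) {q q₀ : Plane} (hq : q ∈ D) (hq₀ : q₀ ∈ D)
    (hsame : ∀ π : Covec, maxHam F (q, π) = maxHam F (q₀, π)) {u w : U} {l : ℝ} (hl : 0 < l)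
    (h : F q u = l • F q₀ w) : F q u = F q₀ w := by
  have hsup : ∀ {x : Plane}, x ∈ D → ∀ (p : Covec) (u : U), p (F x u) ≤ maxHam F (x, p) + 1 := by
    intro x hx p u
    obtain ⟨m, hm⟩ := hF.exists_max hx p
    rw [maxHam_eq (z := (x, p)) hm]
    linarith [hm u]
  -- The supporting covector at `F q₀ w` bounds the ratio `l` from above through the common support
  -- function; the one at `F q u` bounds it from below.
  have h1 : l ≤ 1 := by
    obtain ⟨p, hp, hmax⟩ := hF.convex q₀ hq₀ w
    have hpos := hF.apply_pos_of_max hq₀ hp hmax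
    have h2 := hsup hq p u
    rw [hsame, maxHam_eq (z := (q₀, p)) hmax, h, map_smul, smul_eq_mul] at h2
    nlinarith
  have h2 : 1 ≤ l := by
    obtain ⟨p, hp, hmax⟩ := hF.convex q hq u
    have hpos := hF.apply_pos_of_max hq hp hmax
    have h3 := hsup hq₀ p w
    rw [← hsame, maxHam_eq (z := (q, p)) hmax, h, map_smul, smul_eq_mul] at h3
    rw [h, map_smul, smul_eq_mul] at hpos
    have : 0 < p (F q₀ w) := pos_of_mul_pos_right hpos hl.le
    nlinarith
  rw [h, le_antisymm h1 h2, one_smul]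

/-- Systems with the same support functions differ by a change of controls. -/
theorem exists_control_change [T2Space U] [SecondCountableTopology U] (hF : IsRegularSystem D F)
    {q₀ : Plane} (hq₀ : q₀ ∈ D)
    (hsame : ∀ q ∈ D, ∀ π : Covec, maxHam F (q, π) = maxHam F (q₀, π)) :
    ∃ (B : Set Plane) (ψ ρ : Plane × U → U), IsOpen B ∧ q₀ ∈ B ∧ B ⊆ D ∧
      ContMDiffOn ((𝓡 2).prod 𝓘(ℝ)) 𝓘(ℝ) ∞ ψ (B ×ˢ univ) ∧
      ContMDiffOn ((𝓡 2).prod 𝓘(ℝ)) 𝓘(ℝ) ∞ ρ (B ×ˢ univ) ∧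
      ∀ q ∈ B, ∀ u, F q u = F q₀ (ψ (q, u)) ∧ ρ (q, ψ (q, u)) = u ∧ ψ (q, ρ (q, u)) = u := by
  let _ := TopologicalSpace.metrizableSpaceMetric U
  have hG := hF.const hq₀
  set G : Plane → U → Plane := fun _ => F q₀ with hGdef
  have hne : ∀ q ∈ D, ∀ u, F q u ≠ 0 := by
    intro q hq u h1
    have := (hF.regular _ (IsManifold.chart_mem_maximalAtlas (I := 𝓘(ℝ)) (n := ∞) u) q hq _
      ((chartAt ℝ u).map_source (mem_chart_source ℝ u))).1
    rw [(chartAt ℝ u).left_inv (mem_chart_source ℝ u), h1] at this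
    simp at this
  have hcont : ∀ q ∈ D, ∀ u w, ContinuousAt
      (fun y : Plane × U × U => (inner ℝ (F y.1 y.2.1) (F q₀ y.2.2) : ℝ)) (q, u, w) := by
    intro q hq u w
    refine ContinuousAt.inner ?_ ?_
    · have h1 : ContinuousAt (fun x : Plane × U => F x.1 x.2) (q, u) :=
        hF.smooth.continuousOn.continuousAt
          ((hF.isOpen.prod isOpen_univ).mem_nhds ⟨hq, mem_univ _⟩)
      exact ContinuousAt.comp (g := fun x : Plane × U => F x.1 x.2)
        (f := fun y : Plane × U × U => (y.1, y.2.1)) h1 (by fun_prop)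
    · exact ((hF.continuous_velocity hq₀).comp (continuous_snd.comp continuous_snd)).continuousAt
  -- uniqueness and positivity near the diagonal
  obtain ⟨δ, hδ, huniq⟩ := eventually_near_diagonal (x₀ := q₀) (U := U)
    (p := fun q u w w' => 0 < (inner ℝ (F q u) (F q₀ w) : ℝ) ∧
      (area (F q u) (F q₀ w) = 0 → area (F q u) (F q₀ w') = 0 → w = w') ∧
      (area (F q₀ u) (F q w) = 0 → area (F q₀ u) (F q w') = 0 → w = w')) (fun u => by
    obtain ⟨τ, -, -, -, hτ⟩ := hF.exists_parallel_control hG hq₀ (area_self (F q₀ u))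
    obtain ⟨τ', -, -, -, hτ'⟩ := hG.exists_parallel_control hF hq₀ (area_self (F q₀ u))
    have hpos : ∀ᶠ y : Plane × U × U in 𝓝 (q₀, u, u),
        0 < (inner ℝ (F y.1 y.2.1) (F q₀ y.2.2) : ℝ) :=
      (hcont q₀ hq₀ u u).eventually (lt_mem_nhds (real_inner_self_pos.2 (hne q₀ hq₀ u)))
    have c1 : ContinuousAt (fun y : Plane × U × U × U => (y.1, y.2.1, y.2.2.1)) (q₀, u, u, u) := by
      fun_prop
    have c2 : ContinuousAt (fun y : Plane × U × U × U => (y.1, y.2.1, y.2.2.2)) (q₀, u, u, u) := by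
      fun_prop
    filter_upwards [c1.eventually hpos, c1.eventually hτ, c2.eventually hτ, c1.eventually hτ',
      c2.eventually hτ'] with y p0 p1 p2 p3 p4
    exact ⟨p0, fun k1 k2 => (p1 k1).trans (p2 k2).symm, fun k1 k2 => (p3 k1).trans (p4 k2).symm⟩)
  -- existence
  have hexist : ∀ {F' G' : Plane → U → Plane}, IsRegularSystem D F' → IsRegularSystem D G' →
      F' q₀ = G' q₀ → ∀ᶠ q in 𝓝 q₀, ∀ u : U, ∃ w, dist w u < δ ∧ area (F' q u) (G' q w) = 0 := by
    intro F' G' hF' hG' h0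
    have h1 : ∀ᶠ q in 𝓝 q₀, ∀ u ∈ (univ : Set U), ∃ w, dist w u < δ ∧
        area (F' q u) (G' q w) = 0 := by
      refine isCompact_univ.eventually_forall_of_forall_eventually fun u _ => ?_
      obtain ⟨τ, hτs, hτ0, hτz, -⟩ := hF'.exists_parallel_control hG' hq₀ (u₁ := u) (w₁ := u)
        (by rw [h0]; exact area_self _)
      have hd : ∀ᶠ y : Plane × U in 𝓝 (q₀, u), dist (τ y) y.2 < δ := by
        refine (hτs.continuousAt.dist continuousAt_snd).eventually (gt_mem_nhds ?_)
        simpa [hτ0] using hδ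
      filter_upwards [hd, hτz] with y y1 y2
      exact ⟨τ y, y1, y2⟩
    exact h1.mono fun q hq u => hq u (mem_univ u)
  have hnear : ∀ᶠ q in 𝓝 q₀, q ∈ D := hF.isOpen.mem_nhds hq₀
  obtain ⟨B, hBsub, hBo, hqB⟩ := mem_nhds_iff.1 (hnear.and
    (huniq.and ((hexist hF hG rfl).and (hexist hG hF rfl))))
  -- a solution with the required closeness is smooth
  have hsmooth : ∀ {F' G' : Plane → U → Plane}, IsRegularSystem D F' → IsRegularSystem D G' →
      (∀ q ∈ B, ∀ u w w', dist w u < δ → dist w' u < δ → area (F' q u) (G' q w) = 0 →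
        area (F' q u) (G' q w') = 0 → w = w') → ∀ ψ : Plane × U → U,
      (∀ q ∈ B, ∀ u, dist (ψ (q, u)) u < δ ∧ area (F' q u) (G' q (ψ (q, u))) = 0) →
      ContMDiffOn ((𝓡 2).prod 𝓘(ℝ)) 𝓘(ℝ) ∞ ψ (B ×ˢ univ) := by
    rintro F' G' hF' hG' hun ψ hψ ⟨q, u⟩ ⟨hq, -⟩
    obtain ⟨τ, hτs, hτ0, hτz, -⟩ := hF'.exists_parallel_control hG' (hBsub hq).1
      (u₁ := u) (w₁ := ψ (q, u)) (hψ q hq u).2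
    refine ContMDiffAt.contMDiffWithinAt (hτs.congr_of_eventuallyEq ?_)
    have hd : ∀ᶠ y : Plane × U in 𝓝 (q, u), dist (τ y) y.2 < δ := by
      refine (hτs.continuousAt.dist continuousAt_snd).eventually (gt_mem_nhds ?_)
      rw [hτ0]; exact (hψ q hq u).1
    have hB : ∀ᶠ y : Plane × U in 𝓝 (q, u), y.1 ∈ B :=
      continuousAt_fst.eventually (hBo.mem_nhds hq)
    filter_upwards [hd, hτz, hB] with y y1 y2 y3
    exact hun y.1 y3 y.2 _ _ (hψ y.1 y3 y.2).1 y1 (hψ y.1 y3 y.2).2 y2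
  have hex1 : ∀ y : Plane × U, ∃ w, y.1 ∈ B → dist w y.2 < δ ∧ area (F y.1 y.2) (F q₀ w) = 0 := by
    intro y
    by_cases hy : y.1 ∈ B
    · obtain ⟨w, hw⟩ := (hBsub hy).2.2.1 y.2
      exact ⟨w, fun _ => hw⟩
    · exact ⟨y.2, fun h => absurd h hy⟩
  have hex2 : ∀ y : Plane × U, ∃ w, y.1 ∈ B → dist w y.2 < δ ∧ area (F q₀ y.2) (F y.1 w) = 0 := by
    intro y
    by_cases hy : y.1 ∈ B
    · obtain ⟨w, hw⟩ := (hBsub hy).2.2.2 y.2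
      exact ⟨w, fun _ => hw⟩
    · exact ⟨y.2, fun h => absurd h hy⟩
  choose ψ hψ using hex1
  choose ρ hρ using hex2
  refine ⟨B, ψ, ρ, hBo, hqB, fun q hq => (hBsub hq).1, ?_, ?_, fun q hq u => ⟨?_, ?_, ?_⟩⟩
  · exact hsmooth hF hG (fun q hq u w w' h1 h2 => ((hBsub hq).2.1 u w w' h1 h2).2.1) ψ
      fun q hq u => hψ (q, u) hq
  · exact hsmooth hG hF (fun q hq u w w' h1 h2 => ((hBsub hq).2.1 u w w' h1 h2).2.2) ρ
      fun q hq u => hρ (q, u) hq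
  · obtain ⟨hd, ha⟩ := hψ (q, u) hq
    have hpos := ((hBsub hq).2.1 u _ _ hd hd).1
    have hq' := (hBsub hq).1
    set w := ψ (q, u)
    have hw0 := hne q₀ hq₀ w
    have hn : 0 < (inner ℝ (F q₀ w) (F q₀ w) : ℝ) := real_inner_self_pos.2 hw0
    -- The ratio is the coefficient of orthogonal projection, exact because the vectors are
    -- parallel. It is positive since `w` is within `δ` of `u`.
    refine hF.eq_of_eq_smul hq' hq₀ (hsame q hq')
      (l := inner ℝ (F q u) (F q₀ w) / inner ℝ (F q₀ w) (F q₀ w)) (div_pos hpos hn) ?_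
    have ha' : F q u 0 * F q₀ w 1 - F q u 1 * F q₀ w 0 = 0 := by rw [← area_apply]; exact ha
    have hin : ∀ x y : Plane, (inner ℝ x y : ℝ) = x 0 * y 0 + x 1 * y 1 := fun x y => by
      simp [PiLp.inner_apply, Fin.sum_univ_two, mul_comm]
    rw [div_eq_inv_mul, mul_smul, eq_inv_smul_iff₀ hn.ne', hin, hin]
    ext j
    fin_cases j
    · simp
      linear_combination (F q₀ w 1) * ha'
    · simp
      linear_combination -(F q₀ w 0) * ha'
  · obtain ⟨hd, ha⟩ := hψ (q, u) hq
    obtain ⟨hd', ha'⟩ := hρ (q, ψ (q, u)) hq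
    -- Both `u` and `ρ (q, ψ (q, u))` lie within `δ` of `ψ (q, u)` and give velocities parallel to
    -- the same vector, so local uniqueness identifies them.
    refine ((hBsub hq).2.1 (ψ (q, u)) _ _ hd' (by rw [dist_comm]; exact hd)).2.2 ha' ?_
    rw [area_swap, ha, neg_zero]
  · obtain ⟨hd, ha⟩ := hρ (q, u) hq
    obtain ⟨hd', ha'⟩ := hψ (q, ρ (q, u)) hq
    refine ((hBsub hq).2.1 (ρ (q, u)) _ _ hd' (by rw [dist_comm]; exact hd)).2.1 ha' ?_
    rw [area_swap, ha, neg_zero]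

end

end IsRegularSystem

/-! ### Systems in charts -/

section

variable {M : Type*} [TopologicalSpace M] [ChartedSpace Plane M]
  {χ : OpenPartialHomeomorph M Plane}

theorem mdifferentiable_of_mem_maximalAtlas (hχ : χ ∈ IsManifold.maximalAtlas (𝓡 2) ∞ M) :
    χ.MDifferentiable (𝓡 2) (𝓡 2) :=
  ⟨(contMDiffOn_of_mem_maximalAtlas hχ).mdifferentiableOn (by simp),
    (contMDiffOn_symm_of_mem_maximalAtlas hχ).mdifferentiableOn (by simp)⟩

/-- The differential of a chart as a linear isomorphism of the plane. -/
theorem exists_chart_equiv (hχ : χ ∈ IsManifold.maximalAtlas (𝓡 2) ∞ M) {q : M}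
    (hq : q ∈ χ.source) :
    ∃ L : Plane ≃L[ℝ] Plane, ∀ y : Plane, L y = mfderiv (𝓡 2) (𝓡 2) χ q y :=
  ⟨(mdifferentiable_of_mem_maximalAtlas hχ).mfderiv hq, fun _ => rfl⟩

variable {U : Type*} {f : (q : M) → U → TangentSpace (𝓡 2) q}

theorem inChart_apply {q : M} (hq : q ∈ χ.source) (u : U) :
    inChart f χ (χ q) u = mfderiv (𝓡 2) (𝓡 2) χ q (f q u) := by
  have h : ∀ q', q' = q → (mfderiv (𝓡 2) (𝓡 2) χ q' (f q' u) : Plane) =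
      mfderiv (𝓡 2) (𝓡 2) χ q (f q u) := by
    rintro _ rfl; rfl
  exact h _ (χ.left_inv hq)

variable [TopologicalSpace U] [ChartedSpace ℝ U]

theorem contMDiffOn_inChart [IsManifold (𝓡 2) ∞ M] (hf : IsControlSystem f)
    (hχ : χ ∈ IsManifold.maximalAtlas (𝓡 2) ∞ M) :
    ContMDiffOn ((𝓡 2).prod 𝓘(ℝ)) (𝓡 2) ∞ (fun x : Plane × U => inChart f χ x.1 x.2)
      (χ.target ×ˢ univ) := by
  have : IsManifold (𝓡 2) 1 M := IsManifold.of_le (n := ∞) (by simp)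
  have h1 : ContMDiffOn (𝓡 2).tangent (𝓡 2).tangent ∞
      (tangentMapWithin (𝓡 2) (𝓡 2) χ χ.source) (Bundle.TotalSpace.proj ⁻¹' χ.source) :=
    (contMDiffOn_of_mem_maximalAtlas hχ).contMDiffOn_tangentMapWithin (by simp)
      χ.open_source.uniqueMDiffOn
  have h2 : ContMDiffOn ((𝓡 2).prod 𝓘(ℝ)) ((𝓡 2).prod 𝓘(ℝ)) ∞
      (fun x : Plane × U => (χ.symm x.1, x.2)) (χ.target ×ˢ univ) :=
    ((contMDiffOn_symm_of_mem_maximalAtlas hχ).comp contMDiffOn_fst fun x hx => hx.1).prodMk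
      contMDiffOn_snd
  have h3 : ContMDiffOn ((𝓡 2).prod 𝓘(ℝ)) (𝓡 2).tangent ∞
      (fun x : Plane × U => (⟨χ.symm x.1, f (χ.symm x.1) x.2⟩ : TangentBundle (𝓡 2) M))
      (χ.target ×ˢ univ) := hf.comp_contMDiffOn h2
  have h4 := h1.comp h3 fun x hx => χ.map_target hx.1
  have h5 := (contMDiff_snd_tangentBundle_modelSpace (n := ∞) Plane (𝓡 2)).comp_contMDiffOn h4
  refine h5.congr fun x hx => ?_
  change _ = mfderivWithin (𝓡 2) (𝓡 2) χ χ.source (χ.symm x.1) (f (χ.symm x.1) x.2)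
  rw [mfderivWithin_of_isOpen χ.open_source (χ.map_target hx.1)]
  rfl

/-- Regularity and convexity are invariant under the linear isomorphism given by the differential of
the chart, which does not involve the control. -/
theorem isRegularSystem_inChart [IsManifold (𝓡 2) ∞ M] (hf : IsControlSystem f)
    (hreg : IsRegular f) (hconv : HasConvexVelocities f) (hχ : χ ∈ IsManifold.maximalAtlas (𝓡 2) ∞ M) :
    IsRegularSystem χ.target (inChart f χ) := by
  refine ⟨χ.open_target, contMDiffOn_inChart hf hχ, fun c hc x hx t ht => ?_, fun x hx u => ?_⟩
  · obtain ⟨L, hL⟩ := exists_chart_equiv hχ (χ.map_target hx)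
    have h0 : (fun s => inChart f χ x (c.symm s)) = L ∘ velocityCurve f c (χ.symm x) := by
      funext s; exact (hL _).symm
    have h1 : ∀ γ : ℝ → Plane, deriv (L ∘ γ) = L ∘ deriv γ := by
      intro γ
      funext s
      rw [← fderiv_apply_one_eq_deriv, L.comp_fderiv, Function.comp_apply,
        ← fderiv_apply_one_eq_deriv]
      rfl
    have hdet : planeDet (L : Plane →L[ℝ] Plane) ≠ 0 := planeDet_ne_zero L.injective
    have hmap : ∀ a b : Plane, area (L a) (L b) = planeDet (L : Plane →L[ℝ] Plane) * area a b :=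
      area_map (L : Plane →L[ℝ] Plane)
    obtain ⟨r1, r2⟩ := hreg c hc (χ.symm x) t ht
    have e0 : inChart f χ x (c.symm t) = L (velocityCurve f c (χ.symm x) t) := congrFun h0 t
    rw [h0, h1, h1, e0, Function.comp_apply, Function.comp_apply, hmap, hmap]
    exact ⟨mul_ne_zero hdet (area_ne_zero_iff.1 r1), mul_ne_zero hdet (area_ne_zero_iff.1 r2)⟩
  · obtain ⟨L, hL⟩ := exists_chart_equiv hχ (χ.map_target hx)
    obtain ⟨p, hp, hmax⟩ := hconv (χ.symm x) u
    set p' : Covec := p with hp'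
    have h0 : ∀ w, inChart f χ x w = L (f (χ.symm x) w) := fun w => (hL _).symm
    have h1 : ∀ y : Plane, p'.comp (L.symm : Plane →L[ℝ] Plane) (L y) = p' y := fun y => by simp
    refine ⟨p'.comp (L.symm : Plane →L[ℝ] Plane), fun h2 => hp ?_, fun w => ?_⟩
    · refine ContinuousLinearMap.ext fun y => ?_
      exact (h1 y).symm.trans (congrArg (fun ξ : Covec => ξ (L y)) h2)
    · rw [h0, h0]
      exact (h1 _).le.trans ((hmax w).trans (h1 _).ge)

/-- A flat system can be straightened in every chart. -/
theorem exists_straightening_of_isFlat (hf : IsFlat f)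
    (hχ : χ ∈ IsManifold.maximalAtlas (𝓡 2) ∞ M) {x₀ : Plane} (hx₀ : x₀ ∈ χ.target) :
    ∃ O φ, O ⊆ χ.target ∧ IsStraightening (maxHam (inChart f χ)) x₀ O φ := by
  obtain ⟨O, O', g, hq₀, hO, -, -, Θ, φ, ψ, hΘs, hΘt, hφs, hφt, hΘ, hφf⟩ := hf (χ.symm x₀)
  set e := χ.symm.trans φ.toOpenPartialHomeomorph with he
  have hes : e.source = χ.target ∩ χ.symm ⁻¹' O := by
    rw [← hφs]; exact OpenPartialHomeomorph.trans_source _ _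
  have hx₀e : x₀ ∈ e.source := by rw [hes]; exact ⟨hx₀, hq₀⟩
  have hsm : ContDiffOn ℝ ∞ e e.source := by
    rw [← contMDiffOn_iff_contDiffOn]
    exact φ.contMDiffOn_toFun.comp ((contMDiffOn_symm_of_mem_maximalAtlas hχ).mono
      fun x hx => hx.1) fun x hx => hx.2
  have hsm' : ContDiffOn ℝ ∞ e.symm e.target := by
    rw [← contMDiffOn_iff_contDiffOn]
    exact (contMDiffOn_of_mem_maximalAtlas hχ).comp (φ.contMDiffOn_invFun.mono
      fun x hx => hx.1) fun x hx => hx.2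
  have hd : ∀ x ∈ e.source, DifferentiableAt ℝ e x := fun x hx =>
    (hsm.contDiffAt (e.open_source.mem_nhds hx)).differentiableAt (by simp)
  have hd' : DifferentiableAt ℝ e.symm (e x₀) :=
    (hsm'.contDiffAt (e.open_target.mem_nhds (e.map_source hx₀e))).differentiableAt (by simp)
  have hinj : Function.Injective (fderiv ℝ e x₀) := by
    have h1 : HasFDerivAt (e.symm ∘ e) ((fderiv ℝ e.symm (e x₀)).comp (fderiv ℝ e x₀)) x₀ :=
      hd'.hasFDerivAt.comp x₀ (hd x₀ hx₀e).hasFDerivAt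
    have h2 : (e.symm ∘ e) =ᶠ[𝓝 x₀] id :=
      Filter.eventually_of_mem (e.open_source.mem_nhds hx₀e) fun x hx => e.left_inv hx
    have h3 := h1.unique ((hasFDerivAt_id x₀).congr_of_eventuallyEq h2)
    intro a b hab
    have h4 := congrArg (fun L : Plane →L[ℝ] Plane => L a) h3
    have h5 := congrArg (fun L : Plane →L[ℝ] Plane => L b) h3
    simp only [ContinuousLinearMap.comp_apply, ContinuousLinearMap.id_apply] at h4 h5
    rw [← h4, ← h5, hab]
  -- Composing the flat coordinates with the inverse of their differential at `x₀` makes them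
  -- tangent to the identity there; the model curve is replaced by its linear image.
  obtain ⟨L, hL⟩ := exists_equiv_of_planeDet (planeDet_ne_zero hinj)
  set φ₁ : Plane → Plane := fun x => L.symm (e x) with hφ₁
  have hφ₁s : ContDiffOn ℝ ∞ φ₁ e.source := L.symm.contDiff.comp_contDiffOn hsm
  have hfd : ∀ x ∈ e.source, fderiv ℝ φ₁ x = (L.symm : Plane →L[ℝ] Plane).comp (fderiv ℝ e x) :=
    fun x hx => ((L.symm : Plane →L[ℝ] Plane).hasFDerivAt.comp x (hd x hx).hasFDerivAt).fderiv
  have hbase : fderiv ℝ φ₁ x₀ = ContinuousLinearMap.id ℝ Plane := by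
    rw [hfd x₀ hx₀e, ← hL]; ext; simp
  have hdet : ContinuousOn (fun x => planeDet (fderiv ℝ φ₁ x)) e.source := by
    have h2 : Continuous planeDet := by unfold planeDet; fun_prop
    exact h2.comp_continuousOn (hφ₁s.fderiv_of_isOpen (m := ∞) e.open_source (by simp)).continuousOn
  -- the velocities
  have hvel : ∀ x ∈ e.source, ∀ u, fderiv ℝ φ₁ x (inChart f χ x u) =
      L.symm (g (ψ (χ.symm x) u)) := by
    intro x hx u
    have hx' := hx
    rw [hes] at hx'
    have hM := mdifferentiable_of_mem_maximalAtlas hχ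
    have h1 : fderiv ℝ e x = (mfderiv (𝓡 2) (𝓡 2) φ (χ.symm x)).comp
        (mfderiv (𝓡 2) (𝓡 2) χ.symm x) := by
      rw [← mfderiv_eq_fderiv]
      refine mfderiv_comp (I' := 𝓡 2) x (g := φ) (f := χ.symm) ?_
        (hM.mdifferentiableAt_symm hx'.1)
      have h2 : φ.source ∈ 𝓝 (χ.symm x) := φ.open_source.mem_nhds (by rw [hφs]; exact hx'.2)
      exact (φ.contMDiffOn_toFun.contMDiffAt h2).mdifferentiableAt (by simp)
    have h3 : mfderiv (𝓡 2) (𝓡 2) χ.symm x (inChart f χ x u) = f (χ.symm x) u := by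
      have h4 := hM.symm_comp_deriv (χ.map_target hx'.1)
      have h5 := congrArg (fun T => T (f (χ.symm x) u)) h4
      have h6 : ∀ y, y = x → (mfderiv (𝓡 2) (𝓡 2) χ.symm y (inChart f χ x u) : Plane) =
          mfderiv (𝓡 2) (𝓡 2) χ.symm x (inChart f χ x u) := by rintro _ rfl; rfl
      exact (h6 _ (χ.right_inv hx'.1)).symm.trans h5
    rw [hfd x hx, ContinuousLinearMap.comp_apply, h1]
    have h7 := hφf (χ.symm x) hx'.2 u
    change L.symm (mfderiv (𝓡 2) (𝓡 2) φ (χ.symm x)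
      (mfderiv (𝓡 2) (𝓡 2) χ.symm x (inChart f χ x u))) = _
    rw [h3]
    exact congrArg L.symm h7
  -- This makes the supremum over controls at each point a supremum over all controls of the model,
  -- which no longer depends on the point.
  have hsurj : ∀ q ∈ O, Function.Surjective (ψ q) := by
    intro q hq w
    have h1 : (φ q, w) ∈ Θ.target := by
      rw [hΘt]; exact ⟨by rw [← hφt]; exact φ.map_source (by rw [hφs]; exact hq), mem_univ _⟩
    have h2 := Θ.map_target h1
    rw [hΘs] at h2
    set y := Θ.invFun (φ q, w) with hy
    have h3 : Θ y = (φ q, w) := Θ.right_inv h1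
    have h4 := hΘ y.1 h2.1 y.2
    rw [Prod.mk.eta, h3] at h4
    have h5 : y.1 = q := φ.injOn (by rw [hφs]; exact h2.1) (by rw [hφs]; exact hq)
      (congrArg Prod.fst h4).symm
    refine ⟨y.2, ?_⟩
    rw [← h5]
    exact (congrArg Prod.snd h4).symm
  have hsup : ∀ x ∈ e.source, ∀ π : Covec, maxHam (inChart f χ) (x, π.comp (fderiv ℝ φ₁ x)) =
      ⨆ w, (π (L.symm (g w)) - 1) := by
    intro x hx π
    have hx' := hx
    rw [hes] at hx'
    rw [← (hsurj _ hx'.2).iSup_comp]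
    unfold maxHam
    congr 1
    funext u
    simp only [ContinuousLinearMap.comp_apply]
    rw [hvel x hx]
  refine ⟨e.source ∩ (fun x => planeDet (fderiv ℝ φ₁ x)) ⁻¹' Ioi 0, φ₁, ?_,
    hdet.isOpen_inter_preimage e.open_source isOpen_Ioi, ⟨hx₀e, ?_⟩,
    hφ₁s.mono inter_subset_left, hbase, fun x hx => hx.2, fun x hx π => ?_⟩
  · rw [hes]; exact fun x hx => hx.1.1
  · simp only [mem_preimage, mem_Ioi, hbase, planeDet, ContinuousLinearMap.id_apply, area_apply]
    simp [e₁, e₂]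
  · have h1 := hsup x₀ hx₀e π
    rw [hbase, ContinuousLinearMap.comp_id] at h1
    rw [hsup x hx.1, h1]

end

/-! ### From a straightening to a feedback equivalence. -/

section

variable {M U : Type*} [TopologicalSpace M] [ChartedSpace Plane M] [IsManifold (𝓡 2) ∞ M]
  [TopologicalSpace U] [ChartedSpace ℝ U] {f : (q : M) → U → TangentSpace (𝓡 2) q}

/-- A straightening and a change of controls flatten a system near a point. -/
theorem isFlat_of_straightening [IsManifold 𝓘(ℝ) ∞ U] [CompactSpace U] [Nonempty U] [T2Space U]
    [SecondCountableTopology U] (hf : IsControlSystem f) (hreg : IsRegular f)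
    (hconv : HasConvexVelocities f)
    (hstr : ∀ χ ∈ IsManifold.maximalAtlas (𝓡 2) ∞ M, ∀ x₀ ∈ χ.target,
      ∃ O φ, O ⊆ χ.target ∧ IsStraightening (maxHam (inChart f χ)) x₀ O φ) : IsFlat f := by
  intro q₀
  set χ := chartAt Plane q₀ with hχdef
  have hχ : χ ∈ IsManifold.maximalAtlas (𝓡 2) ∞ M :=
    IsManifold.chart_mem_maximalAtlas (I := 𝓡 2) (n := ∞) q₀
  have hq₀ : q₀ ∈ χ.source := mem_chart_source Plane q₀
  set x₀ := χ q₀ with hx₀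
  set F := inChart f χ with hFdef
  have hF : IsRegularSystem χ.target F := isRegularSystem_inChart hf hreg hconv hχ
  obtain ⟨O₁, φ₁, hO₁, hφ₁⟩ := hstr χ hχ x₀ (χ.map_source hq₀)
  set A : Plane → Plane →L[ℝ] Plane := fderiv ℝ φ₁ with hA
  have hAs : ContDiffOn ℝ ∞ A O₁ := hφ₁.smooth.fderiv_of_isOpen hφ₁.isOpen (by simp)
  -- The velocities pushed forward by `Dφ₁`: their support functions are the same at all points, so
  -- a change of controls turns `F' x` into `F' x₀`, the model system.
  set F' : Plane → U → Plane := fun x u => A x (F x u) with hF'def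
  have hF' : IsRegularSystem O₁ F' :=
    (hF.mono hφ₁.isOpen hO₁).map hAs fun x hx => (hφ₁.det_pos x hx).ne'
  have hsame : ∀ x ∈ O₁, ∀ π : Covec, maxHam F' (x, π) = maxHam F' (x₀, π) := by
    have h1 : ∀ x π, maxHam F' (x, π) = maxHam F (x, π.comp (A x)) := fun x π => rfl
    intro x hx π
    rw [h1, h1, hA, hφ₁.invariant x hx, hφ₁.base, ContinuousLinearMap.comp_id]
  obtain ⟨B, ψ, ρ, hBo, hxB, hBO, hψ, hρ, hB⟩ := hF'.exists_control_change hφ₁.mem hsame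
  have hφat : ∀ x ∈ O₁, ContDiffAt ℝ ∞ φ₁ x := fun x hx =>
    hφ₁.smooth.contDiffAt (hφ₁.isOpen.mem_nhds hx)
  have hequiv : ∀ x ∈ O₁, ∃ L : Plane ≃L[ℝ] Plane, HasFDerivAt φ₁ (L : Plane →L[ℝ] Plane) x := by
    intro x hx
    obtain ⟨L, hL⟩ := exists_equiv_of_planeDet (hφ₁.det_pos x hx).ne'
    exact ⟨L, by rw [hL]; exact ((hφat x hx).differentiableAt (by simp)).hasFDerivAt⟩
  -- the local diffeomorphism
  obtain ⟨L₀, hL₀⟩ := hequiv x₀ hφ₁.mem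
  -- The inverse function theorem gives local injectivity. Smoothness of the inverse on the whole
  -- image follows pointwise, since `Dφ₁` is invertible throughout the domain.
  set e₁ := (hφat x₀ hφ₁.mem).toOpenPartialHomeomorph φ₁ hL₀ (by simp) with he₁
  have he₁c : (e₁ : Plane → Plane) = φ₁ := ContDiffAt.toOpenPartialHomeomorph_coe _ _ _
  have hx₀e₁ : x₀ ∈ e₁.source := ContDiffAt.mem_toOpenPartialHomeomorph_source _ _ _
  set e := χ.trans (e₁.restr B) with he
  have hes : ∀ q, q ∈ e.source ↔ q ∈ χ.source ∧ χ q ∈ e₁.source ∧ χ q ∈ B := by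
    intro q
    rw [he, OpenPartialHomeomorph.trans_source, OpenPartialHomeomorph.restr_source,
      hBo.interior_eq]
    rfl
  have heq : ∀ q, e q = φ₁ (χ q) := fun q => by rw [← he₁c]; rfl
  have hχs : ContMDiffOn (𝓡 2) (𝓡 2) ∞ χ χ.source := contMDiffOn_of_mem_maximalAtlas hχ
  have hesm : ContMDiffOn (𝓡 2) (𝓡 2) ∞ e e.source := by
    have h1 : ContMDiffOn (𝓡 2) (𝓡 2) ∞ φ₁ O₁ := contMDiffOn_iff_contDiffOn.2 hφ₁.smooth
    exact (h1.comp (hχs.mono fun q hq => ((hes q).1 hq).1)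
      fun q hq => hBO ((hes q).1 hq).2.2).congr fun q _ => heq q
  have hesm' : ContMDiffOn (𝓡 2) (𝓡 2) ∞ e.symm e.target := by
    intro y hy
    have h1 := e.map_target hy
    obtain ⟨h2, h3, h4⟩ := (hes _).1 h1
    have hy1 : e₁ (χ (e.symm y)) = y := by rw [he₁c, ← heq]; exact e.right_inv hy
    have hys : e₁.symm y = χ (e.symm y) := by rw [← hy1, e₁.left_inv h3, hy1]
    have hyt : y ∈ e₁.target := by rw [← hy1]; exact e₁.map_source h3
    obtain ⟨L, hL⟩ := hequiv _ (hBO h4)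
    have h5 : ContDiffAt ℝ ∞ e₁.symm y := e₁.contDiffAt_symm (f₀' := L) hyt
      (by rw [hys, he₁c]; exact hL) (by rw [hys, he₁c]; exact hφat _ (hBO h4))
    refine ContMDiffAt.contMDiffWithinAt ?_
    exact ContMDiffAt.comp (g := χ.symm) (f := e₁.symm) y
      (contMDiffAt_symm_of_mem_maximalAtlas hχ (by rw [hys]; exact χ.map_source h2))
      h5.contMDiffAt
  -- the change of controls
  have hlift : ContMDiffOn ((𝓡 2).prod 𝓘(ℝ)) ((𝓡 2).prod 𝓘(ℝ)) ∞
      (fun x : M × U => (χ x.1, x.2)) (e.source ×ˢ univ) :=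
    (hχs.comp contMDiffOn_fst fun x hx => ((hes _).1 hx.1).1).prodMk contMDiffOn_snd
  have hback : ContMDiffOn ((𝓡 2).prod 𝓘(ℝ)) (𝓡 2) ∞ (fun y : Plane × U => e.symm y.1)
      (e.target ×ˢ univ) := hesm'.comp contMDiffOn_fst fun y hy => hy.1
  have hlift' : ContMDiffOn ((𝓡 2).prod 𝓘(ℝ)) ((𝓡 2).prod 𝓘(ℝ)) ∞
      (fun y : Plane × U => (χ (e.symm y.1), y.2)) (e.target ×ˢ univ) :=
    (hχs.comp hback fun y hy => ((hes _).1 (e.map_target hy.1)).1).prodMk contMDiffOn_snd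
  have hBs : ∀ q ∈ e.source, χ q ∈ B := fun q hq => ((hes q).1 hq).2.2
  let φ : PartialDiffeomorph (𝓡 2) (𝓡 2) M Plane ∞ :=
    ⟨e.toPartialEquiv, e.open_source, e.open_target, hesm, hesm'⟩
  let Θ : PartialDiffeomorph ((𝓡 2).prod 𝓘(ℝ)) ((𝓡 2).prod 𝓘(ℝ)) (M × U) (Plane × U) ∞ :=
    { toFun := fun x => (e x.1, ψ (χ x.1, x.2))
      invFun := fun y => (e.symm y.1, ρ (χ (e.symm y.1), y.2))
      source := e.source ×ˢ univ
      target := e.target ×ˢ univ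
      map_source' := fun x hx => ⟨e.map_source hx.1, mem_univ _⟩
      map_target' := fun y hy => ⟨e.map_target hy.1, mem_univ _⟩
      left_inv' := fun x hx => by
        simp only [e.left_inv hx.1, (hB _ (hBs _ hx.1) _).2.1]
      right_inv' := fun y hy => by
        simp only [e.right_inv hy.1, (hB _ (hBs _ (e.map_target hy.1)) _).2.2]
      open_source := e.open_source.prod isOpen_univ
      open_target := e.open_target.prod isOpen_univ
      contMDiffOn_toFun := (hesm.comp contMDiffOn_fst fun x hx => hx.1).prodMk
        (hψ.comp hlift fun x hx => ⟨hBs _ hx.1, mem_univ _⟩)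
      contMDiffOn_invFun := hback.prodMk
        (hρ.comp hlift' fun y hy => ⟨hBs _ (e.map_target hy.1), mem_univ _⟩) }
  have hg : ContMDiff 𝓘(ℝ) (𝓡 2) ∞ fun u : U => F' x₀ u := by
    rw [← contMDiffOn_univ]
    exact hF'.smooth.comp (f := fun u : U => (x₀, u))
      (contMDiff_const.prodMk contMDiff_id).contMDiffOn fun u _ => ⟨hφ₁.mem, mem_univ _⟩
  refine ⟨e.source, e.target, fun u => F' x₀ u, (hes q₀).2 ⟨hq₀, hx₀e₁, hxB⟩, e.open_source,
    e.open_target, hg, Θ, φ, fun q u => ψ (χ q, u), rfl, rfl, rfl, rfl, fun q _ u => rfl,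
    fun q hq u => ?_⟩
  obtain ⟨h1, h2, h3⟩ := (hes q).1 hq
  have h4 : mfderiv (𝓡 2) (𝓡 2) e q = (fderiv ℝ φ₁ (χ q)).comp (mfderiv (𝓡 2) (𝓡 2) χ q) := by
    rw [← mfderiv_eq_fderiv]
    have h5 : (e : M → Plane) = φ₁ ∘ χ := funext heq
    rw [h5]
    exact mfderiv_comp (I' := 𝓡 2) q
      ((hφat _ (hBO h3)).differentiableAt (by simp)).mdifferentiableAt
      ((mdifferentiable_of_mem_maximalAtlas hχ).mdifferentiableAt h1)
  have h6 : F' (χ q) u = F' x₀ (ψ (χ q, u)) := (hB _ h3 u).1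
  change mfderiv (𝓡 2) (𝓡 2) e q (f q u) = F' x₀ (ψ (χ q, u))
  rw [← h6, h4]
  exact congrArg (A (χ q)) (inChart_apply h1 u).symm

end

end FlatControl

end

theorem theorem6 {M U : Type*}
    [TopologicalSpace M] [T2Space M] [SecondCountableTopology M] [ConnectedSpace M]
    [ChartedSpace (EuclideanSpace ℝ (Fin 2)) M] [IsManifold (𝓡 2) ∞ M]
    [TopologicalSpace U] [T2Space U] [SecondCountableTopology U] [ConnectedSpace U]
    [CompactSpace U] [ChartedSpace ℝ U] [IsManifold 𝓘(ℝ) ∞ U]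
    (f : (q : M) → U → TangentSpace (𝓡 2) q)
    (hf : FlatControl.IsControlSystem f)
    (hreg : FlatControl.IsRegular f)
    (hconv : FlatControl.HasConvexVelocities f)
    (e : ℝ) (he : -1 < e) :
    FlatControl.IsFlat f ↔ FlatControl.InvariantsVanish f e := by
  have hham : ∀ χ ∈ IsManifold.maximalAtlas (𝓡 2) ∞ M,
      FlatControl.IsSmoothHam χ.target (FlatControl.maxHam (FlatControl.inChart f χ)) :=
    fun χ hχ => (FlatControl.isRegularSystem_inChart hf hreg hconv hχ).isSmoothHam
  constructor
  · intro hflat χ hχ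
    exact FlatControl.invariantsVanishOn_of_straightening (hham χ hχ) he fun x₀ hx₀ =>
      FlatControl.exists_straightening_of_isFlat hflat hχ hx₀
  · intro hinv
    exact FlatControl.isFlat_of_straightening hf hreg hconv fun χ hχ x₀ hx₀ =>
      (hham χ hχ).exists_straightening he (hinv χ hχ) hx₀
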